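/- Let $n\ge 1$, $N=2n$, $m=n-1$. Write $\langle X,Y\rangle=\sum_k x_ky_k$ on $\mathbb C^p$, $\omega(X,Y)=\langle X_2,Y_1\rangle-\langle X_1,Y_2\rangle$ for $X=(X_1,X_2)$, $Y=(Y_1,Y_2)\in\mathbb C^N=\mathbb C^n\times\mathbb C^n$, and $[a]=a/|a|$ for $a\ne0$. Let $(\mu,\delta)\in i\mathbb R\times\mathbb Z$. *Induced picture.* $V^\infty_{\mu,\delta}$ is the space of $f\in C^\infty(\mathbb C^N\setminus\{0\})$ with $f(aX)=|a|^{-\mu-N}[a]^{-\delta}f(X)$ for all $a\in\mathbb C^\times$, $X\neq 0$, and $V_{\mu,\delta}$ is its completion for the $L^2$-norm on the unit sphere $S\subset\mathbb C^N$ with its Euclidean surface measure $\sigma$. *Normalised Knapp–Stein operator.* For $f\in V^\infty_{-\mu,-\delta}$ and $Y\in S$ let $\mathcal T_{z,\delta}f(Y)$ be the meromorphic continuation to $z\in\mathbb C$ of $$\int_S f(X)\,|\mathrm{Re}\,\omega(X,Y)|^{-z-N}\,[\mathrm{Re}\,\omega(X,Y)]^{-\delta}\,d\sigma(X)\qquad(\mathrm{Re}\,z<1-N),$$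 and let $$C_N(z,\delta)=2\pi^{z+N-\frac12}\frac{\Gamma(\frac{1-z-N}2)}{\Gamma(\frac{z+N}2)}\ (\delta\text{ even}),\qquad C_N(z,\delta)=2i\,\pi^{z+N-\frac12}\frac{\Gamma(\frac{2-z-N}2)}{\Gamma(\frac{1+z+N}2)}\ (\delta\text{ odd}).$$ $\widetilde{\mathcal T}_{\mu,\delta}:V_{-\mu,-\delta}\to V_{\mu,\delta}$ is the bounded operator such that, for every $f\in V^\infty_{-\mu,-\delta}$, $\widetilde{\mathcal T}_{\mu,\delta}f$ on $S$ is the value at $z=\mu$ of the meromorphic function $\mathcal T_{z,\delta}f(Y)/C_N(z,\delta)$. *Non-standard model.* Let $\mathcal F$ be the partial Fourier transform on $L^2(\mathbb C\times\mathbb C^m\times\mathbb C^m)=L^2(\mathbb C^{2m+1})$, the bounded operator given on Schwartz functions by $$\mathcal Ff(\tau,X_1,\xi_2)=\int_{\mathbb C\times\mathbb C^m}f(t,X_1,X_2)\,e^{-2i\pi\,\mathrm{Re}(t\tau+\langle X_2,\xi_2\rangle)}\,dX_2\,dt,$$ and let $\alpha_{\mu,\delta}:V_{\mu,\delta}\to\mathcal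 U_{\mu,\delta}=L^2(\mathbb C^{2m+1})$ be the bounded operator with $\alpha_{\mu,\delta}f=\mathcal FF$, $F(t,X_1,X_2)=f(1,X_1,2t,X_2)$, for $f\in V^\infty_{\mu,\delta}$. Let $T_{\mu,\delta}$ be the bounded operator on $L^2(\mathbb C^{2m+1})$ $$T_{\mu,\delta}H(s,X_1,X_2)=\left|\tfrac s2\right|^{\mu}[s]^{\delta}\,H\!\left(s,\tfrac2sX_2,\tfrac s2X_1\right).$$ **Theorem.** The bounded operators $\mathcal F$, $\alpha_{\pm\mu,\pm\delta}$ (equal signs), $\widetilde{\mathcal T}_{\mu,\delta}$ and $T_{\mu,\delta}$ exist and are uniquely determined by the above descriptions, and $$\alpha_{\mu,\delta}\circ\widetilde{\mathcal T}_{\mu,\delta}=T_{\mu,\delta}\circ\alpha_{-\mu,-\delta}:\ V_{-\mu,-\delta}\to\mathcal U_{\mu,\delta}.$$ -/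

import Mathlib

open scoped ENNReal Topology ContDiff SchwartzMap
open MeasureTheory

namespace KnappStein

noncomputable section

/-! Throughout `n = m + 1` and `N = 2 n`, with `m ≥ 0` arbitrary. -/

/-- `ℂ^N = ℂ₁^n × ℂ₂^n` with its Hermitian norm; `Sum.inl` labels the coordinates of the first
factor and `Sum.inr` those of the second one. -/
abbrev CN (m : ℕ) : Type := EuclideanSpace ℂ (Fin (m + 1) ⊕ Fin (m + 1))

/-- The complex number `N = 2 n`. -/
def dimN (m : ℕ) : ℂ := 2 * ((m : ℂ) + 1)

/-- The complex symplectic form `ω(X, Y) = ⟨X₂, Y₁⟩ - ⟨X₁, Y₂⟩` (bilinear brackets). -/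
def omega {m : ℕ} (X Y : CN m) : ℂ :=
  ∑ i, X (Sum.inr i) * Y (Sum.inl i) - ∑ i, X (Sum.inl i) * Y (Sum.inr i)

/-- `[a] = a / |a|`. -/
def bracket (a : ℂ) : ℂ := a / (‖a‖ : ℂ)

/-- The unit sphere of `ℂ^N`, of real dimension `2 N - 1`. -/
abbrev Sph (m : ℕ) : Type := Metric.sphere (0 : CN m) 1

/-- The Euclidean surface measure of the unit sphere. -/
def sigma (m : ℕ) : Measure (Sph m) := (volume : Measure (CN m)).toSphere

instance (m : ℕ) : IsFiniteMeasure (sigma m) := by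
  unfold sigma; infer_instance

/-- `V^∞_{μ,δ}`: functions that are smooth on `ℂ^N ∖ {0}` and satisfy
`f(a X) = |a|^{-μ-N} [a]^{-δ} f(X)`. Their value at the origin is irrelevant. -/
def Vsmooth (m : ℕ) (μ : ℂ) (δ : ℤ) : Submodule ℂ (CN m → ℂ) where
  carrier := {f | ContDiffOn ℝ ∞ f {0}ᶜ ∧ ∀ a : ℂ, a ≠ 0 → ∀ X : CN m, X ≠ 0 →
    f (a • X) = (‖a‖ : ℂ) ^ (-μ - dimN m) * bracket a ^ (-δ) * f X}
  zero_mem' := ⟨contDiffOn_const, fun a _ X _ => by simp⟩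
  add_mem' := by
    rintro f g ⟨hf, hf'⟩ ⟨hg, hg'⟩
    refine ⟨hf.add hg, fun a ha X hX => ?_⟩
    simp only [Pi.add_apply, hf' a ha X hX, hg' a ha X hX]
    ring
  smul_mem' := by
    rintro c f ⟨hf, hf'⟩
    refine ⟨contDiffOn_const.smul hf, fun a ha X hX => ?_⟩
    simp only [Pi.smul_apply, smul_eq_mul, hf' a ha X hX]
    ring

/-- Restriction of `f ∈ V^∞_{μ,δ}` to the unit sphere, as a continuous function. -/
def restrictC {m : ℕ} {μ : ℂ} {δ : ℤ} (f : Vsmooth m μ δ) : C(Sph m, ℂ) where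
  toFun X := (f : CN m → ℂ) X
  continuous_toFun := f.2.1.continuousOn.comp_continuous continuous_subtype_val
    fun X => ne_zero_of_mem_unit_sphere X

/-- Restriction of `V^∞_{μ,δ}` to the unit sphere, as a linear map into `L²` of the sphere. -/
def restrictL (m : ℕ) (μ : ℂ) (δ : ℤ) : Vsmooth m μ δ →ₗ[ℂ] Lp ℂ 2 (sigma m) where
  toFun f := ContinuousMap.toLp 2 (sigma m) ℂ (restrictC f)
  map_add' f g := by
    rw [← map_add]; rfl
  map_smul' c f := by
    rw [RingHom.id_apply, ← map_smul]; rfl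

/-- The Hilbert space `V_{μ,δ}`: completion of `V^∞_{μ,δ}` for the `L²` norm on the unit sphere,
that is, the closure of `V^∞_{μ,δ}` in `L²` of the sphere. -/
def V (m : ℕ) (μ : ℂ) (δ : ℤ) : Submodule ℂ (Lp ℂ 2 (sigma m)) :=
  (LinearMap.range (restrictL m μ δ)).topologicalClosure

/-- The element of `V_{μ,δ}` defined by a function of `V^∞_{μ,δ}`. -/
def toV {m : ℕ} {μ : ℂ} {δ : ℤ} (f : Vsmooth m μ δ) : V m μ δ :=
  ⟨restrictL m μ δ f, Submodule.le_topologicalClosure _ (LinearMap.mem_range_self _ f)⟩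

/-! ### Knapp-Stein operators -/

/-- The Knapp-Stein integral
`∫_S f(X) |Re ω(X,Y)|^{-z-N} [Re ω(X,Y)]^{-δ} dσ(X)`,
absolutely convergent for `Re z < 1 - N` and `Y ≠ 0`. -/
def knappSteinIntegral {m : ℕ} (δ : ℤ) (f : CN m → ℂ) (Y : CN m) (z : ℂ) : ℂ :=
  ∫ X : Sph m, f X * ((|(omega (X : CN m) Y).re| : ℝ) : ℂ) ^ (-z - dimN m) *
    bracket ((omega (X : CN m) Y).re : ℂ) ^ (-δ) ∂(sigma m)

/-- The normalising factor `C_N(z,δ)`. -/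
def normFactor (m : ℕ) (z : ℂ) (δ : ℤ) : ℂ :=
  if Even δ then
    2 * (Real.pi : ℂ) ^ (z + dimN m - 1 / 2) *
      (Complex.Gamma ((1 - z - dimN m) / 2) / Complex.Gamma ((z + dimN m) / 2))
  else
    2 * Complex.I * (Real.pi : ℂ) ^ (z + dimN m - 1 / 2) *
      (Complex.Gamma ((2 - z - dimN m) / 2) / Complex.Gamma ((1 + z + dimN m) / 2))

/-- `w` is the value at `z = μ` of the meromorphic function `T_{z,δ} f(Y) / C_N(z,δ)`, where
`T_{z,δ} f(Y)` is the meromorphic continuation to `ℂ` of the Knapp-Stein integral. The value is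
taken as a limit, since both `T_{z,δ} f(Y)` and `C_N(z,δ)` may have a pole at `μ`. -/
def IsNormalizedKSValue {m : ℕ} (μ : ℂ) (δ : ℤ) (f : CN m → ℂ) (Y : CN m) (w : ℂ) : Prop :=
  ∃ Φ : ℂ → ℂ, MeromorphicOn Φ Set.univ ∧
    (∀ z : ℂ, z.re < 1 - (dimN m).re → Φ z = knappSteinIntegral δ f Y z) ∧
    Filter.Tendsto (fun z => Φ z / normFactor m z δ) (𝓝[≠] μ) (𝓝 w)

/-- `S : V_{-μ,-δ} → V_{μ,δ}` is the normalised Knapp-Stein operator: bounded, and given on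
`V^∞_{-μ,-δ}` by the meromorphically continued normalised Knapp-Stein integral. -/
def IsNormalizedKS (m : ℕ) (μ : ℂ) (δ : ℤ) (S : V m (-μ) (-δ) →L[ℂ] V m μ δ) : Prop :=
  ∀ f : Vsmooth m (-μ) (-δ), ∃ g : Sph m → ℂ,
    (∀ Y : Sph m, IsNormalizedKSValue μ δ (f : CN m → ℂ) (Y : CN m) (g Y)) ∧
      ((S (toV f) : Lp ℂ 2 (sigma m)) : Sph m → ℂ) =ᵐ[sigma m] g

/-- The normalised Knapp-Stein operator `V_{-μ,-δ} → V_{μ,δ}`. -/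
def normalizedKS (m : ℕ) (μ : ℂ) (δ : ℤ) : V m (-μ) (-δ) →L[ℂ] V m μ δ :=
  Classical.epsilon (IsNormalizedKS m μ δ)

/-! ### The non-standard model -/

/-- `ℂ^{2m+1} = ℂ × ℂ₁^m × ℂ₂^m`, with its Lebesgue measure (its norm plays no role). -/
abbrev HC (m : ℕ) : Type := ℂ × (Fin m → ℂ) × (Fin m → ℂ)

/-- `L²(ℂ^{2m+1})`. -/
abbrev L2 (m : ℕ) : Type := Lp ℂ 2 (volume : Measure (HC m))

/-- The integral
`∫ f(t,X₁,X₂) exp(-2iπ Re(t τ + ⟨X₂,ξ₂⟩)) dX₂ dt`, as a function of `(τ,X₁,ξ₂)`. -/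
def partialFourierIntegral {m : ℕ} (f : HC m → ℂ) (q : HC m) : ℂ :=
  ∫ p : ℂ × (Fin m → ℂ),
    f (p.1, q.2.1, p.2) *
      Complex.exp (-2 * Complex.I * Real.pi * ((p.1 * q.1 + ∑ i, p.2 i * q.2.2 i).re : ℂ))

/-- `P` is the partial Fourier transform in `(t,X₂)` on `L²(ℂ^{2m+1})`: bounded, and given by the
above integral on Schwartz functions. -/
def IsPartialFourier (m : ℕ) (P : L2 m →L[ℂ] L2 m) : Prop :=
  ∀ f : 𝓢(HC m, ℂ), ∃ hf : MemLp (f : HC m → ℂ) 2 (volume : Measure (HC m)),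
    (P (hf.toLp _) : HC m → ℂ) =ᵐ[volume] partialFourierIntegral (f : HC m → ℂ)

/-- The partial Fourier transform in `(t,X₂)` on `L²(ℂ^{2m+1})`. -/
def partialFourier (m : ℕ) : L2 m →L[ℂ] L2 m := Classical.epsilon (IsPartialFourier m)

/-- The point `(1,X₁,2t,X₂)` of `ℂ^N`. -/
def embedPoint {m : ℕ} (q : HC m) : CN m :=
  WithLp.toLp 2 (Sum.elim (Fin.cons 1 q.2.1) (Fin.cons (2 * q.1) q.2.2))

/-- The non-compact picture of `f`: `F(t,X₁,X₂) = f(1,X₁,2t,X₂)`. -/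
def nonCompact {m : ℕ} (f : CN m → ℂ) (q : HC m) : ℂ := f (embedPoint q)

/-- `A` is the map `α_{μ,δ} : V_{μ,δ} → U_{μ,δ} = L²(ℂ^{2m+1})`: bounded, and on `V^∞_{μ,δ}` the
restriction to the non-compact picture followed by the partial Fourier transform. -/
def IsAlpha (m : ℕ) (μ : ℂ) (δ : ℤ) (A : V m μ δ →L[ℂ] L2 m) : Prop :=
  ∀ f : Vsmooth m μ δ, ∃ hF : MemLp (nonCompact (f : CN m → ℂ)) 2 (volume : Measure (HC m)),
    A (toV f) = partialFourier m (hF.toLp _)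

/-- The map `α_{μ,δ}` from the induced picture to the non-standard model. -/
def alpha (m : ℕ) (μ : ℂ) (δ : ℤ) : V m μ δ →L[ℂ] L2 m := Classical.epsilon (IsAlpha m μ δ)

/-- `|s/2|^μ [s]^δ H(s, (2/s) X₂, (s/2) X₁)`, as a function of `(s,X₁,X₂)`. -/
def algebraicFun {m : ℕ} (μ : ℂ) (δ : ℤ) (H : HC m → ℂ) (q : HC m) : ℂ :=
  (‖q.1 / 2‖ : ℂ) ^ μ * bracket q.1 ^ δ * H (q.1, (2 / q.1) • q.2.2, (q.1 / 2) • q.2.1)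

/-- `T` is the bounded operator on `L²(ℂ^{2m+1})` given by the above algebraic formula. -/
def IsAlgebraicOp (m : ℕ) (μ : ℂ) (δ : ℤ) (T : L2 m →L[ℂ] L2 m) : Prop :=
  ∀ H : L2 m, (T H : HC m → ℂ) =ᵐ[volume] algebraicFun μ δ (H : HC m → ℂ)

/-- The algebraic operator `T_{μ,δ}` on `L²(ℂ^{2m+1})`. -/
def algebraicOp (m : ℕ) (μ : ℂ) (δ : ℤ) : L2 m →L[ℂ] L2 m :=
  Classical.epsilon (IsAlgebraicOp m μ δ)

end

end KnappStein

namespace KnappStein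

noncomputable section

/-! ### Measures in coordinates -/

/-! The normalised Knapp–Stein operator is the symplectic Fourier transform on homogeneous
functions, and `C_N(z,δ)` is the gamma factor of Tate's local functional equation over ℝ. Given `f`
in `V^∞_{-μ,-δ}`, let `G = cutoff f` be its product with a radial bump, `M` the Mellin transform of
the bump and `Ĝ = sympFT G`. In polar coordinates, `∫ G(X) |Re ω(X,Y)|^{-z-N} [Re ω(X,Y)]^{-δ} dX`
is the Knapp–Stein integral times `M(μ-z)` (`integral_cutoff_mul_homChar`). For `0 < Re(z+N) < 1`,
the functional equation along the linear form `Re ω(·,Y)` (`mellin_linear_form_eq`) equates this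
integral with `C_N(z,δ)` times the Mellin transform of `r ↦ Ĝ(rY)` at `z+N`. The latter is
holomorphic for `Re z > -N`, so the normalised value at `μ` is `M(0)⁻¹ ∫₀^∞ r^{μ+N-1} Ĝ(rY) dr`,
which is `normalizedFun f`.

The intertwining relation is then proved by duality. Extend `𝓕ψ` from the affine chart to ℂ^N,
homogeneously of type `(μ-N, δ)`. Its integral against `Ĝ` is `8π M(0)` times the chart pairing of
`normalizedFun f` with `𝓕ψ` (`integral_mul_extHom`). Split ℂ^N as ℂ^n × ℂ^n. On the slice over `y`,
the extension of `𝓕ψ` is the Fourier transform in `η` of `kern μ δ ψ y η`, a multiple of `ψ(2y₀η₀,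
y'/y₀, y₀η')`. Since `Re ω((x,x'),(y,y')) = Re⟨x',y⟩ - Re⟨x,y'⟩`, a partial Fourier transform in the
second half reduces the symplectic one to an exchange of two variables (`ae_WF_sympFT`). Exchanging
`y` and `η` in the kernel fixes `s = 2y₀η₀`, swaps the other two arguments up to the factors `2/s`
and `s/2`, and multiplies by the character of `y₀η₀ = s/2`: this is exactly `T_{μ,δ}`
(`kern_algebraicFun`). Hence `⟨normalizedFun f, 𝓕ψ⟩ = ⟨f, 𝓕Tψ⟩` in the chart.

`𝓕` and `T` are symmetric for the bilinear pairing, so this identity reads `𝓕(normalizedFun f) =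
T𝓕f` (`PF_normalizedFun`). The chart map is √(8π)⁻¹ times an isometry onto `L²` and `𝓕` is unitary,
so `α` is invertible. The operator `α⁻¹Tα` is therefore bounded and has the prescribed values on
`V^∞`, which gives existence together with the commuting square. Uniqueness follows from density and
the identity theorem for meromorphic functions. -/

lemma det_lsmul_complex (E : Type*) [AddCommGroup E] [Module ℂ E]  [Module.Finite ℂ E] (c : ℂ) :
    LinearMap.det ((c • LinearMap.id : E →ₗ[ℂ] E).restrictScalars ℝ) =
      ‖c‖ ^ (2 * Module.finrank ℂ E) := by
  rw [LinearMap.det_restrictScalars, LinearMap.det_smul]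
  simp [Algebra.norm_complex_apply, Complex.normSq_eq_norm_sq, ← pow_mul, mul_comm]

/-- Multiplication by a nonzero complex number scales a Haar measure. -/
lemma map_complex_smul (E : Type*) [NormedAddCommGroup E] [NormedSpace ℂ E]
    [FiniteDimensional ℂ E] [MeasurableSpace E] [BorelSpace E] (ν : Measure E)
    [ν.IsAddHaarMeasure] {c : ℂ} (hc : c ≠ 0) :
    ν.map (fun x => c • x) = ENNReal.ofReal ((‖c‖ ^ (2 * Module.finrank ℂ E))⁻¹) • ν := by
  have : FiniteDimensional ℝ E := FiniteDimensional.complexToReal E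
  have h := Measure.map_linearMap_addHaar_eq_smul_addHaar ν
    (f := (c • LinearMap.id : E →ₗ[ℂ] E).restrictScalars ℝ)
    (by rw [det_lsmul_complex]; exact pow_ne_zero _ (norm_ne_zero_iff.2 hc))
  rw [det_lsmul_complex, abs_of_nonneg (by positivity)] at h
  exact h

/-- Forgetting the Hermitian norm preserves the volume of `ℂ^ι`. -/
lemma volume_preserving_ofLp_complex (ι : Type*) [Fintype ι] :
    MeasurePreserving (WithLp.ofLp : EuclideanSpace ℂ ι → ι → ℂ) := by
  have hmeas : Measurable (WithLp.ofLp : EuclideanSpace ℂ ι → ι → ℂ) := WithLp.measurable_ofLp ..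
  refine ⟨hmeas, ?_⟩
  set e : EuclideanSpace ℂ ι ≃L[ℝ] (ι → ℂ) :=
    (PiLp.continuousLinearEquiv 2 ℝ (fun _ : ι => ℂ)) with he
  have : (Measure.map (WithLp.ofLp : EuclideanSpace ℂ ι → ι → ℂ) volume).IsAddHaarMeasure :=
    e.isAddHaarMeasure_map volume
  set ν : Measure (ι → ℂ) := Measure.map (WithLp.ofLp : EuclideanSpace ℂ ι → ι → ℂ) volume with hν
  -- Both measures are Haar, hence proportional. The Gaussian has integral `π ^ card ι` for each of
  -- them, so the factor is 1.
  have h1 := Measure.isAddLeftInvariant_eq_smul ν (volume : Measure (ι → ℂ))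
  set c := ν.addHaarScalarFactor (volume : Measure (ι → ℂ))
  have h2 : ∫ x : ι → ℂ, Real.exp (-1 * ∑ i, ‖x i‖ ^ 2) ∂ν =
      (Real.pi) ^ (Fintype.card ι) := by
    rw [hν, integral_map hmeas.aemeasurable
      (Continuous.aestronglyMeasurable (by fun_prop))]
    have := GaussianFourier.integral_rexp_neg_mul_sq_norm (V := EuclideanSpace ℂ ι) one_pos
    have hd : Module.finrank ℝ (EuclideanSpace ℂ ι) = 2 * Fintype.card ι := by
      rw [← Module.finrank_mul_finrank ℝ ℂ (EuclideanSpace ℂ ι)]; simp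
    rw [hd] at this
    simp only [EuclideanSpace.norm_sq_eq] at this
    rw [this]; simp
  have h3 : ∫ x : ι → ℂ, Real.exp (-1 * ∑ i, ‖x i‖ ^ 2) = (Real.pi) ^ (Fintype.card ι) := by
    simp_rw [Finset.mul_sum, Real.exp_sum]
    rw [integral_fintype_prod_volume_eq_prod (fun _ (z : ℂ) => Real.exp (-1 * ‖z‖ ^ 2))]
    have := GaussianFourier.integral_rexp_neg_mul_sq_norm (V := ℂ) one_pos
    rw [this]; simp
  rw [h1, integral_smul_nnreal_measure, h3] at h2
  have h4 : c = 1 := by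
    have : (0:ℝ) < Real.pi ^ (Fintype.card ι) := by positivity
    have h5 : (c : ℝ) * Real.pi ^ (Fintype.card ι) = Real.pi ^ (Fintype.card ι) := by
      simp only [NNReal.smul_def, smul_eq_mul] at h2
      exact h2
    have : (c : ℝ) = 1 := by
      field_simp at h5; exact h5
    exact_mod_cast this
  rw [h1, h4, one_smul]

lemma volume_preserving_toLp_complex (ι : Type*) [Fintype ι] :
    MeasurePreserving (WithLp.toLp 2 : (ι → ℂ) → EuclideanSpace ℂ ι) :=
  (volume_preserving_ofLp_complex ι).symm (MeasurableEquiv.toLp 2 (ι → ℂ)).symm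

/-- The space `ℂ^n` of each half of the coordinates. -/
abbrev WC (m : ℕ) : Type := EuclideanSpace ℂ (Fin (m + 1))

/-- `ℂ × ℂ^m ≃ ℂ^n`. -/
def consW (m : ℕ) : ℂ × (Fin m → ℂ) ≃ᵐ WC m :=
  (MeasurableEquiv.piFinSuccAbove (fun _ => ℂ) 0).symm.trans (MeasurableEquiv.toLp 2 _)

lemma consW_apply {m : ℕ} (p : ℂ × (Fin m → ℂ)) :
    consW m p = WithLp.toLp 2 (Fin.cons p.1 p.2 : Fin (m + 1) → ℂ) := by
  simp [consW, MeasurableEquiv.piFinSuccAbove, Fin.insertNthEquiv]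

lemma consW_symm_apply {m : ℕ} (w : WC m) : (consW m).symm w = (w 0, fun i => w i.succ) := by
  rw [MeasurableEquiv.symm_apply_eq, consW_apply]
  ext i
  refine Fin.cases ?_ (fun j => ?_) i <;> simp

lemma volume_preserving_consW (m : ℕ) : MeasurePreserving (consW m) :=
  (volume_preserving_toLp_complex _).comp
    ((volume_preserving_piFinSuccAbove (fun _ : Fin (m + 1) => ℂ) 0).symm _)

/-- `ℂ^n × ℂ^n ≃ ℂ^N`. -/
def joinW (m : ℕ) : WC m × WC m ≃ᵐ CN m :=
  ((MeasurableEquiv.toLp 2 (Fin (m + 1) → ℂ)).symm.prodCongr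
    (MeasurableEquiv.toLp 2 (Fin (m + 1) → ℂ)).symm).trans
    ((MeasurableEquiv.sumPiEquivProdPi (fun _ : Fin (m + 1) ⊕ Fin (m + 1) => ℂ)).symm.trans
      (MeasurableEquiv.toLp 2 _))

lemma joinW_apply {m : ℕ} (p : WC m × WC m) :
    joinW m p = WithLp.toLp 2 (Sum.elim p.1 p.2) := by
  ext i
  rcases i with i | i <;> rfl

lemma volume_preserving_joinW (m : ℕ) : MeasurePreserving (joinW m) := by
  refine (volume_preserving_toLp_complex _).comp
    ((volume_measurePreserving_sumPiEquivProdPi_symm _).comp ?_)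
  exact (volume_preserving_ofLp_complex _).prod (volume_preserving_ofLp_complex _)

/-! ### Polar coordinates and the affine chart -/

lemma finrank_real_CN (m : ℕ) : Module.finrank ℝ (CN m) = 4 * m + 4 := by
  rw [← Module.finrank_mul_finrank ℝ ℂ (CN m)]; simp; ring

/-- Polar coordinates on `ℂ^N`. -/
def radialMeasure (m : ℕ) : Measure ℝ :=
  (volume.restrict (Set.Ioi 0)).withDensity fun r => ENNReal.ofReal (r ^ (4 * m + 3))

instance (m : ℕ) : SFinite (radialMeasure m) := by
  unfold radialMeasure; infer_instance

/-- The exponent `4m+3` of `radialMeasure` is the real dimension `2N = 4m+4` minus one. A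
push-forward from sphere × ℝ lets Fubini apply without subtypes. -/
lemma map_polar (m : ℕ) :
    Measure.map (fun p : Sph m × ℝ => p.2 • (p.1 : CN m)) ((sigma m).prod (radialMeasure m)) =
      volume := by
  have hm : Measurable (fun p : Sph m × ℝ => p.2 • (p.1 : CN m)) := by fun_prop
  refine Measure.ext_of_lintegral _ fun K hK => ?_
  have h := (volume : Measure (CN m)).measurePreserving_homeomorphUnitSphereProd
  have h1 : ∫⁻ X, K X = ∫⁻ X : ({0}ᶜ : Set (CN m)), K X ∂(volume.comap Subtype.val) := by
    rw [lintegral_subtype_comap (measurableSet_singleton _).compl, restrict_compl_singleton]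
  have h2 : ∫⁻ X : ({0}ᶜ : Set (CN m)), K X ∂(volume.comap Subtype.val) =
      ∫⁻ p : Sph m × Set.Ioi (0 : ℝ), K ((p.2 : ℝ) • (p.1 : CN m))
        ∂((sigma m).prod (Measure.volumeIoiPow (Module.finrank ℝ (CN m) - 1))) := by
    rw [sigma, ← h.lintegral_comp (by fun_prop)]
    refine lintegral_congr fun X => ?_
    have := (homeomorphUnitSphereProd (CN m)).symm_apply_apply X
    have h3 := congrArg Subtype.val this
    rw [homeomorphUnitSphereProd_symm_apply_coe] at h3
    rw [h3]
  rw [h1, h2, lintegral_map hK hm, lintegral_prod _ (by fun_prop), lintegral_prod _ (by fun_prop)]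
  refine lintegral_congr fun X => ?_
  rw [Measure.volumeIoiPow, lintegral_withDensity_eq_lintegral_mul _ (by fun_prop) (by fun_prop),
    radialMeasure, lintegral_withDensity_eq_lintegral_mul _ (by fun_prop) (by fun_prop),
    finrank_real_CN]
  exact (lintegral_subtype_comap measurableSet_Ioi (fun r : ℝ =>
    ENNReal.ofReal (r ^ (4 * m + 3)) * K (r • (X : CN m)))).symm

/-- Coordinates `(x₀, x₀', X₁, X₂)` on `ℂ^N`. -/
def coordCN (m : ℕ) (p : ℂ × HC m) : CN m :=
  joinW m (consW m (p.1, p.2.2.1), consW m (p.2.1, p.2.2.2))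

lemma measurable_coordCN (m : ℕ) : Measurable (coordCN m) := by
  unfold coordCN; fun_prop

lemma volume_preserving_coordCN (m : ℕ) : MeasurePreserving (coordCN m) := by
  refine ⟨measurable_coordCN m, Measure.ext_of_lintegral _ fun K hK => ?_⟩
  have hj := ((volume_preserving_joinW m).comp
    ((volume_preserving_consW m).prod (volume_preserving_consW m)))
  rw [lintegral_map hK (measurable_coordCN m), ← hj.lintegral_comp hK]
  have hK' : Measurable fun p : (ℂ × (Fin m → ℂ)) × (ℂ × (Fin m → ℂ)) =>
    K (joinW m (consW m p.1, consW m p.2)) := by fun_prop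
  change ∫⁻ p : ℂ × (ℂ × (Fin m → ℂ) × (Fin m → ℂ)), _ ∂(volume.prod (volume.prod
    (volume.prod volume))) =
    ∫⁻ p : (ℂ × (Fin m → ℂ)) × (ℂ × (Fin m → ℂ)), K (joinW m (consW m p.1, consW m p.2))
      ∂((volume.prod volume).prod (volume.prod volume))
  have hm : Measurable fun p : ℂ × ℂ × (Fin m → ℂ) × (Fin m → ℂ) => K (coordCN m p) :=
    hK.comp (measurable_coordCN m)
  rw [lintegral_prod _ hm.aemeasurable, lintegral_prod _ hK'.aemeasurable,
    lintegral_prod _ (by fun_prop)]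
  refine lintegral_congr fun a => ?_
  simp only [coordCN]
  rw [lintegral_prod _ (by fun_prop)]
  calc _ = ∫⁻ b : ℂ, ∫⁻ A : Fin m → ℂ, ∫⁻ B : Fin m → ℂ,
      K (joinW m (consW m (a, A), consW m (b, B))) :=
        lintegral_congr fun b => lintegral_prod _ (by fun_prop)
    _ = ∫⁻ A : Fin m → ℂ, ∫⁻ b : ℂ, ∫⁻ B : Fin m → ℂ,
      K (joinW m (consW m (a, A), consW m (b, B))) := by
        refine lintegral_lintegral_swap (Measurable.aemeasurable ?_)
        exact Measurable.lintegral_prod_right' (f := fun p : (ℂ × (Fin m → ℂ)) × (Fin m → ℂ) =>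
          K (joinW m (consW m (a, p.1.2), consW m (p.1.1, p.2)))) (by fun_prop)
    _ = _ := lintegral_congr fun A => (lintegral_prod (fun p : ℂ × (Fin m → ℂ) =>
        K (joinW m (consW m (a, A), consW m p))) (by fun_prop)).symm

/-- Scaling `(t, X₁, X₂) ↦ (2 a t, a X₁, a X₂)`. -/
def scaleHC {m : ℕ} (a : ℂ) (q : HC m) : HC m := (2 * a * q.1, a • q.2.1, a • q.2.2)

lemma map_scaleHC (m : ℕ) {a : ℂ} (ha : a ≠ 0) :
    Measure.map (scaleHC (m := m) a) volume =
      ENNReal.ofReal ((4 * ‖a‖ ^ (4 * m + 2))⁻¹) • volume := by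
  have h1 := map_complex_smul ℂ volume (c := 2 * a) (by simp [ha])
  have h2 := map_complex_smul (Fin m → ℂ) volume ha
  have : scaleHC (m := m) a = Prod.map (fun x : ℂ => (2 * a) • x)
    (Prod.map (fun x : Fin m → ℂ => a • x) (fun x : Fin m → ℂ => a • x)) := rfl
  rw [this]
  change Measure.map _ (volume.prod (volume.prod volume)) = _ • (volume.prod (volume.prod volume))
  rw [← Measure.map_prod_map _ _ (by fun_prop) (by fun_prop),
    ← Measure.map_prod_map _ _ (by fun_prop) (by fun_prop), h1, h2]
  simp only [Measure.prod_smul_left, Measure.prod_smul_right, smul_smul]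
  rw [← ENNReal.ofReal_mul (by positivity), ← ENNReal.ofReal_mul (by positivity)]
  congr 2
  simp only [Module.finrank_self, Module.finrank_fin_fun, norm_mul, Complex.norm_ofNat, mul_one]
  rw [← mul_inv, ← mul_inv]
  congr 1
  ring

lemma coordCN_scaleHC {m : ℕ} (a : ℂ) (q : HC m) :
    coordCN m (a, scaleHC a q) = a • embedPoint q := by
  ext i
  simp only [coordCN, joinW_apply, consW_apply, scaleHC, embedPoint]
  rcases i with i | i <;> refine Fin.cases ?_ (fun j => ?_) i <;> simp
  ring

lemma measurable_embedPoint (m : ℕ) : Measurable (embedPoint (m := m)) := by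
  have h : embedPoint (m := m) = fun q => coordCN m (1, scaleHC 1 q) := by
    ext1 q; rw [coordCN_scaleHC, one_smul]
  rw [h]
  have := measurable_coordCN m
  unfold scaleHC
  fun_prop

/-- The measure on `ℂ^×` occurring in the coordinates `X = a (1, X₁, 2t, X₂)`. -/
def chartMeasure (m : ℕ) : Measure ℂ :=
  volume.withDensity fun a => ENNReal.ofReal (4 * ‖a‖ ^ (4 * m + 2))

instance (m : ℕ) : SFinite (chartMeasure m) := by
  unfold chartMeasure; infer_instance

/-- For fixed `a ≠ 0` the last `2m+1` coordinates of `a(1,X₁,2t,X₂)` are a scaling of `(t,X₁,X₂)`,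
with Jacobian `|2a|²|a|^{4m}`. This is the density of `chartMeasure`. -/
lemma map_chart (m : ℕ) :
    Measure.map (fun p : ℂ × HC m => p.1 • embedPoint p.2) ((chartMeasure m).prod volume) =
      volume := by
  have he := measurable_embedPoint m
  have hm : Measurable (fun p : ℂ × HC m => p.1 • embedPoint p.2) := by fun_prop
  refine Measure.ext_of_lintegral _ fun K hK => ?_
  rw [lintegral_map hK hm, lintegral_prod _ (by fun_prop), chartMeasure,
    lintegral_withDensity_eq_lintegral_mul _ (by fun_prop)
      (Measurable.lintegral_prod_right' (f := fun p : ℂ × HC m => K (p.1 • embedPoint p.2))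
        (by fun_prop)),
    ← (volume_preserving_coordCN m).lintegral_comp hK]
  have hm' : Measurable fun p : ℂ × HC m => K (coordCN m p) :=
    hK.comp (measurable_coordCN m)
  change _ = ∫⁻ p : ℂ × HC m, _ ∂(volume.prod volume)
  rw [lintegral_prod _ hm'.aemeasurable]
  refine lintegral_congr_ae ?_
  have h0 : ∀ᵐ a : ℂ, a ≠ 0 := by
    simp [ae_iff, measure_singleton]
  filter_upwards [h0] with a ha
  have hs : Measurable (scaleHC (m := m) a) := by unfold scaleHC; fun_prop
  have hKa : Measurable fun q : HC m => K (coordCN m (a, q)) := hm'.comp (by fun_prop)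
  have h := lintegral_map (μ := volume) hKa hs
  rw [map_scaleHC m ha, lintegral_smul_measure] at h
  simp only [Pi.mul_apply, coordCN_scaleHC] at h ⊢
  rw [← h, smul_eq_mul, ← mul_assoc, ← ENNReal.ofReal_mul (by positivity), mul_inv_cancel₀
    (by positivity), ENNReal.ofReal_one, one_mul]

/-- Polar coordinates for radial functions on `ℂ`. -/
lemma lintegral_radial_complex {h : ℝ → ℝ≥0∞} (hh : Measurable h) :
    ∫⁻ z : ℂ, h ‖z‖ = ENNReal.ofReal (2 * Real.pi) *
      ∫⁻ r in Set.Ioi (0 : ℝ), ENNReal.ofReal r * h r := by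
  rw [← Complex.lintegral_comp_polarCoord_symm]
  simp only [Complex.norm_polarCoord_symm, smul_eq_mul, polarCoord_target]
  rw [Measure.volume_eq_prod]
  rw [← Measure.prod_restrict, lintegral_prod_symm _ (by fun_prop)]
  have : ∀ θ : ℝ, ∫⁻ r in Set.Ioi (0 : ℝ), ENNReal.ofReal r * h |r| =
      ∫⁻ r in Set.Ioi (0 : ℝ), ENNReal.ofReal r * h r := fun _ =>
    setLIntegral_congr_fun measurableSet_Ioi fun r hr => by simp only [abs_of_pos (Set.mem_Ioi.1 hr)]
  rw [lintegral_congr this, lintegral_const, Measure.restrict_apply_univ, Real.volume_Ioo, mul_comm]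
  congr 2
  ring

/-- `dr/r` is scale invariant, so the window `1 < rR < 2` has mass `log 2` for every `R`. -/
lemma lintegral_inv_Ioo {R : ℝ} (hR : 0 < R) :
    ∫⁻ r in Set.Ioi (0 : ℝ), ENNReal.ofReal r⁻¹ * (Set.Ioo 1 2).indicator 1 (r * R) =
      ENNReal.ofReal (Real.log 2) := by
  have h1 : ∀ r : ℝ, ENNReal.ofReal r⁻¹ * (Set.Ioo 1 2).indicator 1 (r * R) =
      (Set.Ioo (1 / R) (2 / R)).indicator (fun r => ENNReal.ofReal r⁻¹) r := fun r => by
    simp only [Set.indicator, Set.mem_Ioo, div_lt_iff₀ hR, lt_div_iff₀ hR, Pi.one_apply, mul_ite,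
      mul_one, mul_zero]
  simp only [h1]
  rw [setLIntegral_indicator measurableSet_Ioo]
  have h2 : Set.Ioo (1 / R) (2 / R) ∩ Set.Ioi 0 = Set.Ioo (1 / R) (2 / R) := by
    refine Set.inter_eq_left.2 fun r hr => ?_
    exact lt_trans (by positivity) hr.1
  have hle : 1 / R ≤ 2 / R := by gcongr; norm_num
  have h0 : (0 : ℝ) ∉ Set.uIcc (1 / R) (2 / R) := by
    rw [Set.uIcc_of_le hle]
    intro h
    have : 0 < 1 / R := by positivity
    linarith [h.1]
  have hint : IntegrableOn (fun r : ℝ => r⁻¹) (Set.Ioo (1 / R) (2 / R)) := by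
    have := (intervalIntegral.intervalIntegrable_inv (f := fun r : ℝ => r) (μ := volume)
      (fun x hx h => h0 (h ▸ hx)) continuous_id.continuousOn)
    rw [intervalIntegrable_iff_integrableOn_Ioo_of_le hle] at this
    exact this
  rw [h2, ← ofReal_integral_eq_lintegral_ofReal hint]
  · rw [← integral_Ioc_eq_integral_Ioo, ← intervalIntegral.integral_of_le hle,
      integral_inv h0]
    congr 2
    field_simp
  · filter_upwards [ae_restrict_mem measurableSet_Ioo] with r hr
    exact inv_nonneg.2 (lt_trans (by positivity) hr.1).le

lemma embedPoint_ne_zero {m : ℕ} (q : HC m) : embedPoint q ≠ 0 := by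
  intro h
  have := congrArg (fun X : CN m => X (Sum.inl 0)) h
  simp [embedPoint] at this

/-- Comparison of the sphere and of the affine chart: densities on the projective space. -/
lemma lintegral_sphere_eq {m : ℕ} {k : CN m → ℝ≥0∞} (hk : Measurable k)
    (hom : ∀ a : ℂ, a ≠ 0 → ∀ X : CN m, X ≠ 0 →
      k (a • X) = ENNReal.ofReal ((‖a‖ ^ (4 * m + 4))⁻¹) * k X) :
    ∫⁻ X : Sph m, k X ∂(sigma m) =
      ENNReal.ofReal (8 * Real.pi) * ∫⁻ q : HC m, k (embedPoint q) := by
  have he := measurable_embedPoint m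
  -- `k` restricted to the shell `1 < ‖X‖ < 2` is integrated over ℂ^N in two ways. As `k` has degree
  -- `-2N`, both radial integrals reduce to `dr/r` and give `log 2`. The chart adds the factor 4 of
  -- its Jacobian and the `2π` of the phase of `a`, whence `8π`.
  set A : ℝ → ℝ≥0∞ := (Set.Ioo 1 2).indicator 1
  have hA : Measurable A := measurable_const.indicator measurableSet_Ioo
  have hKm : Measurable fun X : CN m => A ‖X‖ * k X := by fun_prop
  have h1 : ∫⁻ X : CN m, A ‖X‖ * k X =
      ENNReal.ofReal (Real.log 2) * ∫⁻ X : Sph m, k X ∂(sigma m) := by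
    rw [← map_polar m, lintegral_map hKm (by fun_prop), lintegral_prod _ (by fun_prop),
      ← lintegral_const_mul _ (by fun_prop)]
    refine lintegral_congr fun X => ?_
    rw [radialMeasure, lintegral_withDensity_eq_lintegral_mul _ (by fun_prop) (by fun_prop),
      ← lintegral_inv_Ioo one_pos, ← lintegral_mul_const _ (by
        have := measurableSet_Ioo (a := (1 : ℝ)) (b := 2); fun_prop (disch := assumption))]
    refine setLIntegral_congr_fun measurableSet_Ioi fun r (hr : 0 < r) => ?_
    have h2 : k (r • (X : CN m)) = ENNReal.ofReal ((r ^ (4 * m + 4))⁻¹) * k X := by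
      have := hom (r : ℂ) (by exact_mod_cast hr.ne') X (ne_zero_of_mem_unit_sphere X)
      rw [Complex.norm_real, Real.norm_of_nonneg hr.le] at this
      exact this
    have h3 : ‖r • (X : CN m)‖ = r * 1 := by
      rw [norm_smul, Real.norm_of_nonneg hr.le, norm_eq_of_mem_sphere X]
    simp only [Pi.mul_apply, h2, h3]
    have h4 : ENNReal.ofReal (r ^ (4 * m + 3)) * ENNReal.ofReal ((r ^ (4 * m + 4))⁻¹) =
        ENNReal.ofReal r⁻¹ := by
      rw [← ENNReal.ofReal_mul (by positivity)]
      congr 1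
      field_simp
      ring
    rw [← h4]
    ring
  have h2 : ∫⁻ X : CN m, A ‖X‖ * k X =
      ENNReal.ofReal (Real.log 2) * (ENNReal.ofReal (8 * Real.pi) *
        ∫⁻ q : HC m, k (embedPoint q)) := by
    rw [← map_chart m, lintegral_map hKm (by fun_prop), lintegral_prod_symm _ (by fun_prop),
      ← mul_assoc, ← lintegral_const_mul _ (by fun_prop)]
    refine lintegral_congr fun q => ?_
    set R := ‖embedPoint q‖ with hR
    have hR0 : 0 < R := norm_pos_iff.2 (embedPoint_ne_zero q)
    rw [chartMeasure, lintegral_withDensity_eq_lintegral_mul _ (by fun_prop) (by fun_prop)]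
    have h3 : ∀ᵐ a : ℂ, ENNReal.ofReal (4 * ‖a‖ ^ (4 * m + 2)) *
        (A ‖a • embedPoint q‖ * k (a • embedPoint q)) =
        ENNReal.ofReal 4 * k (embedPoint q) *
          (ENNReal.ofReal (‖a‖⁻¹ * ‖a‖⁻¹) * A (‖a‖ * R)) := by
      have h0 : ∀ᵐ a : ℂ, a ≠ 0 := by simp [ae_iff, measure_singleton]
      filter_upwards [h0] with a ha
      have ha' : 0 < ‖a‖ := norm_pos_iff.2 ha
      rw [hom a ha _ (embedPoint_ne_zero q), norm_smul, ← hR]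
      have : ENNReal.ofReal (4 * ‖a‖ ^ (4 * m + 2)) * ENNReal.ofReal ((‖a‖ ^ (4 * m + 4))⁻¹) =
          ENNReal.ofReal 4 * ENNReal.ofReal (‖a‖⁻¹ * ‖a‖⁻¹) := by
        rw [← ENNReal.ofReal_mul (by positivity), ← ENNReal.ofReal_mul (by positivity)]
        congr 1
        field_simp
        ring
      calc _ = (ENNReal.ofReal (4 * ‖a‖ ^ (4 * m + 2)) * ENNReal.ofReal ((‖a‖ ^ (4 * m + 4))⁻¹)) *
            (A (‖a‖ * R) * k (embedPoint q)) := by ring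
        _ = _ := by rw [this]; ring
    have h4 : Measurable fun r : ℝ => ENNReal.ofReal (r⁻¹ * r⁻¹) * A (r * R) := by fun_prop
    simp only [Pi.mul_apply]
    rw [lintegral_congr_ae h3, lintegral_const_mul _ (by fun_prop),
      lintegral_radial_complex h4]
    have h5 : ∫⁻ r in Set.Ioi (0 : ℝ), ENNReal.ofReal r *
        (ENNReal.ofReal (r⁻¹ * r⁻¹) * A (r * R)) = ENNReal.ofReal (Real.log 2) := by
      rw [← lintegral_inv_Ioo hR0]
      refine setLIntegral_congr_fun measurableSet_Ioi fun r (hr : 0 < r) => ?_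
      rw [← mul_assoc, ← ENNReal.ofReal_mul hr.le, ← mul_assoc, mul_inv_cancel₀ hr.ne', one_mul]
    rw [h5]
    have h8 : ENNReal.ofReal (8 * Real.pi) = ENNReal.ofReal 4 * ENNReal.ofReal (2 * Real.pi) := by
      rw [← ENNReal.ofReal_mul (by positivity)]; congr 1; ring
    rw [h8]; ring
  have hlog : 0 < Real.log 2 := Real.log_pos (by norm_num)
  exact (ENNReal.mul_right_inj (by simpa using hlog) ENNReal.ofReal_ne_top).1 (h1.symm.trans h2)

instance (m : ℕ) : BorelSpace ((Fin m → ℂ) × (Fin m → ℂ)) := Prod.borelSpace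

instance instBorelSpaceHC (m : ℕ) : BorelSpace (HC m) := Prod.borelSpace

instance (m : ℕ) : (volume : Measure ((Fin m → ℂ) × (Fin m → ℂ))).IsAddHaarMeasure :=
  Measure.prod.instIsAddHaarMeasure volume volume

instance instIsAddHaarMeasureHC (m : ℕ) : (volume : Measure (HC m)).IsAddHaarMeasure :=
  Measure.prod.instIsAddHaarMeasure volume volume

/-! ### Fourier transform on `ℂ^n` for the bilinear pairing -/

lemma lintegral_enorm_sq_eq {α : Type*} [MeasurableSpace α] (ν : Measure α) (f : α → ℂ) :
    ∫⁻ x, ‖f x‖ₑ ^ 2 ∂ν = eLpNorm f 2 ν ^ 2 := by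
  have := eLpNorm_nnreal_pow_eq_lintegral (μ := ν) (f := f) (p := 2) two_ne_zero
  simp only [NNReal.coe_ofNat, ENNReal.coe_ofNat, ENNReal.rpow_ofNat] at this
  exact this.symm

/-- Complex conjugation of the coordinates. -/
def conjW (m : ℕ) : WC m ≃ₗᵢ[ℝ] WC m :=
  LinearIsometryEquiv.piLpCongrRight 2 fun _ => Complex.conjLIE

lemma conjW_apply {m : ℕ} (w : WC m) (i : Fin (m + 1)) : conjW m w i = star (w i) := rfl

lemma conjW_conjW {m : ℕ} (w : WC m) : conjW m (conjW m w) = w := by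
  ext i; simp [conjW_apply]

/-- The pairing `Re ⟨w, v⟩`. -/
def pairW {m : ℕ} (w v : WC m) : ℝ := (∑ i, w i * v i).re

lemma pairW_comm {m : ℕ} (w v : WC m) : pairW w v = pairW v w := by
  simp [pairW, mul_comm]

/-- Conjugating one argument turns the bilinear pairing into the real inner product, which transfers
Fourier inversion and Plancherel to `WF`. -/
lemma pairW_eq_inner {m : ℕ} (w v : WC m) : pairW w v = inner ℝ w (conjW m v) := by
  rw [pairW, PiLp.inner_apply, Complex.re_sum]
  refine Finset.sum_congr rfl fun i _ => ?_
  rw [conjW_apply, Complex.inner]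
  simp
  ring

@[fun_prop]
lemma continuous_pairW {m : ℕ} : Continuous fun p : WC m × WC m => pairW p.1 p.2 := by
  unfold pairW; fun_prop

/-- The character `exp(-2 i π x)`. -/
def expC (x : ℝ) : ℂ := Complex.exp (-2 * Complex.I * Real.pi * (x : ℂ))

@[fun_prop]
lemma continuous_expC : Continuous expC := by unfold expC; fun_prop

lemma norm_expC (x : ℝ) : ‖expC x‖ = 1 := by
  have : expC x = Complex.exp (((-2 * Real.pi * x : ℝ) : ℂ) * Complex.I) := by
    unfold expC; congr 1; push_cast; ring
  rw [this, Complex.norm_exp_ofReal_mul_I]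

lemma expC_add (x y : ℝ) : expC (x + y) = expC x * expC y := by
  unfold expC; rw [← Complex.exp_add]; congr 1; push_cast; ring

/-- The Fourier transform on `ℂ^n` for the pairing `Re ⟨w, v⟩`. -/
def WF {m : ℕ} (f : WC m → ℂ) (v : WC m) : ℂ := ∫ w, f w * expC (pairW w v)

lemma fourier_eq_expC {E : Type*} [NormedAddCommGroup E] [InnerProductSpace ℝ E]
    [MeasurableSpace E] [BorelSpace E] [FiniteDimensional ℝ E] (f : E → ℂ) (v : E) :
    FourierTransform.fourier f v = ∫ w, f w * expC (inner ℝ w v) := by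
  rw [Real.fourier_eq']
  refine integral_congr_ae (Filter.Eventually.of_forall fun w => ?_)
  simp only [expC, smul_eq_mul]
  rw [mul_comm]
  congr 2
  push_cast
  ring

lemma WF_eq_fourier {m : ℕ} (f : WC m → ℂ) (v : WC m) :
    WF f v = FourierTransform.fourier f (conjW m v) := by
  rw [fourier_eq_expC]
  simp only [WF, pairW_eq_inner]

lemma integral_WF_mul {m : ℕ} {f g : WC m → ℂ} (hf : Integrable f) (hg : Integrable g) :
    ∫ v, WF f v * g v = ∫ w, f w * WF g w := by
  have h1 : Integrable (Function.uncurry fun v w : WC m => f w * expC (pairW w v) * g v)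
      (volume.prod volume) := by
    have := (hg.mul_prod hf)
    refine (this.mul_bdd (c := 1) (g := fun p : WC m × WC m => expC (pairW p.2 p.1))
      (Continuous.aestronglyMeasurable (by fun_prop)) ?_).congr ?_
    · exact Filter.Eventually.of_forall fun p => (norm_expC _).le
    · refine Filter.Eventually.of_forall fun p => ?_
      simp only [Function.uncurry]
      ring
  calc ∫ v, WF f v * g v = ∫ v, ∫ w, f w * expC (pairW w v) * g v := by
        refine integral_congr_ae (Filter.Eventually.of_forall fun v => ?_)
        simp only [WF]
        rw [integral_mul_const]
    _ = ∫ w, ∫ v, f w * expC (pairW w v) * g v := integral_integral_swap h1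
    _ = _ := by
        refine integral_congr_ae (Filter.Eventually.of_forall fun w => ?_)
        simp only [WF]
        rw [← integral_const_mul]
        refine integral_congr_ae (Filter.Eventually.of_forall fun v => ?_)
        simp only [pairW_comm w v]
        ring

/-- Fourier inversion. -/
lemma WF_WF_neg {m : ℕ} {f : WC m → ℂ} (hc : Continuous f) (hf : Integrable f)
    (hf' : Integrable (WF f)) (w : WC m) : WF (fun v => WF f (-v)) w = f w := by
  have h1 : (fun v => WF f (-v)) =
      FourierTransform.fourier f ∘ (conjW m).trans (LinearIsometryEquiv.neg ℝ) := by
    ext1 v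
    rw [WF_eq_fourier]
    simp
  have h2 : Integrable (FourierTransform.fourier f) := by
    have := (conjW m).measurePreserving.integrable_comp_emb
      (conjW m).toHomeomorph.measurableEmbedding (g := FourierTransform.fourier f)
    rw [← this]
    refine hf'.congr (Filter.Eventually.of_forall fun v => ?_)
    exact WF_eq_fourier f v
  rw [h1, WF_eq_fourier, Real.fourier_comp_linearIsometry]
  have h3 := congrFun (hc.fourierInv_fourier_eq hf h2) w
  rw [Real.fourierInv_eq_fourier_neg] at h3
  rw [← h3]
  simp [conjW_conjW]

lemma lintegral_WF_sq {m : ℕ} (f : 𝓢(WC m, ℂ)) :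
    ∫⁻ v, ‖WF f v‖ₑ ^ 2 = ∫⁻ v, ‖f v‖ₑ ^ 2 := by
  have h1 : ∫⁻ v, ‖WF f v‖ₑ ^ 2 = ∫⁻ v, ‖FourierTransform.fourier f v‖ₑ ^ 2 := by
    rw [← (conjW m).measurePreserving.lintegral_comp
      (f := fun v => ‖FourierTransform.fourier f v‖ₑ ^ 2)
      (by have := (FourierTransform.fourier f).continuous.measurable; fun_prop)]
    refine lintegral_congr fun v => ?_
    rw [WF_eq_fourier, SchwartzMap.fourier_coe]
  have h2 := SchwartzMap.norm_fourier_toL2_eq f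
  rw [h1, lintegral_enorm_sq_eq, lintegral_enorm_sq_eq]
  rw [SchwartzMap.norm_toLp, SchwartzMap.norm_toLp] at h2
  have h3 := (ENNReal.toReal_eq_toReal_iff'
    ((FourierTransform.fourier f).memLp 2 volume).2.ne (f.memLp 2 volume).2.ne).1 h2
  rw [h3]

/-! ### The partial Fourier transform -/

/-- The slice `(X₁, (t, X₂)) ↦ (t, X₁, X₂)`. -/
def sliceHC {m : ℕ} (p : (Fin m → ℂ) × WC m) : HC m := (p.2 0, p.1, fun i => p.2 i.succ)

@[fun_prop]
lemma continuous_sliceHC {m : ℕ} : Continuous (sliceHC (m := m)) := by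
  unfold sliceHC; fun_prop

lemma sliceHC_consW {m : ℕ} (X : Fin m → ℂ) (p : ℂ × (Fin m → ℂ)) :
    sliceHC (X, consW m p) = (p.1, X, p.2) := by
  simp [sliceHC, consW_apply]

/-- `sliceHC` as a measurable equivalence. -/
def sliceEquiv (m : ℕ) : (Fin m → ℂ) × WC m ≃ᵐ HC m where
  toFun := sliceHC
  invFun q := (q.2.1, consW m (q.1, q.2.2))
  left_inv p := by
    rcases p with ⟨X, w⟩
    refine Prod.ext rfl ?_
    rw [← MeasurableEquiv.eq_symm_apply, consW_symm_apply]
    rfl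
  right_inv q := by rw [sliceHC_consW]
  measurable_toFun := continuous_sliceHC.measurable
  measurable_invFun := by
    change Measurable fun q : HC m => (q.2.1, consW m (q.1, q.2.2))
    fun_prop

lemma volume_preserving_sliceEquiv (m : ℕ) :
    MeasurePreserving (sliceEquiv m) := by
  refine ⟨(sliceEquiv m).measurable, Measure.ext_of_lintegral _ fun K hK => ?_⟩
  rw [lintegral_map hK (sliceEquiv m).measurable]
  change ∫⁻ p : (Fin m → ℂ) × WC m, K (sliceHC p) ∂(volume.prod volume) =
    ∫⁻ q : ℂ × ((Fin m → ℂ) × (Fin m → ℂ)), K q ∂(volume.prod (volume.prod volume))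
  have hKs : Measurable fun p : (Fin m → ℂ) × WC m => K (sliceHC p) :=
    hK.comp continuous_sliceHC.measurable
  rw [lintegral_prod _ hKs.aemeasurable, lintegral_prod _ hK.aemeasurable]
  calc _ = ∫⁻ X : Fin m → ℂ, ∫⁻ t : ℂ, ∫⁻ Z : Fin m → ℂ, K (t, X, Z) := by
        refine lintegral_congr fun X => ?_
        rw [← (volume_preserving_consW m).lintegral_comp (f := fun w => K (sliceHC (X, w)))
          (hKs.comp (by fun_prop))]
        simp only [sliceHC_consW]
        exact lintegral_prod (fun p : ℂ × (Fin m → ℂ) => K (p.1, X, p.2)) (by fun_prop)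
    _ = ∫⁻ t : ℂ, ∫⁻ X : Fin m → ℂ, ∫⁻ Z : Fin m → ℂ, K (t, X, Z) := by
        refine lintegral_lintegral_swap (Measurable.aemeasurable ?_)
        exact Measurable.lintegral_prod_right' (f := fun p : ((Fin m → ℂ) × ℂ) × (Fin m → ℂ) =>
          K (p.1.2, p.1.1, p.2)) (by fun_prop)
    _ = _ := lintegral_congr fun t => (lintegral_prod
        (fun p : (Fin m → ℂ) × (Fin m → ℂ) => K (t, p)) (by fun_prop)).symm

lemma lintegral_HC_slice {m : ℕ} {K : HC m → ℝ≥0∞} (hK : AEMeasurable K volume) :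
    ∫⁻ q, K q = ∫⁻ X : Fin m → ℂ, ∫⁻ w : WC m, K (sliceHC (X, w)) := by
  have h := volume_preserving_sliceEquiv m
  rw [← h.lintegral_comp_emb (sliceEquiv m).measurableEmbedding]
  change ∫⁻ p : (Fin m → ℂ) × WC m, _ ∂(volume.prod volume) = _
  rw [lintegral_prod (fun p : (Fin m → ℂ) × WC m => K (sliceEquiv m p))
    (hK.comp_quasiMeasurePreserving h.quasiMeasurePreserving)]
  rfl

lemma integral_HC_slice {m : ℕ} {K : HC m → ℂ} (hK : Integrable K) :
    ∫ q, K q = ∫ X : Fin m → ℂ, ∫ w : WC m, K (sliceHC (X, w)) := by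
  have h := volume_preserving_sliceEquiv m
  rw [← h.integral_comp (sliceEquiv m).measurableEmbedding]
  have h2 : Integrable (fun p : (Fin m → ℂ) × WC m => K (sliceEquiv m p))
    (volume.prod volume) := h.integrable_comp_of_integrable hK
  change ∫ p : (Fin m → ℂ) × WC m, _ ∂(volume.prod volume) = _
  rw [integral_prod _ h2]
  rfl

/-- With `X₁` frozen, `𝓕` is a full Fourier transform on ℂ^n in the variables `(t,X₂)`. Isometry and
symmetry of `𝓕` are proved slice by slice from this. -/
lemma partialFourierIntegral_slice {m : ℕ} (f : HC m → ℂ) (X : Fin m → ℂ) (v : WC m) :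
    partialFourierIntegral f (sliceHC (X, v)) = WF (fun w => f (sliceHC (X, w))) v := by
  rw [WF, ← (volume_preserving_consW m).integral_comp (consW m).measurableEmbedding]
  simp only [sliceHC_consW, partialFourierIntegral]
  refine integral_congr_ae (Filter.Eventually.of_forall fun p => ?_)
  simp only [sliceHC, expC, pairW, consW_apply]
  congr 4
  simp [Fin.sum_univ_succ]

/-- Slices of Schwartz functions. -/
def schwartzSlice {m : ℕ} (f : 𝓢(HC m, ℂ)) (X : Fin m → ℂ) : 𝓢(WC m, ℂ) :=
  SchwartzMap.compCLM ℂ (g := fun w : WC m => sliceHC (X, w)) (by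
    let L : WC m →L[ℝ] HC m := LinearMap.toContinuousLinearMap
      { toFun := fun w => sliceHC (0, w)
        map_add' := fun w w' => by ext <;> simp [sliceHC]
        map_smul' := fun c w => by ext <;> simp [sliceHC] }
    have h : (fun w : WC m => sliceHC (X, w)) = fun w => L w + (0, X, 0) := by
      ext1 w
      change _ = sliceHC (0, w) + _
      simp [sliceHC]
    rw [h]
    exact L.hasTemperateGrowth.add (Function.HasTemperateGrowth.const _)) (by
    refine ⟨1, (m + 1 : ℝ), fun w => ?_⟩
    have h1 : ‖w‖ ≤ ∑ i, ‖w i‖ := by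
      refine (EuclideanSpace.norm_eq w).trans_le (Real.sqrt_le_iff.2 ⟨by positivity, ?_⟩)
      exact Finset.sum_sq_le_sq_sum_of_nonneg fun i _ => norm_nonneg _
    have h2 : ∀ i, ‖w i‖ ≤ ‖sliceHC (X, w)‖ := by
      intro i
      refine Fin.cases ?_ (fun j => ?_) i
      · exact norm_fst_le (sliceHC (X, w))
      · exact (norm_le_pi_norm (fun i : Fin m => w i.succ) j).trans
          ((norm_snd_le (sliceHC (X, w)).2).trans (norm_snd_le (sliceHC (X, w))))
    calc ‖w‖ ≤ ∑ i : Fin (m + 1), ‖sliceHC (X, w)‖ := h1.trans (Finset.sum_le_sum fun i _ => h2 i)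
      _ = (m + 1 : ℝ) * ‖sliceHC (X, w)‖ := by simp
      _ ≤ _ := by rw [pow_one]; gcongr; linarith) f

lemma schwartzSlice_apply {m : ℕ} (f : 𝓢(HC m, ℂ)) (X : Fin m → ℂ) (w : WC m) :
    schwartzSlice f X w = f (sliceHC (X, w)) := rfl

lemma stronglyMeasurable_partialFourierIntegral {m : ℕ} {f : HC m → ℂ} (hf : Measurable f) :
    StronglyMeasurable (partialFourierIntegral f) := by
  unfold partialFourierIntegral
  refine StronglyMeasurable.integral_prod_right' (f := fun p : HC m × (ℂ × (Fin m → ℂ)) =>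
    f (p.2.1, p.1.2.1, p.2.2) * Complex.exp (-2 * Complex.I * Real.pi *
      ((p.2.1 * p.1.1 + ∑ i, p.2.2 i * p.1.2.2 i).re : ℂ))) ?_
  refine Measurable.stronglyMeasurable (Measurable.mul (by fun_prop) ?_)
  refine Continuous.measurable ?_
  fun_prop

lemma lintegral_partialFourierIntegral {m : ℕ} (f : 𝓢(HC m, ℂ)) :
    ∫⁻ q, ‖partialFourierIntegral f q‖ₑ ^ 2 = ∫⁻ q, ‖f q‖ₑ ^ 2 := by
  have hm := (stronglyMeasurable_partialFourierIntegral f.continuous.measurable).measurable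
  rw [lintegral_HC_slice (by fun_prop), lintegral_HC_slice
    (by have := f.continuous.measurable; fun_prop)]
  refine lintegral_congr fun X => ?_
  simp only [partialFourierIntegral_slice]
  exact lintegral_WF_sq (schwartzSlice f X)

lemma eLpNorm_partialFourierIntegral {m : ℕ} (f : 𝓢(HC m, ℂ)) :
    eLpNorm (partialFourierIntegral f) 2 volume = eLpNorm f 2 volume := by
  have h := lintegral_partialFourierIntegral f
  rw [lintegral_enorm_sq_eq, lintegral_enorm_sq_eq] at h
  exact (ENNReal.pow_right_strictMono two_ne_zero).injective h

lemma memLp_partialFourierIntegral {m : ℕ} (f : 𝓢(HC m, ℂ)) :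
    MemLp (partialFourierIntegral f) 2 volume :=
  ⟨(stronglyMeasurable_partialFourierIntegral f.continuous.measurable).aestronglyMeasurable, by
    rw [eLpNorm_partialFourierIntegral]; exact (f.memLp 2 volume).2⟩

lemma integrable_partial_integrand {m : ℕ} (f : 𝓢(HC m, ℂ)) (X : Fin m → ℂ) (v : WC m) :
    Integrable fun w => f (sliceHC (X, w)) * expC (pairW w v) := by
  have : Integrable fun w => f (sliceHC (X, w)) := (schwartzSlice f X).integrable
  refine this.mul_bdd (c := 1) (Continuous.aestronglyMeasurable (by fun_prop)) ?_
  exact Filter.Eventually.of_forall fun w => (norm_expC _).le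

/-- The partial Fourier transform of Schwartz functions, as a linear map into `L²`. -/
def schwartzPartialFourier (m : ℕ) : 𝓢(HC m, ℂ) →ₗ[ℂ] L2 m where
  toFun f := (memLp_partialFourierIntegral f).toLp _
  map_add' f g := by
    rw [← MemLp.toLp_add]
    refine MemLp.toLp_congr _ _ (Filter.Eventually.of_forall fun q => ?_)
    obtain ⟨⟨X, v⟩, rfl⟩ := (sliceEquiv m).surjective q
    change partialFourierIntegral _ (sliceHC (X, v)) =
      partialFourierIntegral _ (sliceHC (X, v)) + partialFourierIntegral _ (sliceHC (X, v))
    simp only [partialFourierIntegral_slice, WF]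
    rw [← integral_add (integrable_partial_integrand f X v) (integrable_partial_integrand g X v)]
    simp [add_mul]
  map_smul' c f := by
    rw [RingHom.id_apply, ← MemLp.toLp_const_smul]
    refine MemLp.toLp_congr _ _ (Filter.Eventually.of_forall fun q => ?_)
    simp only [partialFourierIntegral, smul_apply, Pi.smul_apply, smul_eq_mul,
      mul_assoc, integral_const_mul]

lemma denseRange_schwartz (m : ℕ) :
    DenseRange (SchwartzMap.toLpCLM ℂ ℂ 2 (volume : Measure (HC m))).toLinearMap :=
  SchwartzMap.denseRange_toLpCLM (E := HC m) (F := ℂ) (p := 2) (by norm_num)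

lemma toLpCLM_eq {m : ℕ} (f : 𝓢(HC m, ℂ)) :
    SchwartzMap.toLpCLM ℂ ℂ 2 (volume : Measure (HC m)) f = (f.memLp 2 volume).toLp f := rfl

lemma norm_schwartzPartialFourier {m : ℕ} (f : 𝓢(HC m, ℂ)) :
    ‖schwartzPartialFourier m f‖ = ‖SchwartzMap.toLpCLM ℂ ℂ 2 (volume : Measure (HC m)) f‖ := by
  rw [toLpCLM_eq, schwartzPartialFourier, LinearMap.coe_mk, AddHom.coe_mk, Lp.norm_toLp,
    Lp.norm_toLp, eLpNorm_partialFourierIntegral]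

/-- The partial Fourier transform. -/
def PF (m : ℕ) : L2 m →L[ℂ] L2 m :=
  (schwartzPartialFourier m).extendOfNorm (SchwartzMap.toLpCLM ℂ ℂ 2 volume).toLinearMap

lemma PF_toLp {m : ℕ} (f : 𝓢(HC m, ℂ)) :
    PF m ((f.memLp 2 volume).toLp f) = (memLp_partialFourierIntegral f).toLp _ :=
  LinearMap.extendOfNorm_eq (denseRange_schwartz m)
    ⟨1, fun f => by rw [one_mul]; exact (norm_schwartzPartialFourier f).le⟩ f

lemma norm_PF {m : ℕ} (u : L2 m) : ‖PF m u‖ = ‖u‖ := by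
  refine (denseRange_schwartz m).induction_on u (isClosed_eq (by fun_prop) (by fun_prop)) ?_
  intro f
  exact (congrArg norm (PF_toLp f)).trans (norm_schwartzPartialFourier f)

lemma isPartialFourier_PF (m : ℕ) : IsPartialFourier m (PF m) := fun f => by
  refine ⟨f.memLp 2 volume, ?_⟩
  rw [PF_toLp]
  exact MemLp.coeFn_toLp _

lemma IsPartialFourier.eq_PF {m : ℕ} {P : L2 m →L[ℂ] L2 m} (hP : IsPartialFourier m P) :
    P = PF m := by
  refine ContinuousLinearMap.coeFn_injective
    ((denseRange_schwartz m).equalizer P.continuous (PF m).continuous ?_)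
  ext1 f
  obtain ⟨hf, h⟩ := hP f
  refine Lp.ext (h.trans ?_)
  change _ =ᵐ[_] (PF m ((f.memLp 2 volume).toLp f))
  rw [PF_toLp]
  exact (MemLp.coeFn_toLp _).symm

lemma partialFourier_eq (m : ℕ) : partialFourier m = PF m :=
  IsPartialFourier.eq_PF (Classical.epsilon_spec ⟨_, isPartialFourier_PF m⟩)

/-- The bilinear pairing on `L²`. -/
def pair2 (m : ℕ) : L2 m →L[ℂ] L2 m →L[ℂ] ℂ :=
  (ContinuousLinearMap.mul ℂ ℂ).lpPairing volume 2 2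

lemma pair2_apply {m : ℕ} (u v : L2 m) : pair2 m u v = ∫ q, u q * v q :=
  ContinuousLinearMap.lpPairing_eq_integral _ _ _

lemma pair2_toLp {m : ℕ} {f g : HC m → ℂ} (hf : MemLp f 2 volume) (hg : MemLp g 2 volume) :
    pair2 m (hf.toLp f) (hg.toLp g) = ∫ q, f q * g q := by
  rw [pair2_apply]
  refine integral_congr_ae ?_
  filter_upwards [hf.coeFn_toLp, hg.coeFn_toLp] with q h1 h2
  rw [h1, h2]

/-- The pairing in the exponent is symmetric, so `𝓕` is its own transpose: Fubini on each slice for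
Schwartz functions, then density in both arguments. -/
lemma pair2_PF {m : ℕ} (u v : L2 m) : pair2 m (PF m u) v = pair2 m u (PF m v) := by
  refine (denseRange_schwartz m).induction_on u (isClosed_eq (by fun_prop) (by fun_prop)) ?_
  intro f
  refine (denseRange_schwartz m).induction_on v (isClosed_eq (by fun_prop) (by fun_prop)) ?_
  intro g
  change pair2 m (PF m ((f.memLp 2 volume).toLp f)) ((g.memLp 2 volume).toLp g) = pair2 m ((f.memLp 2 volume).toLp f) (PF m ((g.memLp 2 volume).toLp g))
  rw [PF_toLp, PF_toLp, pair2_toLp, pair2_toLp,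
    integral_HC_slice (K := fun q => partialFourierIntegral f q * g q)
      ((memLp_partialFourierIntegral f).integrable_mul (g.memLp 2 volume)),
    integral_HC_slice (K := fun q => f q * partialFourierIntegral g q)
      ((f.memLp 2 volume).integrable_mul (memLp_partialFourierIntegral g))]
  refine integral_congr_ae (Filter.Eventually.of_forall fun X => ?_)
  simp only [partialFourierIntegral_slice]
  exact integral_WF_mul (schwartzSlice f X).integrable (schwartzSlice g X).integrable

/-- The bilinear pairing is nondegenerate. -/
lemma eq_zero_of_pair2 {m : ℕ} {u : L2 m} (h : ∀ v, pair2 m u v = 0) : u = 0 := by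
  have h1 := h (star u)
  rw [pair2_apply] at h1
  have h2 : inner ℂ u u = (0 : ℂ) := by
    rw [MeasureTheory.L2.inner_def, ← h1]
    refine integral_congr_ae ?_
    filter_upwards [Lp.coeFn_star u] with q hq
    rw [hq]
    simp [Complex.mul_conj, Complex.normSq_eq_norm_sq]
  exact inner_self_eq_zero.1 h2

lemma PF_injective (m : ℕ) : Function.Injective (PF m) :=
  (injective_iff_map_eq_zero (PF m)).2 fun u hu => norm_eq_zero.1 (by rw [← norm_PF, hu, norm_zero])

/-- The range of an isometry is closed, so it suffices that its orthogonal complement vanishes. If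
`v` is orthogonal to the range, symmetry makes `𝓕(star v)` pair to zero with everything, and
injectivity gives `v = 0`. -/
lemma PF_surjective (m : ℕ) : Function.Surjective (PF m) := by
  let I : L2 m →ₗᵢ[ℂ] L2 m := ⟨(PF m).toLinearMap, norm_PF⟩
  have hcl : IsClosed (LinearMap.range (PF m).toLinearMap : Set (L2 m)) := by
    have := I.isometry.isClosedEmbedding.isClosed_range
    convert this using 1
    ext u
    rfl
  rw [← ContinuousLinearMap.coe_coe, ← LinearMap.range_eq_top]
  have : CompleteSpace (LinearMap.range (PF m).toLinearMap) := hcl.completeSpace_coe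
  rw [← Submodule.orthogonal_eq_bot_iff, eq_bot_iff]
  intro v hv
  rw [Submodule.mem_orthogonal] at hv
  have h1 : ∀ u, pair2 m (PF m (star v)) u = 0 := by
    intro u
    rw [pair2_PF, pair2_apply]
    have := hv (PF m u) ⟨u, rfl⟩
    rw [← inner_conj_symm, map_eq_zero, MeasureTheory.L2.inner_def] at this
    rw [← this]
    refine integral_congr_ae ?_
    filter_upwards [Lp.coeFn_star v] with q hq
    rw [hq]
    simp [mul_comm]
  have h2 : star v = 0 := PF_injective m ((eq_zero_of_pair2 h1).trans (map_zero _).symm)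
  rw [← star_star v, h2]
  refine Lp.ext ((Lp.coeFn_star _).trans ?_)
  filter_upwards [Lp.coeFn_zero ℂ 2 (volume : Measure (HC m))] with q hq
  simp

/-! ### Characters of `ℂ^×` -/

/-- The character `|a|^w [a]^d`. -/
def homChar (w : ℂ) (d : ℤ) (a : ℂ) : ℂ := (‖a‖ : ℂ) ^ w * bracket a ^ d

lemma bracket_ne_zero {a : ℂ} (ha : a ≠ 0) : bracket a ≠ 0 :=
  div_ne_zero ha (by simpa using ha)

lemma norm_bracket {a : ℂ} (ha : a ≠ 0) : ‖bracket a‖ = 1 := by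
  rw [bracket, norm_div, Complex.norm_real, norm_norm, div_self (norm_ne_zero_iff.2 ha)]

lemma bracket_mul (a b : ℂ) : bracket (a * b) = bracket a * bracket b := by
  simp only [bracket, norm_mul, Complex.ofReal_mul]
  rw [mul_div_mul_comm]

lemma bracket_ofReal {r : ℝ} (hr : 0 < r) : bracket (r : ℂ) = 1 := by
  have : (r : ℂ) ≠ 0 := by exact_mod_cast hr.ne'
  rw [bracket, Complex.norm_real, Real.norm_of_nonneg hr.le, div_self this]

lemma homChar_ne_zero (w : ℂ) (d : ℤ) {a : ℂ} (ha : a ≠ 0) : homChar w d a ≠ 0 := by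
  refine mul_ne_zero ?_ (zpow_ne_zero _ (bracket_ne_zero ha))
  rw [Complex.cpow_ne_zero_iff]
  left
  simpa using ha

lemma norm_homChar (w : ℂ) (d : ℤ) {a : ℂ} (ha : a ≠ 0) : ‖homChar w d a‖ = ‖a‖ ^ w.re := by
  rw [homChar, norm_mul, norm_zpow, norm_bracket ha, one_zpow, mul_one,
    Complex.norm_cpow_eq_rpow_re_of_pos (norm_pos_iff.2 ha)]

lemma homChar_mul (w : ℂ) (d : ℤ) (a b : ℂ) :
    homChar w d (a * b) = homChar w d a * homChar w d b := by
  simp only [homChar, norm_mul, Complex.ofReal_mul, bracket_mul, mul_zpow]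
  rw [Complex.mul_cpow_ofReal_nonneg (norm_nonneg _) (norm_nonneg _)]
  ring

lemma homChar_neg (w : ℂ) (d : ℤ) {a : ℂ} : homChar (-w) (-d) a = (homChar w d a)⁻¹ := by
  simp only [homChar, Complex.cpow_neg, zpow_neg, mul_inv]

lemma homChar_one (w : ℂ) (d : ℤ) : homChar w d 1 = 1 := by
  simp [homChar, bracket]

lemma homChar_ofReal (w : ℂ) (d : ℤ) {r : ℝ} (hr : 0 < r) : homChar w d r = (r : ℂ) ^ w := by
  rw [homChar, bracket_ofReal hr, one_zpow, mul_one, Complex.norm_real, Real.norm_of_nonneg hr.le]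

@[fun_prop]
lemma measurable_bracket : Measurable bracket := by
  unfold bracket; fun_prop

@[fun_prop]
lemma measurable_homChar (w : ℂ) (d : ℤ) : Measurable (homChar w d) := by
  unfold homChar
  refine Measurable.mul (by fun_prop) ?_
  cases d with
  | ofNat n => simp only [Int.ofNat_eq_natCast, zpow_natCast]; fun_prop
  | negSucc n => simp only [zpow_negSucc]; fun_prop

lemma contDiffAt_homChar {E : Type*} [NormedAddCommGroup E] [NormedSpace ℝ E] (w : ℂ) (d : ℤ)
    {h : E → ℂ} {x : E} (hh : ContDiffAt ℝ ∞ h x) (hx : h x ≠ 0) :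
    ContDiffAt ℝ ∞ (fun y => homChar w d (h y)) x := by
  have hn : ContDiffAt ℝ ∞ (fun y => ‖h y‖) x := hh.norm ℝ hx
  have hc : ContDiffAt ℝ ∞ (fun y => (‖h y‖ : ℂ)) x :=
    Complex.ofRealCLM.contDiff.contDiffAt.comp x hn
  have hb : ContDiffAt ℝ ∞ (fun y => bracket (h y)) x := by
    simp only [bracket, div_eq_mul_inv]
    exact hh.mul (hc.inv (by simpa using hx))
  have hz : ContDiffAt ℝ ∞ (fun y => bracket (h y) ^ d) x := by
    cases d with
    | ofNat n => simp only [Int.ofNat_eq_natCast, zpow_natCast]; exact hb.pow n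
    | negSucc n =>
      simp only [zpow_negSucc]
      exact (hb.pow (n + 1)).inv (pow_ne_zero _ (bracket_ne_zero hx))
  refine ContDiffAt.mul ?_ hz
  have hl : ContDiffAt ℝ ∞ (fun y => Complex.exp ((Real.log ‖h y‖ : ℂ) * w)) x := by
    have hlog : ContDiffAt ℝ ∞ (fun y => (Real.log ‖h y‖ : ℂ)) x :=
      Complex.ofRealCLM.contDiff.contDiffAt.comp x (hn.log (norm_ne_zero_iff.2 hx))
    have he : ContDiff ℝ ∞ Complex.exp := (Complex.contDiff_exp (𝕜 := ℂ)).restrict_scalars ℝ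
    exact he.contDiffAt.comp x (hlog.mul contDiffAt_const)
  refine hl.congr_of_eventuallyEq ?_
  filter_upwards [hh.continuousAt.eventually_ne hx] with y hy
  rw [Complex.cpow_def_of_ne_zero (by simpa using hy), Complex.ofReal_log (norm_nonneg _)]

/-! ### The algebraic operator -/

/-- The involution `(s, X₁, X₂) ↦ (s, (2/s) X₂, (s/2) X₁)`. -/
def swapHC {m : ℕ} (q : HC m) : HC m := (q.1, (2 / q.1) • q.2.2, (q.1 / 2) • q.2.1)

lemma swapHC_swapHC {m : ℕ} {q : HC m} (hq : q.1 ≠ 0) : swapHC (swapHC q) = q := by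
  refine Prod.ext rfl (Prod.ext ?_ ?_) <;> simp only [swapHC, smul_smul]
  · rw [div_mul_div_cancel₀ hq, div_self two_ne_zero, one_smul]
  · rw [div_mul_div_cancel₀ two_ne_zero, div_self hq, one_smul]

lemma algebraicFun_eq {m : ℕ} (μ : ℂ) (δ : ℤ) (H : HC m → ℂ) (q : HC m) :
    algebraicFun μ δ H q = homChar μ δ (q.1 / 2) * H (swapHC q) := by
  have : bracket (q.1 / 2) = bracket q.1 := by
    have h2 : bracket (2⁻¹ : ℂ) = 1 := by
      have := bracket_ofReal (r := 2⁻¹) (by norm_num)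
      push_cast at this
      exact this
    rw [div_eq_mul_inv, bracket_mul, h2, mul_one]
  rw [algebraicFun, homChar, this]
  rfl

lemma ae_fst_ne_zero (m : ℕ) : ∀ᵐ q : HC m, q.1 ≠ 0 := by
  have h0 : ∀ᵐ a : ℂ, a ≠ 0 := by simp [ae_iff, measure_singleton]
  exact Measure.quasiMeasurePreserving_fst.ae h0

/-- For fixed `s ≠ 0` the scalings by `2/s` and `s/2` act on spaces of equal dimension, so their
Jacobians are inverse to each other. With `Re μ = 0` this makes `T` isometric. -/
lemma measurePreserving_swapHC (m : ℕ) : MeasurePreserving (swapHC (m := m)) := by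
  have h0 : ∀ᵐ a : ℂ, a ≠ 0 := by simp [ae_iff, measure_singleton]
  refine (MeasurePreserving.id (volume : Measure ℂ)).skew_product
    (g := fun s (p : (Fin m → ℂ) × (Fin m → ℂ)) => ((2 / s) • p.2, (s / 2) • p.1)) ?_ ?_
  · simp only [Function.uncurry_def]
    fun_prop
  filter_upwards [h0] with s hs
  have h1 := map_complex_smul (Fin m → ℂ) volume (c := 2 / s) (by simp [hs])
  have h2 := map_complex_smul (Fin m → ℂ) volume (c := s / 2) (by simp [hs])
  have h3 : (fun p : (Fin m → ℂ) × (Fin m → ℂ) => ((2 / s) • p.2, (s / 2) • p.1)) =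
    Prod.map (fun x : Fin m → ℂ => (2 / s) • x) (fun x : Fin m → ℂ => (s / 2) • x) ∘ Prod.swap :=
    rfl
  rw [h3, ← Measure.map_map (by fun_prop) (by fun_prop)]
  change Measure.map _ (Measure.map _ (volume.prod volume)) = volume.prod volume
  rw [Measure.prod_swap, ← Measure.map_prod_map _ _ (by fun_prop) (by fun_prop), h1, h2]
  simp only [Measure.prod_smul_left, Measure.prod_smul_right, smul_smul]
  rw [← ENNReal.ofReal_mul (by positivity), ← mul_inv, ← mul_pow, norm_div, norm_div]
  have : ‖s‖ ≠ 0 := norm_ne_zero_iff.2 hs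
  rw [show ‖s‖ / ‖(2 : ℂ)‖ * (‖(2 : ℂ)‖ / ‖s‖) = 1 by
    field_simp]
  simp

lemma algebraicFun_ae_congr {m : ℕ} (μ : ℂ) (δ : ℤ) {H H' : HC m → ℂ} (h : H =ᵐ[volume] H') :
    algebraicFun μ δ H =ᵐ[volume] algebraicFun μ δ H' := by
  filter_upwards [(measurePreserving_swapHC m).quasiMeasurePreserving.ae_eq_comp h] with q hq
  rw [algebraicFun_eq, algebraicFun_eq]
  exact congrArg _ hq

lemma aestronglyMeasurable_algebraicFun {m : ℕ} (μ : ℂ) (δ : ℤ) {H : HC m → ℂ}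
    (hH : AEStronglyMeasurable H volume) :
    AEStronglyMeasurable (algebraicFun μ δ H) volume := by
  have h1 := hH.comp_measurePreserving (measurePreserving_swapHC m)
  have h2 : Measurable fun q : HC m => homChar μ δ (q.1 / 2) := by fun_prop
  refine (h2.aestronglyMeasurable.mul h1).congr (Filter.Eventually.of_forall fun q => ?_)
  exact (algebraicFun_eq μ δ H q).symm

lemma eLpNorm_algebraicFun {m : ℕ} {μ : ℂ} (hμ : μ.re = 0) (δ : ℤ) {H : HC m → ℂ}
    (hH : AEStronglyMeasurable H volume) :
    eLpNorm (algebraicFun μ δ H) 2 volume = eLpNorm H 2 volume := by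
  rw [← eLpNorm_comp_measurePreserving hH (measurePreserving_swapHC m)]
  refine eLpNorm_congr_norm_ae ?_
  filter_upwards [ae_fst_ne_zero m] with q hq
  rw [algebraicFun_eq, norm_mul, norm_homChar _ _ (by simpa using hq), hμ, Real.rpow_zero, one_mul]
  rfl

lemma memLp_algebraicFun {m : ℕ} {μ : ℂ} (hμ : μ.re = 0) (δ : ℤ) {H : HC m → ℂ}
    (hH : MemLp H 2 volume) : MemLp (algebraicFun μ δ H) 2 volume :=
  ⟨aestronglyMeasurable_algebraicFun μ δ hH.1, by rw [eLpNorm_algebraicFun hμ δ hH.1]; exact hH.2⟩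

/-- The algebraic operator. -/
def AO (m : ℕ) {μ : ℂ} (hμ : μ.re = 0) (δ : ℤ) : L2 m →L[ℂ] L2 m :=
  LinearMap.mkContinuous
    { toFun := fun H => (memLp_algebraicFun hμ δ (Lp.memLp H)).toLp _
      map_add' := fun H H' => by
        rw [← MemLp.toLp_add]
        refine MemLp.toLp_congr _ _ ((algebraicFun_ae_congr μ δ (Lp.coeFn_add H H')).trans ?_)
        refine Filter.Eventually.of_forall fun q => ?_
        simp only [Pi.add_apply, algebraicFun_eq]
        ring
      map_smul' := fun c H => by
        rw [RingHom.id_apply, ← MemLp.toLp_const_smul]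
        refine MemLp.toLp_congr _ _ ((algebraicFun_ae_congr μ δ (Lp.coeFn_smul c H)).trans ?_)
        refine Filter.Eventually.of_forall fun q => ?_
        simp only [Pi.smul_apply, algebraicFun_eq, smul_eq_mul]
        ring } 1 fun H => by
    rw [one_mul, LinearMap.coe_mk, AddHom.coe_mk, Lp.norm_toLp,
      eLpNorm_algebraicFun hμ δ (Lp.aestronglyMeasurable H), Lp.norm_def]

lemma AO_apply {m : ℕ} {μ : ℂ} (hμ : μ.re = 0) (δ : ℤ) (H : L2 m) :
    AO m hμ δ H = (memLp_algebraicFun hμ δ (Lp.memLp H)).toLp _ := rfl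

lemma AO_toLp {m : ℕ} {μ : ℂ} (hμ : μ.re = 0) (δ : ℤ) {H : HC m → ℂ} (hH : MemLp H 2 volume) :
    AO m hμ δ (hH.toLp H) = (memLp_algebraicFun hμ δ hH).toLp _ := by
  rw [AO_apply]
  exact MemLp.toLp_congr _ _ (algebraicFun_ae_congr μ δ hH.coeFn_toLp)

lemma isAlgebraicOp_AO (m : ℕ) {μ : ℂ} (hμ : μ.re = 0) (δ : ℤ) :
    IsAlgebraicOp m μ δ (AO m hμ δ) := fun H => by
  rw [AO_apply]
  exact MemLp.coeFn_toLp _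

lemma IsAlgebraicOp.eq_AO {m : ℕ} {μ : ℂ} (hμ : μ.re = 0) {δ : ℤ} {T : L2 m →L[ℂ] L2 m}
    (hT : IsAlgebraicOp m μ δ T) : T = AO m hμ δ := by
  ext1 H
  exact Lp.ext ((hT H).trans (isAlgebraicOp_AO m hμ δ H).symm)

lemma algebraicOp_eq (m : ℕ) {μ : ℂ} (hμ : μ.re = 0) (δ : ℤ) :
    algebraicOp m μ δ = AO m hμ δ :=
  IsAlgebraicOp.eq_AO hμ (Classical.epsilon_spec ⟨_, isAlgebraicOp_AO m hμ δ⟩)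

/-- Almost everywhere `swapHC` is a measure-preserving involution that fixes `s`, and the multiplier
depends on `s` only. A change of variables therefore moves `T` to the other argument unchanged. -/
lemma pair2_AO {m : ℕ} {μ : ℂ} (hμ : μ.re = 0) (δ : ℤ) (u v : L2 m) :
    pair2 m (AO m hμ δ u) v = pair2 m u (AO m hμ δ v) := by
  have hθ := measurePreserving_swapHC m
  have hmu : AEStronglyMeasurable (fun q => algebraicFun μ δ u q * v q) volume :=
    (aestronglyMeasurable_algebraicFun μ δ (Lp.aestronglyMeasurable u)).mul
      (Lp.aestronglyMeasurable v)
  calc pair2 m (AO m hμ δ u) v = ∫ q, algebraicFun μ δ u q * v q := by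
        rw [pair2_apply]
        refine integral_congr_ae ?_
        filter_upwards [isAlgebraicOp_AO m hμ δ u] with q hq
        rw [hq]
    _ = ∫ q, algebraicFun μ δ u (swapHC q) * v (swapHC q) := by
        have := integral_map (μ := volume) hθ.measurable.aemeasurable
          (f := fun q => algebraicFun μ δ u q * v q) (by rwa [hθ.map_eq])
        rwa [hθ.map_eq] at this
    _ = ∫ q, u q * algebraicFun μ δ v q := by
        refine integral_congr_ae ?_
        filter_upwards [ae_fst_ne_zero m] with q hq
        rw [algebraicFun_eq, algebraicFun_eq, swapHC_swapHC hq]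
        simp only [swapHC]
        ring
    _ = pair2 m u (AO m hμ δ v) := by
        rw [pair2_apply]
        refine integral_congr_ae ?_
        filter_upwards [isAlgebraicOp_AO m hμ δ v] with q hq
        rw [hq]

lemma apply_swapHC_eq_zero {m : ℕ} {H : HC m → ℂ} {q : HC m}
    (hq : q.1 ∉ Prod.fst '' tsupport H) : H (swapHC q) = 0 := by
  by_contra h
  exact hq ⟨swapHC q, subset_tsupport _ h, rfl⟩

/-- The multiplier and `2/s` are singular only at `s = 0`. The projection of the support to the
`s`-plane is compact and misses 0, so the function vanishes for `s` near 0. -/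
lemma contDiff_algebraicFun {m : ℕ} (μ : ℂ) (δ : ℤ) {H : HC m → ℂ} (hs : ContDiff ℝ ∞ H)
    (hc : HasCompactSupport H) (hU : tsupport H ⊆ {q | q.1 ≠ 0}) :
    ContDiff ℝ ∞ (algebraicFun μ δ H) := by
  have hfun : algebraicFun μ δ H = fun q => homChar μ δ (q.1 / 2) * H (swapHC q) :=
    funext (algebraicFun_eq μ δ H)
  rw [hfun, contDiff_iff_contDiffAt]
  intro q
  by_cases hq : q.1 = 0
  · have hcl : IsClosed (Prod.fst '' tsupport H) := (hc.image continuous_fst).isClosed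
    have hq' : q.1 ∉ Prod.fst '' tsupport H := by
      rintro ⟨p, hp, hpq⟩
      exact hU hp (hpq.trans hq)
    refine (contDiffAt_const (c := (0 : ℂ))).congr_of_eventuallyEq ?_
    filter_upwards [continuous_fst.continuousAt.eventually (hcl.isOpen_compl.mem_nhds hq')]
      with p hp
    rw [apply_swapHC_eq_zero hp, mul_zero]
  · have h1 : ContDiffAt ℝ ∞ (fun q : HC m => q.1) q := contDiffAt_fst
    have h2 : ContDiffAt ℝ ∞ (fun q : HC m => q.1 / 2) q := by
      simp only [div_eq_mul_inv]
      exact h1.mul contDiffAt_const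
    have h3 : ContDiffAt ℝ ∞ (fun q : HC m => 2 / q.1) q := by
      simp only [div_eq_mul_inv]
      exact contDiffAt_const.mul (h1.inv hq)
    refine (contDiffAt_homChar μ δ h2 (by simpa using hq)).mul (hs.contDiffAt.comp q ?_)
    exact h1.prodMk ((h3.smul (contDiff_snd.comp contDiff_snd).contDiffAt).prodMk
      (h2.smul (contDiff_fst.comp contDiff_snd).contDiffAt))

lemma hasCompactSupport_algebraicFun {m : ℕ} (μ : ℂ) (δ : ℤ) {H : HC m → ℂ}
    (hc : HasCompactSupport H) (hU : tsupport H ⊆ {q | q.1 ≠ 0}) :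
    HasCompactSupport (algebraicFun μ δ H) := by
  have hcont : ContinuousOn (swapHC (m := m)) (tsupport H) := by
    have h1 : ContinuousOn (fun q : HC m => 2 / q.1) (tsupport H) :=
      continuousOn_const.div continuous_fst.continuousOn fun q hq => hU hq
    unfold swapHC
    fun_prop
  refine HasCompactSupport.intro (hc.image_of_continuousOn hcont) fun q hq => ?_
  rw [algebraicFun_eq]
  have : H (swapHC q) = 0 := by
    by_contra h
    have h1 : swapHC q ∈ tsupport H := subset_tsupport _ h
    have h2 : (swapHC q).1 ≠ 0 := hU h1
    exact hq ⟨swapHC q, h1, swapHC_swapHC h2⟩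
  rw [this, mul_zero]

/-! ### From the sphere to the affine chart -/

/-- The homogeneity of the elements of `V_{μ,δ}`. -/
def IsHomog {m : ℕ} (μ : ℂ) (δ : ℤ) (g : CN m → ℂ) : Prop :=
  ∀ a : ℂ, a ≠ 0 → ∀ X : CN m, X ≠ 0 → g (a • X) = homChar (-μ - dimN m) (-δ) a * g X

lemma dimN_re (m : ℕ) : (dimN m).re = 2 * (m + 1) := by simp [dimN]

lemma dimN_eq_ofReal (m : ℕ) : dimN m = ((2 * (m + 1) : ℝ) : ℂ) := by simp [dimN]

lemma vsmooth_isHomog {m : ℕ} {μ : ℂ} {δ : ℤ} (f : Vsmooth m μ δ) :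
    IsHomog μ δ (f : CN m → ℂ) := f.2.2

lemma vsmooth_measurable {m : ℕ} {μ : ℂ} {δ : ℤ} (f : Vsmooth m μ δ) :
    Measurable (f : CN m → ℂ) :=
  measurable_of_continuousOn_compl_singleton 0 f.2.1.continuousOn

lemma IsHomog.sub {m : ℕ} {μ : ℂ} {δ : ℤ} {f g : CN m → ℂ} (hf : IsHomog μ δ f)
    (hg : IsHomog μ δ g) : IsHomog μ δ (f - g) := fun a ha X hX => by
  simp only [Pi.sub_apply, hf a ha X hX, hg a ha X hX]
  ring

/-- `Re μ = 0` gives `|g|²` the degree `-2N` of a density on projective space, so sphere and chart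
compute the same integral up to `8π`. -/
lemma IsHomog.lintegral_sq {m : ℕ} {μ : ℂ} (hμ : μ.re = 0) {δ : ℤ} {g : CN m → ℂ}
    (hg : IsHomog μ δ g) (hm : Measurable g) :
    ∫⁻ X : Sph m, ‖g X‖ₑ ^ 2 ∂(sigma m) =
      ENNReal.ofReal (8 * Real.pi) * ∫⁻ q : HC m, ‖nonCompact g q‖ₑ ^ 2 := by
  refine lintegral_sphere_eq (k := fun X => ‖g X‖ₑ ^ 2) (by fun_prop) fun a ha X hX => ?_
  have ha' : 0 < ‖a‖ := norm_pos_iff.2 ha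
  rw [hg a ha X hX, enorm_mul, mul_pow]
  congr 1
  rw [← ofReal_norm, norm_homChar _ _ ha, ← ENNReal.ofReal_pow (by positivity)]
  congr 1
  have : (-μ - dimN m).re = -(2 * m + 2 : ℕ) := by
    rw [Complex.sub_re, Complex.neg_re, hμ, dimN_re]; push_cast; ring
  rw [this, Real.rpow_neg ha'.le, Real.rpow_natCast, inv_pow, ← pow_mul]
  congr 2
  ring

lemma IsHomog.eLpNorm_sphere {m : ℕ} {μ : ℂ} (hμ : μ.re = 0) {δ : ℤ} {g : CN m → ℂ}
    (hg : IsHomog μ δ g) (hm : Measurable g) :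
    eLpNorm (fun X : Sph m => g X) 2 (sigma m) =
      ENNReal.ofReal √(8 * Real.pi) * eLpNorm (nonCompact g) 2 volume := by
  have h := hg.lintegral_sq hμ hm
  rw [lintegral_enorm_sq_eq (sigma m) (fun X : Sph m => g X), lintegral_enorm_sq_eq] at h
  refine (ENNReal.pow_right_strictMono two_ne_zero).injective ?_
  rw [h, mul_pow, ← ENNReal.ofReal_pow (by positivity), Real.sq_sqrt (by positivity)]

lemma measurable_nonCompact {m : ℕ} {g : CN m → ℂ} (hm : Measurable g) :
    Measurable (nonCompact g) := hm.comp (measurable_embedPoint m)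

lemma IsHomog.memLp_iff {m : ℕ} {μ : ℂ} (hμ : μ.re = 0) {δ : ℤ} {g : CN m → ℂ}
    (hg : IsHomog μ δ g) (hm : Measurable g) :
    MemLp (nonCompact g) 2 volume ↔ MemLp (fun X : Sph m => g X) 2 (sigma m) := by
  have h8 : 0 < √(8 * Real.pi) := by positivity
  have hm' : Measurable fun X : Sph m => g X := by fun_prop
  have h2 := (measurable_nonCompact hm).aestronglyMeasurable (μ := volume)
  rw [MemLp, MemLp, hg.eLpNorm_sphere hμ hm]
  simp only [hm'.aestronglyMeasurable, h2, true_and]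
  constructor
  · exact fun h => ENNReal.mul_lt_top ENNReal.ofReal_lt_top h
  · intro h
    rcases ENNReal.mul_lt_top_iff.1 h with h | h | h
    · exact h.2
    · exact absurd (ENNReal.ofReal_eq_zero.1 h) (not_le.2 h8)
    · rw [h]; exact ENNReal.zero_lt_top

lemma vsmooth_memLp_sphere {m : ℕ} {μ : ℂ} {δ : ℤ} (f : Vsmooth m μ δ) :
    MemLp (fun X : Sph m => (f : CN m → ℂ) X) 2 (sigma m) :=
  (Lp.memLp (restrictL m μ δ f)).ae_eq (ContinuousMap.coeFn_toLp (sigma m) (restrictC f))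

lemma vsmooth_memLp_nonCompact {m : ℕ} {μ : ℂ} (hμ : μ.re = 0) {δ : ℤ} (f : Vsmooth m μ δ) :
    MemLp (nonCompact (f : CN m → ℂ)) 2 volume :=
  ((vsmooth_isHomog f).memLp_iff hμ (vsmooth_measurable f)).2 (vsmooth_memLp_sphere f)

lemma restrictL_eq {m : ℕ} {μ : ℂ} {δ : ℤ} (f : Vsmooth m μ δ) :
    restrictL m μ δ f = (vsmooth_memLp_sphere f).toLp _ :=
  Lp.ext ((ContinuousMap.coeFn_toLp (sigma m) (restrictC f)).trans (MemLp.coeFn_toLp _).symm)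

/-- The non-compact picture as a linear map. -/
def nonCompactL (m : ℕ) {μ : ℂ} (hμ : μ.re = 0) (δ : ℤ) : Vsmooth m μ δ →ₗ[ℂ] L2 m where
  toFun f := (vsmooth_memLp_nonCompact hμ f).toLp _
  map_add' f g := by rw [← MemLp.toLp_add]; rfl
  map_smul' c f := by rw [RingHom.id_apply, ← MemLp.toLp_const_smul]; rfl

/-- `toV` as a linear map. -/
def toVL (m : ℕ) (μ : ℂ) (δ : ℤ) : Vsmooth m μ δ →ₗ[ℂ] V m μ δ where
  toFun := toV
  map_add' f g := Subtype.ext (map_add (restrictL m μ δ) f g)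
  map_smul' c f := Subtype.ext (map_smul (restrictL m μ δ) c f)

lemma denseRange_toVL (m : ℕ) (μ : ℂ) (δ : ℤ) : DenseRange (toVL m μ δ) := by
  intro w
  rw [closure_subtype]
  have h1 : (Subtype.val '' Set.range (toVL m μ δ)) =
      ((LinearMap.range (restrictL m μ δ) : Submodule ℂ _) : Set (Lp ℂ 2 (sigma m))) := by
    ext x
    constructor
    · rintro ⟨_, ⟨f, rfl⟩, rfl⟩
      exact ⟨f, rfl⟩
    · rintro ⟨f, rfl⟩
      exact ⟨toVL m μ δ f, ⟨f, rfl⟩, rfl⟩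
  rw [h1]
  exact w.2

lemma norm_sphere_eq {m : ℕ} {μ : ℂ} (hμ : μ.re = 0) {δ : ℤ} {g : CN m → ℂ}
    (hg : IsHomog μ δ g) (hm : Measurable g) (h1 : MemLp (fun X : Sph m => g X) 2 (sigma m))
    (h2 : MemLp (nonCompact g) 2 volume) :
    ‖h1.toLp _‖ = √(8 * Real.pi) * ‖h2.toLp _‖ := by
  rw [Lp.norm_toLp, Lp.norm_toLp, hg.eLpNorm_sphere hμ hm, ENNReal.toReal_mul,
    ENNReal.toReal_ofReal (by positivity)]

lemma norm_toVL {m : ℕ} {μ : ℂ} (hμ : μ.re = 0) {δ : ℤ} (f : Vsmooth m μ δ) :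
    ‖toVL m μ δ f‖ = √(8 * Real.pi) * ‖nonCompactL m hμ δ f‖ := by
  have := norm_sphere_eq hμ (vsmooth_isHomog f) (vsmooth_measurable f) (vsmooth_memLp_sphere f) (vsmooth_memLp_nonCompact hμ f)
  rw [← restrictL_eq] at this
  exact this

/-- The non-compact picture on `V_{μ,δ}`. -/
def chartL (m : ℕ) {μ : ℂ} (hμ : μ.re = 0) (δ : ℤ) : V m μ δ →L[ℂ] L2 m :=
  (nonCompactL m hμ δ).extendOfNorm (toVL m μ δ)

lemma chartL_toV {m : ℕ} {μ : ℂ} (hμ : μ.re = 0) {δ : ℤ} (f : Vsmooth m μ δ) :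
    chartL m hμ δ (toV f) = (vsmooth_memLp_nonCompact hμ f).toLp _ := by
  have h8 : 0 < √(8 * Real.pi) := by positivity
  refine LinearMap.extendOfNorm_eq (f := nonCompactL m hμ δ) (denseRange_toVL m μ δ)
    ⟨(√(8 * Real.pi))⁻¹, fun f => ?_⟩ f
  rw [norm_toVL hμ, ← mul_assoc, inv_mul_cancel₀ h8.ne', one_mul]

lemma norm_chartL {m : ℕ} {μ : ℂ} (hμ : μ.re = 0) {δ : ℤ} (w : V m μ δ) :
    ‖w‖ = √(8 * Real.pi) * ‖chartL m hμ δ w‖ := by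
  refine (denseRange_toVL m μ δ).induction_on w (isClosed_eq (by fun_prop) (by fun_prop)) ?_
  intro f
  exact (norm_toVL hμ f).trans (by rw [show toVL m μ δ f = toV f from rfl, chartL_toV]; rfl)

/-- An element of `V_{μ,δ}` is determined by its non-compact picture, in the following sense. -/
lemma ae_eq_of_chartL_eq {m : ℕ} {μ : ℂ} (hμ : μ.re = 0) {δ : ℤ} {g : CN m → ℂ}
    (hg : IsHomog μ δ g) (hm : Measurable g) (hg2 : MemLp (nonCompact g) 2 volume)
    (w : V m μ δ) (hw : chartL m hμ δ w = hg2.toLp _) :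
    ((w : Lp ℂ 2 (sigma m)) : Sph m → ℂ) =ᵐ[sigma m] fun X => g X := by
  have h1 : MemLp (fun X : Sph m => g X) 2 (sigma m) := (hg.memLp_iff hμ hm).1 hg2
  -- `g` is not known to lie in `V m μ δ`, so injectivity of `chartL` does not apply. Instead, the
  -- isometry identity for the homogeneous function `f - g` is extended from smooth `f` to all `w`
  -- by density.
  have key : ∀ w : V m μ δ, ‖(w : Lp ℂ 2 (sigma m)) - h1.toLp _‖ =
      √(8 * Real.pi) * ‖chartL m hμ δ w - hg2.toLp _‖ := by
    intro w
    refine (denseRange_toVL m μ δ).induction_on w (isClosed_eq (by fun_prop) (by fun_prop)) ?_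
    intro f
    rw [show toVL m μ δ f = toV f from rfl, chartL_toV]
    change ‖restrictL m μ δ f - _‖ = _
    rw [restrictL_eq, ← MemLp.toLp_sub, ← MemLp.toLp_sub]
    exact norm_sphere_eq hμ ((vsmooth_isHomog f).sub hg) ((vsmooth_measurable f).sub hm) ((vsmooth_memLp_sphere f).sub h1)
      ((vsmooth_memLp_nonCompact hμ f).sub hg2)
  have h2 := key w
  rw [hw, sub_self, norm_zero, mul_zero, norm_eq_zero, sub_eq_zero] at h2
  rw [h2]
  exact h1.coeFn_toLp

/-! ### Homogeneous extension of functions on the affine chart -/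

/-- The coordinates `(t, X₁, X₂)` of the point `a (1, X₁, 2t, X₂)`. -/
def chartPoint {m : ℕ} (X : CN m) : HC m :=
  (X (Sum.inr 0) / (2 * X (Sum.inl 0)), fun i => X (Sum.inl i.succ) / X (Sum.inl 0),
    fun i => X (Sum.inr i.succ) / X (Sum.inl 0))

lemma chartPoint_embedPoint {m : ℕ} (q : HC m) : chartPoint (embedPoint q) = q := by
  simp [chartPoint, embedPoint]

lemma chartPoint_smul {m : ℕ} {a : ℂ} (ha : a ≠ 0) (X : CN m) :
    chartPoint (a • X) = chartPoint X := by
  simp only [chartPoint, PiLp.smul_apply, smul_eq_mul, mul_left_comm (2 : ℂ) a,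
    mul_div_mul_left _ _ ha]

lemma smul_embedPoint_chartPoint {m : ℕ} {X : CN m} (hX : X (Sum.inl 0) ≠ 0) :
    X (Sum.inl 0) • embedPoint (chartPoint X) = X := by
  ext i
  simp only [embedPoint, chartPoint]
  rcases i with i | i <;> refine Fin.cases ?_ (fun j => ?_) i <;> simp <;> field_simp

lemma continuous_embedPoint (m : ℕ) : Continuous (embedPoint (m := m)) := by
  unfold embedPoint
  refine (PiLp.continuous_toLp 2 _).comp (continuous_pi fun i => ?_)
  rcases i with i | i <;> refine Fin.cases ?_ (fun j => ?_) i <;>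
    simp only [Sum.elim_inl, Sum.elim_inr, Fin.cons_zero, Fin.cons_succ] <;> fun_prop

/-- The homogeneous extension of a function of `(t, X₁, X₂)`. -/
def extHom {m : ℕ} (w : ℂ) (d : ℤ) (H : HC m → ℂ) (X : CN m) : ℂ :=
  homChar w d (X (Sum.inl 0)) * H (chartPoint X)

lemma nonCompact_extHom {m : ℕ} (w : ℂ) (d : ℤ) (H : HC m → ℂ) :
    nonCompact (extHom w d H) = H := by
  ext q
  have : embedPoint q (Sum.inl 0) = 1 := by simp [embedPoint]
  rw [nonCompact, extHom, chartPoint_embedPoint, this, homChar_one, one_mul]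

lemma extHom_smul {m : ℕ} (w : ℂ) (d : ℤ) (H : HC m → ℂ) {a : ℂ} (ha : a ≠ 0) (X : CN m) :
    extHom w d H (a • X) = homChar w d a * extHom w d H X := by
  rw [extHom, extHom, chartPoint_smul ha, PiLp.smul_apply, smul_eq_mul, homChar_mul, mul_assoc]

lemma homChar_zero {w : ℂ} (d : ℤ) (hw : w ≠ 0) : homChar w d 0 = 0 := by
  simp [homChar, hw]

/-- Only the hyperplane `X₀ = 0` is at issue. On the support of `H` the norm of `embedPoint` is at
most some `C`, so a nonzero value at `Y` with `Y₀ ≠ 0` forces `‖Y‖ ≤ C|Y₀|`, which is impossible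
near a nonzero point of the hyperplane. On the hyperplane itself `chartPoint` takes default values,
and `w ≠ 0` ensures that the prefactor is zero there. -/
lemma contDiffOn_extHom {m : ℕ} {w : ℂ} (hw : w ≠ 0) (d : ℤ) {H : HC m → ℂ}
    (hs : ContDiff ℝ ∞ H) (hc : HasCompactSupport H) :
    ContDiffOn ℝ ∞ (extHom w d H) {0}ᶜ := by
  intro X hX
  refine ContDiffAt.contDiffWithinAt ?_
  have hcoord : ∀ i, ContDiffAt ℝ ∞ (fun X : CN m => X i) X := fun i =>
    (contDiff_piLp_apply (𝕜 := ℝ) (p := 2) (E := fun _ : Fin (m + 1) ⊕ Fin (m + 1) => ℂ)).contDiffAt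
  by_cases h0 : X (Sum.inl 0) = 0
  · obtain ⟨C, hC⟩ := hc.isCompact.exists_bound_of_continuousOn
      (continuous_embedPoint m).continuousOn
    refine (contDiffAt_const (c := (0 : ℂ))).congr_of_eventuallyEq ?_
    have hlt : ∀ᶠ Y : CN m in 𝓝 X, ‖Y (Sum.inl 0)‖ * C < ‖Y‖ := by
      refine ContinuousAt.eventually_lt (Continuous.continuousAt (by fun_prop))
        (Continuous.continuousAt (by fun_prop)) ?_
      rw [h0, norm_zero, zero_mul]
      exact norm_pos_iff.2 hX
    filter_upwards [hlt] with Y hY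
    by_cases hY0 : Y (Sum.inl 0) = 0
    · rw [extHom, hY0, homChar_zero d hw, zero_mul]
    · have : H (chartPoint Y) = 0 := by
        by_contra hne
        have h1 := hC _ (subset_tsupport _ hne)
        have h2 : ‖Y‖ = ‖Y (Sum.inl 0)‖ * ‖embedPoint (chartPoint Y)‖ := by
          rw [← norm_smul, smul_embedPoint_chartPoint hY0]
        rw [h2] at hY
        exact absurd hY (not_lt.2 (by gcongr))
      rw [extHom, this, mul_zero]
  · refine (contDiffAt_homChar w d (hcoord _) h0).mul (hs.contDiffAt.comp X ?_)
    have hinv := (hcoord (Sum.inl 0)).inv h0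
    have hinv2 : ContDiffAt ℝ ∞ (fun X : CN m => (2 * X (Sum.inl 0))⁻¹) X :=
      (contDiffAt_const.mul (hcoord _)).inv (mul_ne_zero two_ne_zero h0)
    unfold chartPoint
    simp only [div_eq_mul_inv]
    exact ((hcoord _).mul hinv2).prodMk
      ((contDiffAt_pi.2 fun i => (hcoord _).mul hinv).prodMk
        (contDiffAt_pi.2 fun i => (hcoord _).mul hinv))

lemma neg_sub_dimN_ne_zero {m : ℕ} {μ : ℂ} (hμ : μ.re = 0) : -μ - dimN m ≠ 0 := by
  intro h
  have := congrArg Complex.re h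
  rw [Complex.sub_re, Complex.neg_re, hμ, dimN_re, Complex.zero_re] at this
  have hm : (0 : ℝ) ≤ m := Nat.cast_nonneg m
  linarith

/-- The element of `V^∞_{μ,δ}` extending a smooth function with compact support. -/
def smoothExt {m : ℕ} {μ : ℂ} (hμ : μ.re = 0) (δ : ℤ) {H : HC m → ℂ}
    (hs : ContDiff ℝ ∞ H) (hc : HasCompactSupport H) : Vsmooth m μ δ :=
  ⟨extHom (-μ - dimN m) (-δ) H, contDiffOn_extHom (neg_sub_dimN_ne_zero hμ) _ hs hc,
    fun _ ha X _ => extHom_smul _ _ H ha X⟩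

lemma chartL_injective {m : ℕ} {μ : ℂ} (hμ : μ.re = 0) (δ : ℤ) :
    Function.Injective (chartL m hμ δ) :=
  (injective_iff_map_eq_zero (chartL m hμ δ)).2 fun u hu =>
    norm_eq_zero.1 (by rw [norm_chartL hμ, hu, norm_zero, mul_zero])

instance (m : ℕ) (μ : ℂ) (δ : ℤ) : CompleteSpace (V m μ δ) :=
  (Submodule.isClosed_topologicalClosure _).completeSpace_coe

/-- The range is closed, because norms are preserved up to √(8π) and `V` is complete. It is dense,
because every smooth compactly supported function on the chart extends homogeneously to an element
of `V^∞`. -/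
lemma chartL_surjective {m : ℕ} {μ : ℂ} (hμ : μ.re = 0) (δ : ℤ) :
    Function.Surjective (chartL m hμ δ) := by
  have hanti : AntilipschitzWith (Real.toNNReal √(8 * Real.pi)) (chartL m hμ δ) :=
    ContinuousLinearMap.antilipschitz_of_bound _ fun w => by
      rw [Real.coe_toNNReal _ (by positivity)]
      exact (norm_chartL hμ w).le
  have hcl : IsClosed (Set.range (chartL m hμ δ)) :=
    hanti.isClosed_range (chartL m hμ δ).uniformContinuous
  rw [← Set.range_eq_univ, ← hcl.closure_eq, ← dense_iff_closure_eq]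
  refine (Lp.dense_hasCompactSupport_contDiff (E := HC m) (F := ℂ) (μ := volume) (p := 2)
    (by norm_num)).mono ?_
  rintro u ⟨H, hu, hc, hs⟩
  refine ⟨toV (smoothExt hμ δ hs hc), ?_⟩
  rw [chartL_toV]
  refine Lp.ext ((MemLp.coeFn_toLp _).trans ?_)
  rw [show ((smoothExt hμ δ hs hc : Vsmooth m μ δ) : CN m → ℂ) =
    extHom (-μ - dimN m) (-δ) H from rfl, nonCompact_extHom]
  exact hu.symm

/-! ### The map `α` -/

/-- The map from the induced picture to the non-standard model. -/
def AL (m : ℕ) {μ : ℂ} (hμ : μ.re = 0) (δ : ℤ) : V m μ δ →L[ℂ] L2 m :=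
  (PF m).comp (chartL m hμ δ)

lemma isAlpha_AL (m : ℕ) {μ : ℂ} (hμ : μ.re = 0) (δ : ℤ) : IsAlpha m μ δ (AL m hμ δ) := fun f => by
  refine ⟨vsmooth_memLp_nonCompact hμ f, ?_⟩
  rw [partialFourier_eq, AL, ContinuousLinearMap.comp_apply, chartL_toV]

lemma IsAlpha.eq_AL {m : ℕ} {μ : ℂ} (hμ : μ.re = 0) {δ : ℤ} {A : V m μ δ →L[ℂ] L2 m}
    (hA : IsAlpha m μ δ A) : A = AL m hμ δ := by
  refine ContinuousLinearMap.coeFn_injective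
    ((denseRange_toVL m μ δ).equalizer A.continuous (AL m hμ δ).continuous ?_)
  ext1 f
  obtain ⟨h1, h2⟩ := hA f
  obtain ⟨h3, h4⟩ := isAlpha_AL m hμ δ f
  exact h2.trans h4.symm

lemma alpha_eq (m : ℕ) {μ : ℂ} (hμ : μ.re = 0) (δ : ℤ) : alpha m μ δ = AL m hμ δ :=
  IsAlpha.eq_AL hμ (Classical.epsilon_spec ⟨_, isAlpha_AL m hμ δ⟩)

/-- `α_{μ,δ}` is an isomorphism. -/
def ALEquiv (m : ℕ) {μ : ℂ} (hμ : μ.re = 0) (δ : ℤ) : V m μ δ ≃L[ℂ] L2 m :=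
  ContinuousLinearEquiv.ofBijective (AL m hμ δ)
    (LinearMap.ker_eq_bot.2 ((PF_injective m).comp (chartL_injective hμ δ)))
    (LinearMap.range_eq_top.2 ((PF_surjective m).comp (chartL_surjective hμ δ)))

/-! ### Mellin transforms along a linear form -/

lemma bracket_neg_one : bracket (-1) = -1 := by simp [bracket]

lemma homChar_neg_ofReal (w : ℂ) (d : ℤ) {r : ℝ} (hr : 0 < r) :
    homChar w d ((-r : ℝ) : ℂ) = (-1) ^ d * (r : ℂ) ^ w := by
  have : ((-r : ℝ) : ℂ) = (-1) * (r : ℂ) := by push_cast; ring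
  rw [this, homChar_mul, homChar_ofReal _ _ hr, homChar, bracket_neg_one]
  simp

lemma neg_one_zpow_neg (d : ℤ) : (-1 : ℂ) ^ (-d) = (-1) ^ d := by
  rw [zpow_neg, ← inv_zpow]; norm_num

/-- For `l > 0` this is a change of variable. For `l < 0` the parity of `k` supplies the sign
`(-1)^d = [l]^{-d}`. -/
lemma mellin_comp_mul_of_parity {k : ℝ → ℂ} {d : ℤ} (hk : ∀ x, k (-x) = (-1) ^ d * k x) (w : ℂ)
    {l : ℝ} (hl : l ≠ 0) :
    mellin (fun r => k (r * l)) w = homChar (-w) (-d) (l : ℂ) * mellin k w := by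
  rcases lt_or_gt_of_ne hl with h | h
  · have h' : 0 < -l := by linarith
    have : (fun r => k (r * l)) = fun r => (-1 : ℂ) ^ d • k (r * -l) := by
      funext r
      rw [smul_eq_mul, ← hk]; simp
    rw [this, mellin_const_smul, mellin_comp_mul_right _ _ h', ← neg_neg l,
      homChar_neg_ofReal _ _ h', neg_one_zpow_neg]
    simp [mul_assoc]
  · rw [mellin_comp_mul_right _ _ h, homChar_ofReal _ _ h, smul_eq_mul]

lemma mellinConvergent_comp_mul_of_parity {k : ℝ → ℂ} {d : ℤ}
    (hk : ∀ x, k (-x) = (-1) ^ d * k x) {w : ℂ} (hw : MellinConvergent k w) {l : ℝ} (hl : l ≠ 0) :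
    MellinConvergent (fun r => k (r * l)) w := by
  rcases lt_or_gt_of_ne hl with h | h
  · have h' : 0 < -l := by linarith
    have : (fun r => k (r * l)) = fun r => (-1 : ℂ) ^ d • k (-l * r) := by
      funext r
      rw [smul_eq_mul, ← hk]
      congr 1; ring
    rw [this]
    exact ((MellinConvergent.comp_mul_left h').2 hw).const_smul _
  · simp_rw [mul_comm _ l]
    exact (MellinConvergent.comp_mul_left h).2 hw

lemma integral_norm_mellin_comp_mul {k : ℝ → ℂ} {d : ℤ} (hk : ∀ x, k (-x) = (-1) ^ d * k x)
    (w : ℂ) {l : ℝ} (hl : l ≠ 0) :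
    ∫ r in Set.Ioi (0 : ℝ), ‖(r : ℂ) ^ (w - 1) * k (r * l)‖ =
      |l| ^ (-w.re) * ∫ r in Set.Ioi (0 : ℝ), ‖(r : ℂ) ^ (w - 1) * k r‖ := by
  have hl' : 0 < |l| := abs_pos.2 hl
  have hab : ∀ r, ‖k (r * l)‖ = ‖k (r * |l|)‖ := by
    intro r
    rcases abs_choice l with h | h <;> rw [h]
    rw [mul_neg, hk, norm_mul, norm_zpow]; simp
  have h1 := integral_comp_mul_right_Ioi (fun r : ℝ => ‖(r : ℂ) ^ (w - 1) * k r‖) 0 hl'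
  rw [zero_mul] at h1
  have h2 : ∫ r in Set.Ioi (0 : ℝ), ‖(r : ℂ) ^ (w - 1) * k (r * l)‖ =
      ∫ r in Set.Ioi (0 : ℝ), |l| ^ (1 - w.re) *
        ‖(((r * |l| : ℝ)) : ℂ) ^ (w - 1) * k (r * |l|)‖ := by
    refine setIntegral_congr_fun measurableSet_Ioi fun r (hr : 0 < r) => ?_
    simp only [norm_mul]
    rw [hab, Complex.norm_cpow_eq_rpow_re_of_pos hr,
      Complex.norm_cpow_eq_rpow_re_of_pos (mul_pos hr hl'), Real.mul_rpow hr.le hl'.le]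
    have : |l| ^ (1 - w.re) * |l| ^ (w - 1).re = 1 := by
      rw [← Real.rpow_add hl']; simp
    linear_combination (- r ^ (w - 1).re * ‖k (r * |l|)‖) * this
  rw [h2, integral_const_mul, h1, smul_eq_mul, ← mul_assoc]
  congr 1
  rw [← Real.rpow_neg_one, ← Real.rpow_add hl']
  congr 1; ring

/-- Fubini. The inner integral of absolute values scales like `|l|^{-Re w}`, so `hint` supplies the
absolute convergence needed for the interchange. -/
lemma mellin_integral_comp_mul {α : Type*} [MeasurableSpace α] {ν : Measure α} [SFinite ν]
    {F : α → ℂ} {l : α → ℝ} {k : ℝ → ℂ} {d : ℤ} (hk : ∀ x, k (-x) = (-1) ^ d * k x)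
    (hkm : Measurable k) {w : ℂ} (hw : MellinConvergent k w) (hF : AEStronglyMeasurable F ν)
    (hl : Measurable l) (hl0 : ∀ᵐ x ∂ν, l x ≠ 0)
    (hint : Integrable (fun x => ‖F x‖ * |l x| ^ (-w.re)) ν) :
    mellin (fun r => ∫ x, F x * k (r * l x) ∂ν) w =
      mellin k w * ∫ x, F x * homChar (-w) (-d) (l x : ℂ) ∂ν := by
  have hm : AEStronglyMeasurable
      (fun p : α × ℝ => F p.1 * ((p.2 : ℂ) ^ (w - 1) * k (p.2 * l p.1)))
      (ν.prod (volume.restrict (Set.Ioi (0 : ℝ)))) := by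
    refine hF.comp_fst.mul (Measurable.aestronglyMeasurable ?_)
    fun_prop
  have hprod : Integrable (fun p : α × ℝ => F p.1 * ((p.2 : ℂ) ^ (w - 1) * k (p.2 * l p.1)))
      (ν.prod (volume.restrict (Set.Ioi (0 : ℝ)))) := by
    rw [integrable_prod_iff hm]
    constructor
    · filter_upwards [hl0] with x hx
      exact Integrable.const_mul (mellinConvergent_comp_mul_of_parity hk hw hx) _
    · refine (hint.mul_const (∫ r in Set.Ioi (0 : ℝ), ‖(r : ℂ) ^ (w - 1) * k r‖)).congr ?_
      filter_upwards [hl0] with x hx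
      simp_rw [norm_mul (F x), integral_const_mul]
      rw [integral_norm_mellin_comp_mul hk w hx]
      ring
  rw [mellin]
  simp_rw [smul_eq_mul, ← integral_const_mul]
  rw [integral_integral_swap]
  · refine integral_congr_ae ?_
    filter_upwards [hl0] with x hx
    have := mellin_comp_mul_of_parity hk w hx
    simp only [mellin, smul_eq_mul] at this
    simp_rw [mul_left_comm _ (F x)]
    rw [integral_const_mul, this, mellin]
    simp only [smul_eq_mul]
    ring
  · refine hprod.swap.congr (Filter.Eventually.of_forall fun p => ?_)
    simp only [Function.comp, Prod.fst_swap, Prod.snd_swap, Function.uncurry]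
    ring

lemma integral_even {f : ℝ → ℂ} (hf : Integrable f) (h : ∀ x, f (-x) = f x) :
    ∫ x, f x = 2 * ∫ x in Set.Ioi (0 : ℝ), f x := by
  have h1 : ∫ x in Set.Iic (0 : ℝ), f x = ∫ x in Set.Ioi (0 : ℝ), f x := by
    have := integral_comp_neg_Iic (0 : ℝ) f
    rw [neg_zero] at this
    rw [← this]
    simp_rw [h]
  rw [← intervalIntegral.integral_Iic_add_Ioi hf.integrableOn hf.integrableOn, h1]
  ring

/-! ### A Gaussian of prescribed parity -/

/-- A Gaussian of the parity of `d`, which is an eigenfunction of the Fourier transform. -/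
def gaussP (d : ℤ) (x : ℝ) : ℂ :=
  if Even d then Complex.exp (-Real.pi * x ^ 2) else x * Complex.exp (-Real.pi * x ^ 2)

/-- The eigenvalue of `gaussP d`. -/
def eigenP (d : ℤ) : ℂ := if Even d then 1 else -Complex.I

@[fun_prop]
lemma continuous_gaussP (d : ℤ) : Continuous (gaussP d) := by
  unfold gaussP
  split_ifs <;> fun_prop

lemma gaussP_neg (d : ℤ) (x : ℝ) : gaussP d (-x) = (-1) ^ d * gaussP d x := by
  unfold gaussP
  split_ifs with h
  · simp [h.neg_one_zpow]
  · simp [(Int.not_even_iff_odd.1 h).neg_one_zpow]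

lemma integrable_gaussP (d : ℤ) : Integrable (gaussP d) := by
  have hpi : 0 < (Real.pi : ℂ).re := by simpa using Real.pi_pos
  unfold gaussP
  split_ifs
  · exact integrable_cexp_neg_mul_sq hpi
  · exact integrable_mul_cexp_neg_mul_sq hpi

/-- The odd function is `-1/(2π)` times the derivative of the self-dual Gaussian, and
differentiation becomes multiplication by `2πix`. The product of the two constants is the eigenvalue
`-i`. -/
lemma fourier_gaussP (d : ℤ) (x : ℝ) :
    ∫ l, gaussP d l * expC (l * x) = eigenP d * gaussP d x := by
  have h0 : ∀ f : ℝ → ℂ, ∀ v, ∫ l, f l * expC (l * v) = FourierTransform.fourier f v := by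
    intro f v
    rw [fourier_eq_expC]
    refine integral_congr_ae (Filter.Eventually.of_forall fun l => ?_)
    simp [mul_comm]
  have h1 : FourierTransform.fourier (fun x : ℝ => Complex.exp (-Real.pi * x ^ 2)) =
      fun x : ℝ => Complex.exp (-Real.pi * x ^ 2) := by
    have := fourier_gaussian_pi (b := 1) (by simp)
    simpa using this
  rw [h0]
  have hpi : 0 < (Real.pi : ℂ).re := by simpa using Real.pi_pos
  by_cases hd : Even d
  · have hg : gaussP d = fun x : ℝ => Complex.exp (-Real.pi * x ^ 2) := by
      funext y; simp [gaussP, hd]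
    rw [hg, h1]; simp [eigenP, hd]
  · have hg : gaussP d = fun x : ℝ => x * Complex.exp (-Real.pi * x ^ 2) := by
      funext y; simp [gaussP, hd]
    have hder : ∀ y : ℝ, HasDerivAt (fun x : ℝ => Complex.exp (-Real.pi * x ^ 2))
        ((-2 * Real.pi : ℂ) • ((y : ℂ) * Complex.exp (-Real.pi * y ^ 2))) y := by
      intro y
      have h2 : HasDerivAt (fun x : ℝ => (x : ℂ)) 1 y := Complex.ofRealCLM.hasDerivAt
      have h3 := ((h2.pow 2).const_mul (-Real.pi : ℂ)).cexp
      refine h3.congr_deriv ?_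
      simp only [smul_eq_mul, Nat.cast_ofNat, Nat.add_one_sub_one, pow_one, Pi.pow_apply]
      ring
    have hd1 : deriv (fun x : ℝ => Complex.exp (-Real.pi * x ^ 2)) =
        (-2 * Real.pi : ℂ) • gaussP d := by
      funext y
      rw [(hder y).deriv, hg]; rfl
    have h4 := Real.fourier_deriv (f := fun x : ℝ => Complex.exp (-Real.pi * x ^ 2))
      (integrable_cexp_neg_mul_sq hpi) (fun y => (hder y).differentiableAt)
      (by rw [hd1]; exact (integrable_gaussP d).smul _)
    have h5 := congrFun h4 x
    rw [h1, hd1, ← h0] at h5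
    simp_rw [Pi.smul_apply, smul_eq_mul, mul_assoc (-2 * (Real.pi : ℂ))] at h5
    rw [integral_const_mul, h0] at h5
    have hne : (-2 * Real.pi : ℂ) ≠ 0 := by simp [Real.pi_ne_zero]
    apply mul_left_cancel₀ hne
    rw [h5]
    simp only [eigenP, hd, if_false, hg]
    ring

lemma mellin_exp_pi {w : ℂ} (hw : 0 < w.re) :
    mellin (fun t : ℝ => Complex.exp (-(Real.pi * t))) w =
      (Real.pi : ℂ) ^ (-w) * Complex.Gamma w := by
  have := Complex.integral_cpow_mul_exp_neg_mul_Ioi hw Real.pi_pos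
  simp only [mellin, smul_eq_mul]
  rw [this, one_div, Complex.inv_cpow _ _ (by
    rw [Complex.arg_ofReal_of_nonneg Real.pi_pos.le]; exact Real.pi_pos.ne), Complex.cpow_neg]

lemma mellinConvergent_exp_pi {w : ℂ} (hw : 0 < w.re) :
    MellinConvergent (fun t : ℝ => Complex.exp (-(Real.pi * t))) w := by
  have h1 : MellinConvergent (fun t : ℝ => Complex.exp (-(t : ℂ))) w := by
    refine (Complex.GammaIntegral_convergent hw).congr_fun (fun t _ => ?_) measurableSet_Ioi
    simp [mul_comm]
  have := (MellinConvergent.comp_mul_left Real.pi_pos).2 h1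
  simpa using this

lemma mellin_gaussian {w : ℂ} (hw : 0 < w.re) :
    MellinConvergent (fun t : ℝ => Complex.exp (-Real.pi * t ^ 2)) w ∧
    mellin (fun t : ℝ => Complex.exp (-Real.pi * t ^ 2)) w =
      1 / 2 * ((Real.pi : ℂ) ^ (-(w / 2)) * Complex.Gamma (w / 2)) := by
  have hw2 : 0 < (w / ((2 : ℝ) : ℂ)).re := by
    rw [Complex.div_ofReal_re]; positivity
  have he : (fun t : ℝ => Complex.exp (-Real.pi * t ^ 2)) =
      fun t : ℝ => (fun u : ℝ => Complex.exp (-(Real.pi * u))) (t ^ (2 : ℝ)) := by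
    funext t
    simp only [Real.rpow_two]
    push_cast
    ring_nf
  rw [he]
  constructor
  · exact (MellinConvergent.comp_rpow two_ne_zero).2 (mellinConvergent_exp_pi hw2)
  · rw [mellin_comp_rpow (fun u : ℝ => Complex.exp (-(Real.pi * u))) w 2, mellin_exp_pi hw2]
    simp

lemma mellin_gaussP (d : ℤ) {w : ℂ} (hw : 0 < w.re) :
    MellinConvergent (gaussP d) w ∧ mellin (gaussP d) w =
      if Even d then 1 / 2 * ((Real.pi : ℂ) ^ (-(w / 2)) * Complex.Gamma (w / 2))
      else 1 / 2 * ((Real.pi : ℂ) ^ (-((w + 1) / 2)) * Complex.Gamma ((w + 1) / 2)) := by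
  by_cases hd : Even d
  · have hg : gaussP d = fun x : ℝ => Complex.exp (-Real.pi * x ^ 2) := by
      funext y; simp [gaussP, hd]
    simpa [hg, hd] using mellin_gaussian hw
  · have hg : gaussP d = fun x : ℝ => (x : ℂ) ^ (1 : ℂ) • Complex.exp (-Real.pi * x ^ 2) := by
      funext y; simp [gaussP, hd]
    have hw1 : 0 < (w + 1).re := by simp; linarith
    rw [hg, MellinConvergent.cpow_smul, mellin_cpow_smul]
    simpa [hd] using mellin_gaussian hw1

/-- This identifies `C_N`: with `w = z + N` it is the ratio `2 M(1-w) / (ε M(w))` for the Mellin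
transform `M` of a Gaussian of the right parity with Fourier eigenvalue `ε`. In the odd case `2i ·
(-i) = 2`. -/
lemma eigenP_mul_normFactor (m : ℕ) (d : ℤ) {z : ℂ} (h0 : 0 < (z + dimN m).re)
    (h1 : (z + dimN m).re < 1) :
    normFactor m z d * (eigenP d * mellin (gaussP d) (z + dimN m)) =
      2 * mellin (gaussP d) (1 - (z + dimN m)) ∧ mellin (gaussP d) (z + dimN m) ≠ 0 := by
  have hz1 : 0 < (1 - (z + dimN m)).re := by
    rw [Complex.sub_re, Complex.one_re]; linarith
  rw [(mellin_gaussP d h0).2, (mellin_gaussP d hz1).2]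
  have hpi : (Real.pi : ℂ) ≠ 0 := by simp [Real.pi_ne_zero]
  set w := z + dimN m with hw
  have e1 : z + dimN m - 1 / 2 = w - 1 / 2 := by rw [hw]
  have e2 : 1 - z - dimN m = 1 - w := by rw [hw]; ring
  have e3 : 2 - z - dimN m = 2 - w := by rw [hw]; ring
  have e4 : 1 + z + dimN m = 1 + w := by rw [hw]; ring
  unfold normFactor eigenP
  rw [e1, e2, e3, e4, ← hw]
  split_ifs with hd
  · have hG : Complex.Gamma (w / 2) ≠ 0 := Complex.Gamma_ne_zero_of_re_pos (by
      rw [show (w / 2).re = w.re / 2 by simp]; linarith)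
    have hp : (Real.pi : ℂ) ^ (w - 1 / 2) * (Real.pi : ℂ) ^ (-(w / 2)) =
        (Real.pi : ℂ) ^ (-((1 - w) / 2)) := by
      rw [← Complex.cpow_add _ _ hpi]; congr 1; ring
    refine ⟨?_, by simp [hG, hpi, Complex.cpow_eq_zero_iff]⟩
    rw [← hp]
    field_simp
  · have hG : Complex.Gamma ((w + 1) / 2) ≠ 0 := Complex.Gamma_ne_zero_of_re_pos (by
      rw [show ((w + 1) / 2).re = (w.re + 1) / 2 by simp]; linarith)
    have hp : (Real.pi : ℂ) ^ (w - 1 / 2) * (Real.pi : ℂ) ^ (-((w + 1) / 2)) =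
        (Real.pi : ℂ) ^ (-((1 - w + 1) / 2)) := by
      rw [← Complex.cpow_add _ _ hpi]; congr 1; ring
    refine ⟨?_, by simp [hG, hpi, Complex.cpow_eq_zero_iff]⟩
    rw [← hp, add_comm 1 w, show 1 - w + 1 = 2 - w by ring]
    have hI : Complex.I * Complex.I = -1 := Complex.I_mul_I
    field_simp
    linear_combination (-Complex.Gamma ((2 - w) / 2)) * hI

/-! ### The local functional equation along a linear form -/

lemma integrable_of_even {f : ℝ → ℂ} (h : ∀ x, f (-x) = f x)
    (hf : IntegrableOn f (Set.Ioi 0)) : Integrable f := by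
  have h1 : IntegrableOn f (Set.Iio 0) := by
    have := IntegrableOn.comp_neg_Iio (c := (0 : ℝ)) (f := f) (by simpa using hf)
    simpa [h] using this
  rw [← integrableOn_univ, ← Set.Iic_union_Ioi (a := (0 : ℝ)), integrableOn_union,
    integrableOn_Iic_iff_integrableOn_Iio]
  exact ⟨h1, hf⟩

lemma neg_one_zpow_mul_self (d : ℤ) : (-1 : ℂ) ^ d * (-1) ^ d = 1 := by
  rw [← mul_zpow]; simp

lemma gaussP_mul_homChar_even (d : ℤ) (w : ℂ) (x : ℝ) :
    gaussP d (-x) * homChar w (-d) ((-x : ℝ) : ℂ) = gaussP d x * homChar w (-d) (x : ℂ) := by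
  have : ((-x : ℝ) : ℂ) = (-1) * (x : ℂ) := by push_cast; ring
  rw [gaussP_neg, this, homChar_mul]
  have h1 : homChar w (-d) (-1) = (-1) ^ d := by
    rw [← neg_one_zpow_neg]; simp [homChar, bracket_neg_one]
  rw [h1]
  linear_combination gaussP d x * homChar w (-d) (x : ℂ) * neg_one_zpow_mul_self d

lemma integrable_gaussP_mul_homChar (d : ℤ) {w : ℂ} (hw : w.re < 1) :
    Integrable (fun x : ℝ => gaussP d x * homChar (-w) (-d) (x : ℂ)) ∧
    ∫ x : ℝ, gaussP d x * homChar (-w) (-d) (x : ℂ) = 2 * mellin (gaussP d) (1 - w) := by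
  have hw' : 0 < (1 - w).re := by simp; linarith
  have hc := (mellin_gaussP d hw').1
  have he : Set.EqOn (fun x : ℝ => (x : ℂ) ^ (1 - w - 1) • gaussP d x)
      (fun x : ℝ => gaussP d x * homChar (-w) (-d) (x : ℂ)) (Set.Ioi 0) := by
    intro x (hx : 0 < x)
    simp only [smul_eq_mul]
    rw [homChar_ofReal _ _ hx, mul_comm]
    congr 2; ring
  have hi := integrable_of_even (gaussP_mul_homChar_even d (-w))
    (IntegrableOn.congr_fun hc he measurableSet_Ioi)
  refine ⟨hi, ?_⟩
  rw [integral_even hi (gaussP_mul_homChar_even d (-w)), mellin,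
    setIntegral_congr_fun measurableSet_Ioi he]

/-- Tate's argument. Since `gaussP d` is a Fourier eigenfunction, `ε ∫ F(x) g(r l(x)) = ∫ g(t)
Fh(rt) dt` for every `r`. Taking the Mellin transform in `r` factors each side: a Mellin transform
of `g` times the integral of `F` against the character of `l` on the left, one of `Fh` times an
integral of `g` on the right. For `0 < Re w < 1` and under the stated integrability all the
integrals converge absolutely, so no regularised distribution is needed. -/
lemma mellin_linear_form_eq {α : Type*} [MeasurableSpace α] {ν : Measure α} [SFinite ν]
    {F : α → ℂ} {l : α → ℝ} {Fh : ℝ → ℂ} {d : ℤ} {w : ℂ} (hw0 : 0 < w.re) (hw1 : w.re < 1)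
    (hF : Integrable F ν) (hl : Measurable l) (hl0 : ∀ᵐ x ∂ν, l x ≠ 0)
    (hint : Integrable (fun x => ‖F x‖ * |l x| ^ (-w.re)) ν)
    (hFh : ∀ t, ∫ x, F x * expC (t * l x) ∂ν = Fh t) (hFm : Measurable Fh)
    (hpar : ∀ t, Fh (-t) = (-1) ^ d * Fh t) (hconv : MellinConvergent Fh w) :
    eigenP d * mellin (gaussP d) w * ∫ x, F x * homChar (-w) (-d) (l x : ℂ) ∂ν =
      2 * mellin (gaussP d) (1 - w) * mellin Fh w := by
  have h1 := mellin_integral_comp_mul (gaussP_neg d) (continuous_gaussP d).measurable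
    (mellin_gaussP d hw0).1 hF.1 hl hl0 hint
  have h0 : ∀ᵐ x : ℝ, x ≠ 0 := by simp [ae_iff, measure_singleton]
  have hi := integrable_gaussP_mul_homChar d hw1
  have hn : Integrable (fun x : ℝ => ‖gaussP d x‖ * |x| ^ (-w.re)) := by
    refine hi.1.norm.congr ?_
    filter_upwards [h0] with x hx
    rw [norm_mul, norm_homChar _ _ (by simpa using hx)]
    simp
  have h2 := mellin_integral_comp_mul (ν := (volume : Measure ℝ)) (l := fun x => x) hpar hFm hconv
    (continuous_gaussP d).aestronglyMeasurable measurable_id h0 hn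
  have h3 : (fun r => eigenP d • ∫ x, F x * gaussP d (r * l x) ∂ν) =
      fun r => ∫ t, gaussP d t * Fh (r * t) := by
    funext r
    simp_rw [smul_eq_mul, ← integral_const_mul, mul_left_comm (eigenP d), ← fourier_gaussP]
    simp_rw [← integral_const_mul]
    rw [integral_integral_swap]
    · refine integral_congr_ae (Filter.Eventually.of_forall fun t => ?_)
      simp only
      rw [← hFh, ← integral_const_mul]
      refine integral_congr_ae (Filter.Eventually.of_forall fun x => ?_)
      simp only
      rw [show t * (r * l x) = r * t * l x by ring]
      ring
    · have hb : Integrable (fun p : α × ℝ => F p.1 * gaussP d p.2) (ν.prod volume) :=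
        hF.mul_prod (integrable_gaussP d)
      have hm : AEStronglyMeasurable (fun p : α × ℝ => expC (p.2 * (r * l p.1)))
          (ν.prod volume) := by
        refine Measurable.aestronglyMeasurable ?_
        have := continuous_expC.measurable
        fun_prop
      refine (hb.mul_bdd hm (c := 1) (Filter.Eventually.of_forall fun p => (norm_expC _).le)).congr
        (Filter.Eventually.of_forall fun p => ?_)
      simp only [Function.uncurry]
      ring
  rw [mul_assoc, ← h1, ← smul_eq_mul, ← mellin_const_smul, h3, h2, hi.2]
  ring

/-! ### Holomorphy in the exponent -/

lemma differentiableAt_integral_cpow {α : Type*} [MeasurableSpace α] {ν : Measure α}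
    {h : α → ℂ} {u : α → ℝ} (hh : AEStronglyMeasurable h ν) (hu : Measurable u)
    (hu0 : ∀ᵐ x ∂ν, 0 < u x ∧ u x ≤ 1)
    (hint : ∀ σ : ℝ, -1 < σ → Integrable (fun x => ‖h x‖ * u x ^ σ) ν) {s : ℂ} (hs : -1 < s.re) :
    DifferentiableAt ℂ (fun s : ℂ => ∫ x, h x * (u x : ℂ) ^ s ∂ν) s := by
  -- One `ε` is the radius of the ball around `s`, a second one absorbs the logarithm through `|log
  -- u| u^ε ≤ 1/ε`. A third of `s.re + 1` keeps `s.re - 2ε > -1`.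
  set ε := (s.re + 1) / 3 with hε
  have hε0 : 0 < ε := by rw [hε]; linarith
  have hm : ∀ w : ℂ, AEStronglyMeasurable (fun x => h x * (u x : ℂ) ^ w) ν := fun w =>
    hh.mul (Measurable.aestronglyMeasurable (by fun_prop))
  have key := hasDerivAt_integral_of_dominated_loc_of_deriv_le (μ := ν)
    (F := fun (s : ℂ) x => h x * (u x : ℂ) ^ s)
    (F' := fun (s : ℂ) x => h x * ((u x : ℂ) ^ s * Complex.log (u x)))
    (bound := fun x => ‖h x‖ * u x ^ (s.re - 2 * ε) * (1 / ε))
    (x₀ := s) (Metric.ball_mem_nhds s hε0) (Filter.Eventually.of_forall hm) ?_ ?_ ?_ ?_ ?_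
  · exact key.2.differentiableAt
  · refine (hint s.re hs).congr' (hm s) ?_
    filter_upwards [hu0] with x hx
    rw [norm_mul, norm_mul, norm_norm, Complex.norm_cpow_eq_rpow_re_of_pos hx.1,
      Real.norm_of_nonneg (Real.rpow_nonneg hx.1.le _)]
  · refine hh.mul (Measurable.aestronglyMeasurable ?_)
    have := Complex.measurable_log
    fun_prop
  · filter_upwards [hu0] with x hx z hz
    rw [norm_mul, norm_mul, Complex.norm_cpow_eq_rpow_re_of_pos hx.1, mul_assoc]
    refine mul_le_mul_of_nonneg_left ?_ (norm_nonneg _)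
    have hz' : s.re - ε ≤ z.re := by
      have := (Complex.abs_re_le_norm (z - s)).trans (mem_ball_iff_norm.1 hz).le
      rw [Complex.sub_re] at this
      linarith [neg_abs_le (z.re - s.re)]
    have h1 : u x ^ z.re ≤ u x ^ (s.re - 2 * ε) * u x ^ ε := by
      rw [← Real.rpow_add hx.1]
      exact Real.rpow_le_rpow_of_exponent_ge hx.1 hx.2 (by linarith)
    have h2 : ‖Complex.log (u x)‖ * u x ^ ε ≤ 1 / ε := by
      have := Real.abs_log_mul_self_rpow_lt (u x) ε hx.1 hx.2 hε0
      rw [abs_mul, abs_of_nonneg (Real.rpow_nonneg hx.1.le _)] at this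
      rw [← Complex.ofReal_log hx.1.le, Complex.norm_real]
      exact this.le
    calc u x ^ z.re * ‖Complex.log (u x)‖
        ≤ u x ^ (s.re - 2 * ε) * u x ^ ε * ‖Complex.log (u x)‖ := by gcongr
      _ = u x ^ (s.re - 2 * ε) * (‖Complex.log (u x)‖ * u x ^ ε) := by ring
      _ ≤ _ := by
        have := Real.rpow_nonneg hx.1.le (s.re - 2 * ε)
        gcongr
  · exact (hint _ (by linarith)).mul_const _
  · filter_upwards [hu0] with x hx z _
    refine HasDerivAt.const_mul _ ?_
    have hne : (u x : ℂ) ≠ 0 := by exact_mod_cast hx.1.ne'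
    simpa using (hasDerivAt_id z).const_cpow (c := (u x : ℂ)) (Or.inl hne)

/-! ### Integrability of powers of a linear form -/

lemma lintegral_rpow_Icc_lt_top {σ : ℝ} (hσ : -1 < σ) :
    ∫⁻ x in Set.Icc (-1 : ℝ) 1, ENNReal.ofReal |x| ^ σ < ⊤ := by
  have h1 : IntegrableOn (fun x : ℝ => x ^ σ) (Set.Ioc 0 1) :=
    (intervalIntegrable_iff_integrableOn_Ioc_of_le zero_le_one).1
      (intervalIntegral.intervalIntegrable_rpow' hσ)
  have hpos : ∫⁻ x in Set.Ioc (0 : ℝ) 1, ENNReal.ofReal |x| ^ σ < ⊤ := by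
    refine lt_of_le_of_lt (le_of_eq ?_) h1.lintegral_lt_top
    refine setLIntegral_congr_fun measurableSet_Ioc fun x hx => ?_
    rw [abs_of_pos hx.1, ENNReal.ofReal_rpow_of_pos hx.1]
  have hneg : ∫⁻ x in Set.Ico (-1 : ℝ) 0, ENNReal.ofReal |x| ^ σ < ⊤ := by
    refine lt_of_le_of_lt (le_of_eq ?_) hpos
    have hmp := (Measure.measurePreserving_neg (volume : Measure ℝ)).restrict_preimage
      (measurableSet_Ioc (a := (0 : ℝ)) (b := 1))
    have hpre : (fun x : ℝ => -x) ⁻¹' Set.Ioc 0 1 = Set.Ico (-1) 0 := by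
      ext x; simp only [Set.mem_preimage, Set.mem_Ioc, Set.mem_Ico]
      constructor <;> rintro ⟨h, h'⟩ <;> constructor <;> linarith
    rw [← hmp.lintegral_comp (by fun_prop)]
    change _ = ∫⁻ x in (fun x : ℝ => -x) ⁻¹' Set.Ioc 0 1, _
    rw [hpre]
    simp
  have hsub : Set.Icc (-1 : ℝ) 1 ⊆ (Set.Ico (-1 : ℝ) 0 ∪ Set.Ioc 0 1) ∪ {0} := by
    intro x hx
    rcases lt_trichotomy x 0 with h | h | h
    · exact Or.inl (Or.inl ⟨hx.1, h⟩)
    · exact Or.inr h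
    · exact Or.inl (Or.inr ⟨h, hx.2⟩)
  refine lt_of_le_of_lt (lintegral_mono_set hsub) ?_
  refine lt_of_le_of_lt (lintegral_union_le _ _ _) ?_
  refine ENNReal.add_lt_top.2 ⟨lt_of_le_of_lt (lintegral_union_le _ _ _)
    (ENNReal.add_lt_top.2 ⟨hneg, hpos⟩), ?_⟩
  simp

/-- No coordinates adapted to `l` are chosen. With `l v = 1`, translating by `t v` for `t ∈ [0,1]`
bounds the integral by that of `|l X + t|^σ` over a larger ball. Averaging over `t` and exchanging
the integrals leaves a one-dimensional integral at most `C + 1`, where the 1 accounts for `|x| ≥ 1`.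
-/
lemma lintegral_rpow_linear_form_lt_top {E : Type*} [NormedAddCommGroup E] [NormedSpace ℝ E]
    [MeasurableSpace E] [BorelSpace E] [SecondCountableTopology E] {ν : Measure E} [SFinite ν]
    [ν.IsAddRightInvariant] [IsFiniteMeasureOnCompacts ν] [ProperSpace E] (l : E →L[ℝ] ℝ) (hl : l ≠ 0)
    {σ : ℝ} (hσ : -1 < σ) (hσ0 : σ < 0) (R : ℝ) :
    ∫⁻ X in Metric.closedBall 0 R, ENNReal.ofReal |l X| ^ σ ∂ν < ⊤ := by
  obtain ⟨v, hv⟩ : ∃ v, l v = 1 := by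
    obtain ⟨v, hv⟩ : ∃ v, l v ≠ 0 := by
      by_contra! h
      exact hl (ContinuousLinearMap.ext h)
    exact ⟨(l v)⁻¹ • v, by simp [hv]⟩
  set C := ∫⁻ x in Set.Icc (-1 : ℝ) 1, ENNReal.ofReal |x| ^ σ with hC
  have hCt : C < ⊤ := lintegral_rpow_Icc_lt_top hσ
  set φ : ℝ → ℝ≥0∞ := fun x => ENNReal.ofReal |x| ^ σ with hφ
  have hφm : Measurable φ := by fun_prop
  have hlm : Measurable l := l.continuous.measurable
  have hone : ∀ a : ℝ, ∫⁻ t in Set.Icc (0 : ℝ) 1, φ (a + t) ≤ C + 1 := by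
    intro a
    have h1 : ∀ x, φ x ≤ (Set.Icc (-1 : ℝ) 1).indicator φ x + 1 := by
      intro x
      by_cases hx : x ∈ Set.Icc (-1 : ℝ) 1
      · rw [Set.indicator_of_mem hx]; exact le_self_add
      · rw [Set.indicator_of_notMem hx, zero_add]
        have hx' : 1 ≤ |x| := by
          by_contra! h
          exact hx (abs_le.1 h.le)
        exact ENNReal.rpow_le_one_of_one_le_of_neg (ENNReal.one_le_ofReal.2 hx') hσ0
    calc ∫⁻ t in Set.Icc (0 : ℝ) 1, φ (a + t)
        ≤ ∫⁻ t in Set.Icc (0 : ℝ) 1, ((Set.Icc (-1 : ℝ) 1).indicator φ (a + t) + 1) :=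
          lintegral_mono fun t => h1 _
      _ = (∫⁻ t in Set.Icc (0 : ℝ) 1, (Set.Icc (-1 : ℝ) 1).indicator φ (a + t)) + 1 := by
          rw [lintegral_add_right _ measurable_const]; simp [φ]
      _ ≤ (∫⁻ t, (Set.Icc (-1 : ℝ) 1).indicator φ (a + t)) + 1 := by
          gcongr; exact Measure.restrict_le_self
      _ = C + 1 := by
          rw [lintegral_add_left_eq_self (fun t => (Set.Icc (-1 : ℝ) 1).indicator φ t) a,
            lintegral_indicator measurableSet_Icc]
  have hmB : ∀ r : ℝ, MeasurableSet (Metric.closedBall (0 : E) r) := fun r =>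
    Metric.isClosed_closedBall.measurableSet
  have hstep : ∀ t ∈ Set.Icc (0 : ℝ) 1, ∫⁻ X in Metric.closedBall 0 R, φ (l X) ∂ν ≤
      ∫⁻ X in Metric.closedBall 0 (R + ‖v‖), φ (l X + t) ∂ν := by
    intro t ht
    rw [← lintegral_indicator (hmB _), ← lintegral_indicator (hmB _),
      ← lintegral_add_right_eq_self _ (t • v)]
    refine lintegral_mono fun X => ?_
    by_cases hX : X + t • v ∈ Metric.closedBall (0 : E) R
    · have hX' : X ∈ Metric.closedBall (0 : E) (R + ‖v‖) := by
        rw [mem_closedBall_zero_iff] at hX ⊢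
        have h1 : ‖t • v‖ ≤ ‖v‖ := by
          rw [norm_smul, Real.norm_of_nonneg ht.1]
          exact mul_le_of_le_one_left (norm_nonneg _) ht.2
        have h2 := norm_sub_le (X + t • v) (t • v)
        rw [add_sub_cancel_right] at h2
        linarith
      rw [Set.indicator_of_mem hX, Set.indicator_of_mem hX', map_add, map_smul, hv, smul_eq_mul,
        mul_one]
    · rw [Set.indicator_of_notMem hX]; exact zero_le
  calc ∫⁻ X in Metric.closedBall 0 R, φ (l X) ∂ν
      = ∫⁻ t in Set.Icc (0 : ℝ) 1, ∫⁻ X in Metric.closedBall 0 R, φ (l X) ∂ν := by simp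
    _ ≤ ∫⁻ t in Set.Icc (0 : ℝ) 1, ∫⁻ X in Metric.closedBall 0 (R + ‖v‖), φ (l X + t) ∂ν :=
        setLIntegral_mono' measurableSet_Icc hstep
    _ = ∫⁻ X in Metric.closedBall 0 (R + ‖v‖), (∫⁻ t in Set.Icc (0 : ℝ) 1, φ (l X + t)) ∂ν := by
        refine lintegral_lintegral_swap (Measurable.aemeasurable ?_)
        simp only [Function.uncurry_def]
        fun_prop
    _ ≤ ∫⁻ X in Metric.closedBall 0 (R + ‖v‖), (C + 1) ∂ν := lintegral_mono fun X => hone _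
    _ < ⊤ := by
        rw [setLIntegral_const]
        exact ENNReal.mul_lt_top (ENNReal.add_lt_top.2 ⟨hCt, ENNReal.one_lt_top⟩)
          (isCompact_closedBall _ _).measure_lt_top

lemma one_le_radialMeasure (m : ℕ) : 1 ≤ radialMeasure m (Set.Icc 1 2) := by
  have hs : Set.Icc (1 : ℝ) 2 ⊆ Set.Ioi 0 := fun x hx => lt_of_lt_of_le one_pos hx.1
  rw [radialMeasure, withDensity_apply _ measurableSet_Icc, Measure.restrict_restrict_of_subset hs]
  calc (1 : ℝ≥0∞) = ∫⁻ r in Set.Icc (1 : ℝ) 2, 1 := by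
        rw [setLIntegral_one, Real.volume_Icc]; norm_num
    _ ≤ _ := setLIntegral_mono' measurableSet_Icc fun r hr =>
        ENNReal.one_le_ofReal.2 (one_le_pow₀ hr.1)

/-- The ball of radius 2 contains the shell `1 ≤ r ≤ 2`, where `(r|l|)^σ ≥ 2^σ|l|^σ` because `σ <
0`. The shell has positive radial mass, so finiteness on the ball forces finiteness on the sphere.
-/
lemma lintegral_sphere_rpow_lt_top {m : ℕ} (l : CN m →L[ℝ] ℝ) (hl : l ≠ 0)
    {σ : ℝ} (hσ : -1 < σ) (hσ0 : σ < 0) :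
    ∫⁻ X : Sph m, ENNReal.ofReal |l X| ^ σ ∂(sigma m) < ⊤ := by
  have hB := lintegral_rpow_linear_form_lt_top (ν := (volume : Measure (CN m))) l hl hσ hσ0 2
  have hlm : Measurable l := l.continuous.measurable
  have hmB : MeasurableSet (Metric.closedBall (0 : CN m) 2) :=
    Metric.isClosed_closedBall.measurableSet
  rw [← lintegral_indicator hmB, ← map_polar, lintegral_map (by
    exact Measurable.indicator (by fun_prop) hmB) (by fun_prop)] at hB
  set A := ∫⁻ X : Sph m, ENNReal.ofReal |l X| ^ σ ∂(sigma m)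
  have h2 : (ENNReal.ofReal 2 ^ σ) ≠ 0 := by simp [ENNReal.rpow_eq_zero_iff]
  have hle : A * (ENNReal.ofReal 2 ^ σ * radialMeasure m (Set.Icc 1 2)) < ⊤ := by
    refine lt_of_le_of_lt ?_ hB
    rw [← setLIntegral_const, ← lintegral_indicator measurableSet_Icc,
      ← lintegral_prod_mul (by fun_prop) (by
        exact (Measurable.indicator (by fun_prop) measurableSet_Icc).aemeasurable)]
    refine lintegral_mono fun p => ?_
    by_cases hp : p.2 ∈ Set.Icc (1 : ℝ) 2
    · have h0 : 0 < p.2 := lt_of_lt_of_le one_pos hp.1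
      have hn : p.2 • (p.1 : CN m) ∈ Metric.closedBall (0 : CN m) 2 := by
        rw [mem_closedBall_zero_iff, norm_smul, norm_eq_of_mem_sphere, mul_one,
          Real.norm_of_nonneg h0.le]
        exact hp.2
      rw [Set.indicator_of_mem hp, Set.indicator_of_mem hn, map_smul, smul_eq_mul, abs_mul,
        ENNReal.ofReal_mul (abs_nonneg _),
        ENNReal.mul_rpow_of_ne_top ENNReal.ofReal_ne_top ENNReal.ofReal_ne_top, mul_comm,
        abs_of_pos h0]
      gcongr ?_ * _
      rw [ENNReal.ofReal_rpow_of_pos h0, ENNReal.ofReal_rpow_of_pos two_pos]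
      exact ENNReal.ofReal_le_ofReal (Real.rpow_le_rpow_of_nonpos h0 hp.2 hσ0.le)
    · rw [Set.indicator_of_notMem hp, mul_zero]; exact zero_le
  by_contra hA
  have hA' : A = ⊤ := by simpa using hA
  rw [hA', ENNReal.top_mul] at hle
  · exact lt_irrefl _ hle
  · exact mul_ne_zero h2 (one_pos.trans_le (one_le_radialMeasure m)).ne'

lemma ae_ne_zero_of_lintegral_rpow {α : Type*} [MeasurableSpace α] {ν : Measure α} {u : α → ℝ}
    (hu : Measurable u) {σ : ℝ} (hσ : σ < 0) (h : ∫⁻ x, ENNReal.ofReal |u x| ^ σ ∂ν < ⊤) :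
    ∀ᵐ x ∂ν, u x ≠ 0 := by
  filter_upwards [ae_lt_top (by fun_prop) h.ne] with x hx h0
  simp [h0, ENNReal.zero_rpow_of_neg hσ] at hx

lemma ae_sphere_ne_zero {m : ℕ} (l : CN m →L[ℝ] ℝ) (hl : l ≠ 0) :
    ∀ᵐ X : Sph m ∂(sigma m), l X ≠ 0 :=
  have hlm : Measurable l := l.continuous.measurable
  ae_ne_zero_of_lintegral_rpow (u := fun X : Sph m => l X) (by fun_prop) (σ := -(1 / 2))
    (by norm_num) (lintegral_sphere_rpow_lt_top l hl (by norm_num) (by norm_num))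

lemma integrable_sphere_rpow {m : ℕ} (l : CN m →L[ℝ] ℝ) (hl : l ≠ 0)
    (hl1 : ∀ X : Sph m, |l X| ≤ 1) {h : Sph m → ℂ} (hh : Continuous h) {σ : ℝ} (hσ : -1 < σ) :
    Integrable (fun X : Sph m => ‖h X‖ * |l X| ^ σ) (sigma m) := by
  have hlm : Measurable l := l.continuous.measurable
  -- As `|l| ≤ 1` on the sphere, lowering the exponent only increases the integrand, and the sphere
  -- estimate requires an exponent in `(-1, 0)`.
  obtain ⟨τ, hτ, hτσ, hτ0⟩ : ∃ τ : ℝ, -1 < τ ∧ τ ≤ σ ∧ τ < 0 := by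
    refine ⟨min σ (-(1 / 2)), lt_min hσ (by norm_num), min_le_left _ _, ?_⟩
    exact (min_le_right _ _).trans_lt (by norm_num)
  have hi : Integrable (fun X : Sph m => |l X| ^ τ) (sigma m) := by
    refine ⟨Measurable.aestronglyMeasurable (by fun_prop), ?_⟩
    refine lt_of_le_of_lt (le_of_eq ?_) (lintegral_sphere_rpow_lt_top l hl hτ hτ0)
    refine lintegral_congr_ae ?_
    filter_upwards [ae_sphere_ne_zero l hl] with X hX
    rw [ENNReal.ofReal_rpow_of_pos (abs_pos.2 hX), Real.enorm_of_nonneg (by positivity)]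
  obtain ⟨C, hC⟩ := (isCompact_range hh).isBounded.exists_norm_le
  refine (hi.const_mul C).mono' ?_ ?_
  · exact hh.norm.aestronglyMeasurable.mul (Measurable.aestronglyMeasurable (by fun_prop))
  · filter_upwards [ae_sphere_ne_zero l hl] with X hX
    have hX' := abs_pos.2 hX
    rw [norm_mul, norm_norm, Real.norm_of_nonneg (by positivity)]
    refine mul_le_mul (hC _ ⟨X, rfl⟩) ?_ (by positivity) ((norm_nonneg _).trans (hC _ ⟨X, rfl⟩))
    exact Real.rpow_le_rpow_of_exponent_ge hX' (hl1 X) hτσ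

lemma ae_linear_form_ne_zero {m : ℕ} (l : CN m →L[ℝ] ℝ) (hl : l ≠ 0) :
    ∀ᵐ X : CN m, l X ≠ 0 := by
  have h := Measure.addHaar_submodule (volume : Measure (CN m)) (LinearMap.ker l.toLinearMap)
    fun h => hl (ContinuousLinearMap.ext fun X => by
      have : X ∈ LinearMap.ker l.toLinearMap := h ▸ Submodule.mem_top
      simpa using this)
  rw [ae_iff]
  convert h using 2
  ext X
  simp

lemma integrable_rpow_of_hasCompactSupport {m : ℕ} (l : CN m →L[ℝ] ℝ) (hl : l ≠ 0)
    {F : CN m → ℂ} (hF : Continuous F) (hc : HasCompactSupport F) {σ : ℝ} (hσ : -1 < σ)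
    (hσ0 : σ < 0) : Integrable (fun X : CN m => ‖F X‖ * |l X| ^ σ) := by
  have hlm : Measurable l := l.continuous.measurable
  obtain ⟨R, hR⟩ := hc.isCompact.isBounded.subset_closedBall (0 : CN m)
  obtain ⟨C, hC⟩ := hF.bounded_above_of_compact_support hc
  have hi : IntegrableOn (fun X : CN m => |l X| ^ σ) (Metric.closedBall 0 R) := by
    refine ⟨Measurable.aestronglyMeasurable (by fun_prop), ?_⟩
    refine lt_of_le_of_lt (le_of_eq ?_)
      (lintegral_rpow_linear_form_lt_top (ν := (volume : Measure (CN m))) l hl hσ hσ0 R)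
    refine lintegral_congr_ae ?_
    filter_upwards [ae_restrict_of_ae (ae_linear_form_ne_zero l hl)] with X hX
    rw [ENNReal.ofReal_rpow_of_pos (abs_pos.2 hX), Real.enorm_of_nonneg (by positivity)]
  have hmB : MeasurableSet (Metric.closedBall (0 : CN m) R) :=
    Metric.isClosed_closedBall.measurableSet
  refine ((integrable_indicator_iff hmB).2 (hi.const_mul C)).mono' ?_
    (Filter.Eventually.of_forall fun X => ?_)
  · exact hF.norm.aestronglyMeasurable.mul (Measurable.aestronglyMeasurable (by fun_prop))
  · by_cases hX : X ∈ Metric.closedBall (0 : CN m) R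
    · rw [Set.indicator_of_mem hX, norm_mul, norm_norm, Real.norm_of_nonneg (by positivity)]
      have := hC X
      gcongr
    · rw [Set.indicator_of_notMem hX, image_eq_zero_of_notMem_tsupport fun h => hX (hR h)]
      simp

/-! ### The symplectic Fourier transform -/

/-- The conjugate-linear isometry representing `Re ω`. -/
def sympJ (m : ℕ) : CN m ≃ₗᵢ[ℝ] CN m :=
  (LinearIsometryEquiv.piLpCongrLeft 2 ℝ ℂ (Equiv.sumComm (Fin (m + 1)) (Fin (m + 1)))).trans
    (LinearIsometryEquiv.piLpCongrRight 2 fun i =>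
      Sum.elim (fun _ => Complex.conjLIE.trans (LinearIsometryEquiv.neg ℝ))
        (fun _ => Complex.conjLIE) i)

lemma sympJ_inl {m : ℕ} (Y : CN m) (i : Fin (m + 1)) :
    sympJ m Y (Sum.inl i) = -star (Y (Sum.inr i)) := rfl

lemma sympJ_inr {m : ℕ} (Y : CN m) (i : Fin (m + 1)) :
    sympJ m Y (Sum.inr i) = star (Y (Sum.inl i)) := rfl

lemma omega_re_eq_inner {m : ℕ} (X Y : CN m) : (omega X Y).re = inner ℝ (sympJ m Y) X := by
  rw [omega, PiLp.inner_apply, Fintype.sum_sum_type, Complex.sub_re, Complex.re_sum,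
    Complex.re_sum, sub_eq_neg_add, ← Finset.sum_neg_distrib]
  congr 1 <;> refine Finset.sum_congr rfl fun i _ => ?_
  · rw [sympJ_inl, Complex.inner]
    simp
  · rw [sympJ_inr, Complex.inner]
    simp

/-- The real linear form `X ↦ Re ω(X, Y)`. -/
def omegaForm {m : ℕ} (Y : CN m) : CN m →L[ℝ] ℝ := innerSL ℝ (sympJ m Y)

lemma omegaForm_apply {m : ℕ} (X Y : CN m) : omegaForm Y X = (omega X Y).re := by
  rw [omega_re_eq_inner, omegaForm, innerSL_apply_apply]

lemma omegaForm_ne_zero {m : ℕ} {Y : CN m} (hY : Y ≠ 0) : omegaForm Y ≠ 0 := fun h => by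
  have h1 : omegaForm Y (sympJ m Y) = 0 := by rw [h]; rfl
  rw [omegaForm, innerSL_apply_apply, inner_self_eq_zero] at h1
  exact hY (by simpa using h1)

lemma abs_omegaForm_le {m : ℕ} (X Y : Sph m) : |omegaForm (Y : CN m) X| ≤ 1 := by
  have := abs_real_inner_le_norm (sympJ m (Y : CN m)) (X : CN m)
  rwa [LinearIsometryEquiv.norm_map, norm_eq_of_mem_sphere, norm_eq_of_mem_sphere, mul_one] at this

lemma omega_smul_right {m : ℕ} (a : ℂ) (X Y : CN m) : omega X (a • Y) = omega (a • X) Y := by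
  simp only [omega, PiLp.smul_apply, smul_eq_mul]
  congr 1 <;> refine Finset.sum_congr rfl fun i _ => ?_ <;> ring

lemma omega_real_smul {m : ℕ} (r : ℝ) (X Y : CN m) :
    (omega X (r • Y)).re = r * (omega X Y).re := by
  rw [← omegaForm_apply, ← omegaForm_apply, omegaForm, omegaForm, map_smul, map_smul]
  rfl

/-- The symplectic Fourier transform of a Schwartz function. -/
def sympFT {m : ℕ} (G : 𝓢(CN m, ℂ)) : 𝓢(CN m, ℂ) :=
  SchwartzMap.compCLMOfContinuousLinearEquiv ℂ
    (sympJ m).toContinuousLinearEquiv (FourierTransform.fourier G)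

lemma sympFT_apply {m : ℕ} (G : 𝓢(CN m, ℂ)) (Y : CN m) :
    sympFT G Y = ∫ X, G X * expC (omega X Y).re := by
  have : sympFT G Y = FourierTransform.fourier (G : CN m → ℂ) (sympJ m Y) := by
    rw [← SchwartzMap.fourier_coe]; rfl
  rw [this, fourier_eq_expC]
  simp only [omega_re_eq_inner, real_inner_comm]

/-- `ω(X, uY) = ω(uX, Y)` and `X ↦ uX` preserves volume. Because `ω` is bilinear, the phase type
changes sign, as it must for a map from `V_{-μ,-δ}` to `V_{μ,δ}`. -/
lemma sympFT_unit_smul {m : ℕ} {G : 𝓢(CN m, ℂ)} {d : ℤ}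
    (hG : ∀ u : ℂ, ‖u‖ = 1 → ∀ X, G (u • X) = u ^ d * G X) {u : ℂ} (hu : ‖u‖ = 1) (Y : CN m) :
    sympFT G (u • Y) = u ^ (-d) * sympFT G Y := by
  have hu0 : u ≠ 0 := norm_ne_zero_iff.1 (by rw [hu]; exact one_ne_zero)
  rw [sympFT_apply, sympFT_apply]
  have hmp : MeasurePreserving (fun X : CN m => u • X) := by
    refine ⟨by fun_prop, ?_⟩
    rw [map_complex_smul (CN m) volume hu0, hu]
    simp
  have hemb : MeasurableEmbedding (fun X : CN m => u • X) :=
    (Homeomorph.smulOfNeZero u hu0).measurableEmbedding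
  rw [← hmp.integral_comp hemb (fun X => G X * expC (omega X Y).re), ← integral_const_mul]
  refine integral_congr_ae (Filter.Eventually.of_forall fun X => ?_)
  simp only
  rw [omega_smul_right, hG u hu, zpow_neg]
  field_simp

/-! ### Cutting off a homogeneous function -/

/-- A bump function supported in `[1, 3]`. -/
def radialBump : ContDiffBump (2 : ℝ) := ⟨1 / 2, 1, by norm_num, by norm_num⟩

lemma radialBump_eq_zero {r : ℝ} (h : r ≤ 1 ∨ 3 ≤ r) : radialBump r = 0 := by
  have : r ∉ Function.support radialBump := by
    rw [radialBump.support_eq, Metric.mem_ball, Real.dist_eq]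
    change ¬ |r - 2| < 1
    rw [abs_lt]
    rintro ⟨h1, h2⟩
    rcases h with h | h <;> linarith
  simpa using this

lemma contDiff_cutoff {m : ℕ} {f : CN m → ℂ} (hf : ContDiffOn ℝ ∞ f {0}ᶜ) :
    ContDiff ℝ ∞ fun X : CN m => f X * (radialBump ‖X‖ : ℂ) := by
  rw [contDiff_iff_contDiffAt]
  intro X
  rcases eq_or_ne X 0 with rfl | hX
  · refine contDiffAt_const (c := (0 : ℂ)) |>.congr_of_eventuallyEq ?_
    filter_upwards [Metric.ball_mem_nhds (0 : CN m) one_pos] with X hX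
    rw [radialBump_eq_zero (Or.inl (mem_ball_zero_iff.1 hX).le)]
    simp
  · refine (hf.contDiffAt (isOpen_compl_singleton.mem_nhds hX)).mul ?_
    exact Complex.ofRealCLM.contDiff.contDiffAt.comp X
      (radialBump.contDiff.contDiffAt.comp X (contDiffAt_norm ℝ hX))

lemma hasCompactSupport_cutoff {m : ℕ} (f : CN m → ℂ) :
    HasCompactSupport fun X : CN m => f X * (radialBump ‖X‖ : ℂ) := by
  refine HasCompactSupport.intro (isCompact_closedBall (0 : CN m) 3) fun X hX => ?_
  rw [radialBump_eq_zero (Or.inr ?_)]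
  · simp
  · rw [mem_closedBall_zero_iff, not_le] at hX
    exact hX.le

/-- The product of a function of `V^∞` with a radial bump function. -/
def cutoff {m : ℕ} {μ : ℂ} {δ : ℤ} (f : Vsmooth m μ δ) : 𝓢(CN m, ℂ) :=
  (hasCompactSupport_cutoff (f : CN m → ℂ)).toSchwartzMap (contDiff_cutoff f.2.1)

lemma cutoff_apply {m : ℕ} {μ : ℂ} {δ : ℤ} (f : Vsmooth m μ δ) (X : CN m) :
    cutoff f X = (f : CN m → ℂ) X * (radialBump ‖X‖ : ℂ) := rfl

lemma cutoff_unit_smul {m : ℕ} {μ : ℂ} {δ : ℤ} (f : Vsmooth m μ δ) {u : ℂ} (hu : ‖u‖ = 1)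
    (X : CN m) : cutoff f (u • X) = u ^ (-δ) * cutoff f X := by
  have hu0 : u ≠ 0 := norm_ne_zero_iff.1 (by rw [hu]; exact one_ne_zero)
  rw [cutoff_apply, cutoff_apply, norm_smul, hu, one_mul]
  rcases eq_or_ne X 0 with rfl | hX
  · rw [norm_zero, radialBump_eq_zero (Or.inl zero_le_one)]
    simp
  · rw [vsmooth_isHomog f u hu0 X hX, homChar, hu, bracket, hu]
    simp [mul_assoc]

/-- The Mellin transform of the radial bump function. -/
def bumpMellin (w : ℂ) : ℂ := mellin (fun r : ℝ => (radialBump r : ℂ)) w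

lemma locallyIntegrableOn_bump :
    LocallyIntegrableOn (fun r : ℝ => (radialBump r : ℂ)) (Set.Ioi 0) :=
  (Complex.continuous_ofReal.comp radialBump.continuous).locallyIntegrable.locallyIntegrableOn _

lemma isBigO_bump_atTop (k : ℝ) :
    (fun r : ℝ => (radialBump r : ℂ)) =O[Filter.atTop] fun r => r ^ k := by
  refine (Asymptotics.isBigO_zero _ _).congr' ?_ Filter.EventuallyEq.rfl
  filter_upwards [Filter.eventually_ge_atTop 3] with r hr
  rw [radialBump_eq_zero (Or.inr hr)]; simp

lemma isBigO_bump_zero (k : ℝ) :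
    (fun r : ℝ => (radialBump r : ℂ)) =O[nhdsWithin 0 (Set.Ioi 0)] fun r => r ^ k := by
  refine (Asymptotics.isBigO_zero _ _).congr' ?_ Filter.EventuallyEq.rfl
  filter_upwards [mem_nhdsWithin_of_mem_nhds (Iio_mem_nhds one_pos)] with r hr
  rw [radialBump_eq_zero (Or.inl (le_of_lt hr))]; simp

lemma mellinConvergent_bump (w : ℂ) : MellinConvergent (fun r : ℝ => (radialBump r : ℂ)) w :=
  mellinConvergent_of_isBigO_rpow (a := w.re + 1) (b := w.re - 1) locallyIntegrableOn_bump
    (isBigO_bump_atTop _) (by linarith) (isBigO_bump_zero _) (by linarith)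

lemma differentiable_bumpMellin : Differentiable ℂ bumpMellin := fun w =>
  mellin_differentiableAt_of_isBigO_rpow (a := w.re + 1) (b := w.re - 1) locallyIntegrableOn_bump
    (isBigO_bump_atTop _) (by linarith) (isBigO_bump_zero _) (by linarith)

/-- The value is `∫ χ(r) dr/r` for the bump `χ`, the integral of a nonnegative function that is
positive near 2. Dividing by it removes the arbitrary cutoff. -/
lemma bumpMellin_zero_ne_zero : bumpMellin 0 ≠ 0 := by
  have h1 : bumpMellin 0 = ((∫ r in Set.Ioi (0 : ℝ), r⁻¹ * radialBump r : ℝ) : ℂ) := by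
    rw [bumpMellin, mellin, ← integral_complex_ofReal]
    refine setIntegral_congr_fun measurableSet_Ioi fun r (hr : 0 < r) => ?_
    simp [Complex.cpow_neg_one]
  have hc := mellinConvergent_bump 0
  have hi : IntegrableOn (fun r : ℝ => r⁻¹ * radialBump r) (Set.Ioi 0) := by
    refine IntegrableOn.congr_fun (Integrable.re hc) (fun r hr => ?_) measurableSet_Ioi
    simp only [zero_sub, Complex.cpow_neg_one, smul_eq_mul]
    rw [← Complex.ofReal_inv, ← Complex.ofReal_mul]
    rfl
  rw [h1, Complex.ofReal_ne_zero]
  refine ne_of_gt ?_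
  rw [setIntegral_pos_iff_support_of_nonneg_ae _ hi]
  · have hsub : Set.Ioo (3 / 2 : ℝ) (5 / 2) ⊆
        Function.support (fun r : ℝ => r⁻¹ * radialBump r) ∩ Set.Ioi 0 := by
      intro r hr
      have hr0 : 0 < r := lt_trans (by norm_num) hr.1
      refine ⟨?_, hr0⟩
      have : 0 < radialBump r := by
        refine radialBump.pos_of_mem_ball ?_
        rw [Metric.mem_ball, Real.dist_eq]
        change |r - 2| < 1
        rw [abs_lt]
        constructor <;> linarith [hr.1, hr.2]
      exact (mul_pos (inv_pos.2 hr0) this).ne'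
    refine lt_of_lt_of_le ?_ (measure_mono hsub)
    rw [Real.volume_Ioo]
    norm_num
  · filter_upwards [ae_restrict_mem measurableSet_Ioi] with r hr
    exact mul_nonneg (inv_nonneg.2 (le_of_lt hr)) radialBump.nonneg

/-! ### Radial Mellin transforms of Schwartz functions -/

/-- The Mellin transform of a function along the ray through a point. -/
def radialMellin {m : ℕ} (G : CN m → ℂ) (w : ℂ) (Y : CN m) : ℂ := mellin (fun r : ℝ => G (r • Y)) w

lemma isBigO_ray {m : ℕ} (G : 𝓢(CN m, ℂ)) {Y : CN m} (hY : Y ≠ 0) (k : ℝ) :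
    (fun r : ℝ => G (r • Y)) =O[Filter.atTop] fun r => r ^ (-k) := by
  have h1 := G.isBigO_cocompact_rpow (-k)
  have h2 : Filter.Tendsto (fun r : ℝ => r • Y) Filter.atTop (Filter.cocompact (CN m)) := by
    rw [← Metric.cobounded_eq_cocompact, ← tendsto_norm_atTop_iff_cobounded]
    simp_rw [norm_smul, Real.norm_eq_abs]
    exact Filter.tendsto_abs_atTop_atTop.atTop_mul_const (norm_pos_iff.2 hY)
  refine (h1.comp_tendsto h2).trans ?_
  refine Asymptotics.IsBigO.of_bound (‖Y‖ ^ (-k)) ?_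
  filter_upwards [Filter.eventually_gt_atTop 0] with r hr
  simp only [Function.comp]
  rw [norm_smul, Real.norm_of_nonneg hr.le, Real.mul_rpow hr.le (norm_nonneg _), norm_mul,
    Real.norm_of_nonneg (by positivity : 0 ≤ ‖Y‖ ^ (-k)), mul_comm]

lemma isBigO_ray_zero {m : ℕ} (G : 𝓢(CN m, ℂ)) (Y : CN m) :
    (fun r : ℝ => G (r • Y)) =O[nhdsWithin 0 (Set.Ioi 0)] fun r => r ^ (-(0 : ℝ)) := by
  have hc : Continuous fun r : ℝ => G (r • Y) := by
    have := G.continuous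
    fun_prop
  simp only [neg_zero, Real.rpow_zero]
  exact ((hc.tendsto 0).mono_left nhdsWithin_le_nhds).isBigO_one ℝ

lemma locallyIntegrableOn_ray {m : ℕ} (G : 𝓢(CN m, ℂ)) (Y : CN m) :
    LocallyIntegrableOn (fun r : ℝ => G (r • Y)) (Set.Ioi 0) := by
  have hc : Continuous fun r : ℝ => G (r • Y) := by
    have := G.continuous
    fun_prop
  exact hc.locallyIntegrable.locallyIntegrableOn _

lemma mellinConvergent_ray {m : ℕ} (G : 𝓢(CN m, ℂ)) {Y : CN m} (hY : Y ≠ 0) {w : ℂ}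
    (hw : 0 < w.re) : MellinConvergent (fun r : ℝ => G (r • Y)) w :=
  mellinConvergent_of_isBigO_rpow (locallyIntegrableOn_ray G Y) (isBigO_ray G hY (w.re + 1))
    (by linarith) (isBigO_ray_zero G Y) hw

lemma differentiableAt_radialMellin {m : ℕ} (G : 𝓢(CN m, ℂ)) {Y : CN m} (hY : Y ≠ 0) {w : ℂ}
    (hw : 0 < w.re) : DifferentiableAt ℂ (fun w => radialMellin G w Y) w :=
  mellin_differentiableAt_of_isBigO_rpow (locallyIntegrableOn_ray G Y)
    (isBigO_ray G hY (w.re + 1)) (by linarith) (isBigO_ray_zero G Y) hw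

lemma measurable_radialMellin {m : ℕ} {G : CN m → ℂ} (hG : Measurable G) (w : ℂ) :
    Measurable (radialMellin G w) := by
  refine (StronglyMeasurable.integral_prod_right (ν := volume.restrict (Set.Ioi (0 : ℝ)))
    (f := fun (Y : CN m) (r : ℝ) => (r : ℂ) ^ (w - 1) • G (r • Y)) ?_).measurable
  refine Measurable.stronglyMeasurable ?_
  simp only [Function.uncurry_def]
  fun_prop

lemma radialMellin_smul {m : ℕ} {G : CN m → ℂ} {d : ℤ}
    (hG : ∀ u : ℂ, ‖u‖ = 1 → ∀ X, G (u • X) = u ^ d * G X) (w : ℂ) {a : ℂ} (ha : a ≠ 0) (Y : CN m) :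
    radialMellin G w (a • Y) = homChar (-w) d a * radialMellin G w Y := by
  have ha' : 0 < ‖a‖ := norm_pos_iff.2 ha
  have h1 : (fun r : ℝ => G (r • a • Y)) = fun r : ℝ => bracket a ^ d • G ((‖a‖ * r) • Y) := by
    funext r
    rw [smul_eq_mul, ← hG _ (norm_bracket ha)]
    congr 1
    rw [← Complex.coe_smul, ← Complex.coe_smul, smul_smul, smul_smul]
    congr 1
    have : (‖a‖ : ℂ) ≠ 0 := by exact_mod_cast ha'.ne'
    rw [bracket]
    push_cast
    field_simp
  rw [radialMellin, h1, mellin_const_smul, mellin_comp_mul_left (fun r : ℝ => G (r • Y)) w ha',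
    homChar, radialMellin, smul_eq_mul, smul_eq_mul]
  ring

/-- Schwartz decay with the exponents `N-1 = 2m+1` and `N+1 = 2m+3` bounds the integrand by a
multiple of `1/(1+r²)`, uniformly on the sphere. Hence radial Mellin transforms at real part `N` are
bounded there, and so square integrable. -/
lemma exists_integral_ray_le {m : ℕ} (G : 𝓢(CN m, ℂ)) {w : ℂ} (hw : w.re = (dimN m).re) :
    ∃ C, ∀ Y : Sph m, ∫ r in Set.Ioi (0 : ℝ), ‖(r : ℂ) ^ (w - 1) • G (r • (Y : CN m))‖ ≤ C := by
  obtain ⟨C₁, -, hC₁⟩ := G.decay (2 * m + 1) 0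
  obtain ⟨C₂, -, hC₂⟩ := G.decay (2 * m + 3) 0
  simp only [norm_iteratedFDeriv_zero] at hC₁ hC₂
  refine ⟨∫ r in Set.Ioi (0 : ℝ), (C₁ + C₂) * (1 + r ^ 2)⁻¹, fun Y => ?_⟩
  refine integral_mono_of_nonneg (Filter.Eventually.of_forall fun r => norm_nonneg _)
    (integrable_inv_one_add_sq.integrableOn.const_mul _) ?_
  filter_upwards [ae_restrict_mem measurableSet_Ioi] with r (hr : 0 < r)
  have hn : ‖r • (Y : CN m)‖ = r := by
    rw [norm_smul, norm_eq_of_mem_sphere, mul_one, Real.norm_of_nonneg hr.le]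
  have h1 := hC₁ (r • (Y : CN m))
  have h2 := hC₂ (r • (Y : CN m))
  rw [hn] at h1 h2
  have he : (w - 1).re = (2 * m + 1 : ℕ) := by
    rw [Complex.sub_re, hw, dimN_re]; push_cast; simp; ring
  rw [norm_smul, Complex.norm_cpow_eq_rpow_re_of_pos hr, he, Real.rpow_natCast,
    ← div_eq_mul_inv, le_div_iff₀ (by positivity)]
  calc r ^ (2 * m + 1) * ‖G (r • (Y : CN m))‖ * (1 + r ^ 2)
      = r ^ (2 * m + 1) * ‖G (r • (Y : CN m))‖ + r ^ (2 * m + 3) * ‖G (r • (Y : CN m))‖ := by ring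
    _ ≤ _ := add_le_add h1 h2

/-! ### Values of the normalised Knapp-Stein operator -/

lemma knappSteinIntegral_eq {m : ℕ} (δ : ℤ) (f : CN m → ℂ) (Y : CN m) (z : ℂ) :
    knappSteinIntegral δ f Y z =
      ∫ X : Sph m, f X * homChar (-z - dimN m) (-δ) (omegaForm Y X : ℂ) ∂(sigma m) := by
  refine integral_congr_ae (Filter.Eventually.of_forall fun X => ?_)
  simp only [omegaForm_apply, homChar, Complex.norm_real, Real.norm_eq_abs, mul_assoc]

lemma integral_radial_bump (m : ℕ) (w : ℂ) :
    ∫ r : ℝ, (radialBump r : ℂ) * (r : ℂ) ^ (w - 2 * dimN m) ∂(radialMeasure m) =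
      bumpMellin w := by
  rw [radialMeasure, integral_withDensity_eq_integral_toReal_smul (by fun_prop)
    (Filter.Eventually.of_forall fun _ => ENNReal.ofReal_lt_top), bumpMellin, mellin]
  refine setIntegral_congr_fun measurableSet_Ioi fun r (hr : 0 < r) => ?_
  have hr' : (r : ℂ) ≠ 0 := by exact_mod_cast hr.ne'
  have h1 : (r : ℂ) ^ (w - 1) = (r : ℂ) ^ (4 * m + 3) * (r : ℂ) ^ (w - 2 * dimN m) := by
    rw [← Complex.cpow_natCast, ← Complex.cpow_add _ _ hr', dimN]
    congr 1
    push_cast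
    ring
  rw [ENNReal.toReal_ofReal (by positivity), h1, Complex.real_smul, smul_eq_mul]
  push_cast
  ring

/-- Along a ray `f` contributes `r^{μ-N}` and the kernel `r^{-z-N}`. Against `r^{2N-1} dr` this
leaves `r^{μ-z-1} dr`, so the bump contributes its Mellin transform at `μ - z`. -/
lemma integral_cutoff_mul_homChar {m : ℕ} {μ : ℂ} {δ : ℤ} (f : Vsmooth m (-μ) (-δ)) (Y : CN m)
    (z : ℂ) :
    ∫ X : CN m, cutoff f X * homChar (-z - dimN m) (-δ) (omegaForm Y X : ℂ) =
      knappSteinIntegral δ f Y z * bumpMellin (μ - z) := by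
  have hlm : Measurable (omegaForm Y) := (omegaForm Y).continuous.measurable
  have hcm : Measurable (cutoff f) := (cutoff f).continuous.measurable
  rw [← map_polar m, integral_map (by fun_prop) (Measurable.aestronglyMeasurable (by fun_prop)),
    knappSteinIntegral_eq, ← integral_radial_bump m, ← integral_prod_mul]
  have h0 : ∀ᵐ r ∂(radialMeasure m), r ∈ Set.Ioi (0 : ℝ) :=
    (withDensity_absolutelyContinuous _ _).ae_le (ae_restrict_mem measurableSet_Ioi)
  have h1 : ∀ᵐ p : Sph m × ℝ ∂((sigma m).prod (radialMeasure m)), p.2 ∈ Set.Ioi (0 : ℝ) :=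
    Measure.quasiMeasurePreserving_snd.ae h0
  refine integral_congr_ae ?_
  filter_upwards [h1] with p hp
  have hp' : 0 < p.2 := hp
  have hpc : (p.2 : ℂ) ≠ 0 := by exact_mod_cast hp'.ne'
  have hX : (p.1 : CN m) ≠ 0 := ne_zero_of_mem_unit_sphere p.1
  have hf : (f : CN m → ℂ) (p.2 • (p.1 : CN m)) =
      (p.2 : ℂ) ^ (μ - dimN m) * (f : CN m → ℂ) p.1 := by
    rw [← Complex.coe_smul, vsmooth_isHomog f _ hpc _ hX, homChar_ofReal _ _ hp', neg_neg]
  rw [cutoff_apply, hf, norm_smul, norm_eq_of_mem_sphere, mul_one, Real.norm_of_nonneg hp'.le,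
    map_smul, smul_eq_mul, Complex.ofReal_mul, homChar_mul, homChar_ofReal _ _ hp',
    show μ - z - 2 * dimN m = (μ - dimN m) + (-z - dimN m) by ring, Complex.cpow_add _ _ hpc]
  ring

/-- The functional equation with `w = z + N` and the linear form `Re ω(·,Y)`: since `ω` is
real-linear in `Y`, the transform of the cutoff along that form at `t` is `sympFT` at `t • Y`. The
Gaussian factors combine into `C_N`. -/
lemma integral_cutoff_eq_normFactor {m : ℕ} {μ : ℂ} {δ : ℤ} (f : Vsmooth m (-μ) (-δ)) {Y : CN m}
    (hY : Y ≠ 0) {z : ℂ} (h0 : 0 < (z + dimN m).re) (h1 : (z + dimN m).re < 1) :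
    ∫ X : CN m, cutoff f X * homChar (-z - dimN m) (-δ) (omegaForm Y X : ℂ) =
      normFactor m z δ * radialMellin (sympFT (cutoff f)) (z + dimN m) Y := by
  have hpar : ∀ u : ℂ, ‖u‖ = 1 → ∀ X, sympFT (cutoff f) (u • X) = u ^ (-δ) * sympFT (cutoff f) X :=
    fun u hu X => sympFT_unit_smul (d := δ)
      (fun u hu X => by rw [cutoff_unit_smul f hu, neg_neg]) hu X
  have key := mellin_linear_form_eq (F := cutoff f) (l := omegaForm Y)
    (Fh := fun r : ℝ => sympFT (cutoff f) (r • Y)) (d := δ) (w := z + dimN m) h0 h1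
    (cutoff f).integrable (omegaForm Y).continuous.measurable
    (ae_linear_form_ne_zero _ (omegaForm_ne_zero hY))
    (integrable_rpow_of_hasCompactSupport _ (omegaForm_ne_zero hY) (cutoff f).continuous
      (hasCompactSupport_cutoff _) (by linarith) (by linarith))
    (fun t => by simp only [sympFT_apply, omega_real_smul, omegaForm_apply])
    (by have := (sympFT (cutoff f)).continuous.measurable; fun_prop)
    (fun t => by
      have := hpar (-1) (by simp) (t • Y)
      rw [neg_one_zpow_neg] at this
      rw [← this]; simp)
    (mellinConvergent_ray _ hY h0)
  obtain ⟨h2, h3⟩ := eigenP_mul_normFactor m δ h0 h1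
  have h4 : eigenP δ ≠ 0 := by
    unfold eigenP
    split_ifs <;> simp
  rw [← h2] at key
  apply mul_left_cancel₀ (mul_ne_zero h4 h3)
  rw [show -z - dimN m = -(z + dimN m) by ring, key, radialMellin]
  ring

lemma meromorphicAt_normFactor (m : ℕ) (δ : ℤ) (z : ℂ) :
    MeromorphicAt (fun z => normFactor m z δ) z := by
  have hpi : (Real.pi : ℂ) ≠ 0 := by simp [Real.pi_ne_zero]
  have hG : ∀ {g : ℂ → ℂ}, Differentiable ℂ g → MeromorphicAt (fun z => Complex.Gamma (g z)) z :=
    fun {g} hg => (Meromorphic.Gamma (g z)).comp_analyticAt (hg.analyticAt z)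
  have hp : MeromorphicAt (fun z => (Real.pi : ℂ) ^ (z + dimN m - 1 / 2)) z := by
    refine AnalyticAt.meromorphicAt (Differentiable.analyticAt ?_ z)
    intro w
    exact (DifferentiableAt.const_cpow (by fun_prop) (Or.inl hpi))
  unfold normFactor
  split_ifs
  · exact ((MeromorphicAt.const 2 z).mul hp).mul ((hG (by fun_prop)).div (hG (by fun_prop)))
  · exact ((MeromorphicAt.const (2 * Complex.I) z).mul hp).mul
      ((hG (by fun_prop)).div (hG (by fun_prop)))

lemma normFactor_ne_zero_of_im (m : ℕ) (δ : ℤ) {z : ℂ} (hz : z.im ≠ 0) : normFactor m z δ ≠ 0 := by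
  have hG : ∀ a : ℂ, a.im ≠ 0 → Complex.Gamma a ≠ 0 := by
    intro a ha h
    obtain ⟨n, hn⟩ := (Complex.Gamma_eq_zero_iff a).1 h
    exact ha (by rw [hn]; simp)
  have hd : (dimN m).im = 0 := by rw [dimN_eq_ofReal, Complex.ofReal_im]
  have hpi : (Real.pi : ℂ) ≠ 0 := by simp [Real.pi_ne_zero]
  have hp : (Real.pi : ℂ) ^ (z + dimN m - 1 / 2) ≠ 0 := by simp [Complex.cpow_eq_zero_iff, hpi]
  have h1 : Complex.Gamma ((1 - z - dimN m) / 2) ≠ 0 := hG _ (by simp [hd, hz])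
  have h2 : Complex.Gamma ((z + dimN m) / 2) ≠ 0 := hG _ (by simp [hd, hz])
  have h3 : Complex.Gamma ((2 - z - dimN m) / 2) ≠ 0 := hG _ (by simp [hd, hz])
  have h4 : Complex.Gamma ((1 + z + dimN m) / 2) ≠ 0 := hG _ (by simp [hd, hz])
  unfold normFactor
  split_ifs
  · exact mul_ne_zero (mul_ne_zero two_ne_zero hp) (div_ne_zero h1 h2)
  · exact mul_ne_zero (mul_ne_zero (mul_ne_zero two_ne_zero Complex.I_ne_zero) hp)
      (div_ne_zero h3 h4)

lemma eventually_normFactor_ne_zero (m : ℕ) (δ : ℤ) (z : ℂ) :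
    ∀ᶠ w in 𝓝[≠] z, normFactor m w δ ≠ 0 := by
  refine (meromorphicAt_normFactor m δ z).eventually_eq_zero_or_eventually_ne_zero.resolve_left ?_
  intro h
  -- `C_N` does not vanish off the real axis, where no Gamma function involved meets a pole.
  -- Approaching `z` vertically rules out that `C_N` vanishes identically nearby.
  have ht : Filter.Tendsto (fun t : ℝ => z + t * Complex.I) (𝓝[>] 0) (𝓝[≠] z) := by
    refine tendsto_nhdsWithin_iff.2 ⟨?_, ?_⟩
    · have : Continuous fun t : ℝ => z + t * Complex.I := by fun_prop
      have := this.tendsto 0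
      simp only [Complex.ofReal_zero, zero_mul, add_zero] at this
      exact this.mono_left nhdsWithin_le_nhds
    · filter_upwards [self_mem_nhdsWithin] with t ht
      have : (t : ℂ) ≠ 0 := by exact_mod_cast (ne_of_gt ht)
      simp [this]
  have him : ∀ᶠ t : ℝ in 𝓝[>] 0, (z + t * Complex.I).im ≠ 0 := by
    simp only [Complex.add_im, Complex.mul_im, Complex.ofReal_re, Complex.I_im, mul_one,
      Complex.ofReal_im, Complex.I_re, mul_zero, add_zero]
    rcases eq_or_ne z.im 0 with h0 | h0
    · filter_upwards [self_mem_nhdsWithin] with t ht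
      rw [h0, zero_add]
      exact ne_of_gt ht
    · have : Continuous fun t : ℝ => z.im + t := by fun_prop
      have h1 := this.continuousAt.eventually_ne (x := 0) (y := 0) (by simpa using h0)
      exact h1.filter_mono nhdsWithin_le_nhds
  obtain ⟨t, ht1, ht2⟩ := ((ht.eventually h).and him).exists
  exact normFactor_ne_zero_of_im m δ ht2 ht1

lemma differentiableOn_knappSteinIntegral {m : ℕ} {μ : ℂ} {δ : ℤ} (f : Vsmooth m μ δ) (d : ℤ)
    (Y : Sph m) :
    DifferentiableOn ℂ (knappSteinIntegral d (f : CN m → ℂ) (Y : CN m))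
      {z | z.re < 1 - (dimN m).re} := by
  have hY : (Y : CN m) ≠ 0 := ne_zero_of_mem_unit_sphere Y
  have hf : Continuous fun X : Sph m => (f : CN m → ℂ) X := (restrictC f).continuous
  have hlm : Measurable (omegaForm (Y : CN m)) := (omegaForm (Y : CN m)).continuous.measurable
  have hbm : Measurable fun X : Sph m => homChar 0 (-d) (omegaForm (Y : CN m) X : ℂ) := by fun_prop
  have hae := ae_sphere_ne_zero _ (omegaForm_ne_zero hY)
  intro z hz
  have hz' : -1 < (-z - dimN m).re := by
    simp only [Set.mem_ofPred_eq] at hz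
    rw [Complex.sub_re, Complex.neg_re]; linarith
  have h1 := differentiableAt_integral_cpow (ν := sigma m)
    (h := fun X : Sph m => (f : CN m → ℂ) X * homChar 0 (-d) (omegaForm (Y : CN m) X : ℂ))
    (u := fun X : Sph m => |omegaForm (Y : CN m) X|)
    (hf.aestronglyMeasurable.mul hbm.aestronglyMeasurable) (by fun_prop)
    (by filter_upwards [hae] with X hX using ⟨abs_pos.2 hX, abs_omegaForm_le X Y⟩)
    (fun σ hσ => (integrable_sphere_rpow _ (omegaForm_ne_zero hY)
      (fun X => abs_omegaForm_le X Y) hf hσ).congr (by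
        filter_upwards [hae] with X hX
        rw [norm_mul, norm_homChar _ _ (by exact_mod_cast hX)]
        simp)) hz'
  have h2 : DifferentiableAt ℂ (fun z : ℂ => -z - dimN m) z := by fun_prop
  have h3 := h1.comp z h2
  refine (h3.congr_of_eventuallyEq (Filter.Eventually.of_forall fun w => ?_)).differentiableWithinAt
  rw [knappSteinIntegral_eq]
  refine integral_congr_ae ?_
  filter_upwards [hae] with X hX
  have hX' : (omegaForm (Y : CN m) X : ℂ) ≠ 0 := by exact_mod_cast hX
  simp only [homChar, Complex.norm_real, Real.norm_eq_abs, Complex.cpow_zero, one_mul]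
  ring

/-- The image of `f` under the normalised Knapp-Stein operator. -/
def normalizedFun {m : ℕ} {μ : ℂ} {δ : ℤ} (f : Vsmooth m (-μ) (-δ)) (Y : CN m) : ℂ :=
  (bumpMellin 0)⁻¹ * radialMellin (sympFT (cutoff f)) (μ + dimN m) Y

lemma isNormalizedKSValue_normalizedFun {m : ℕ} {μ : ℂ} (hμ : μ.re = 0) {δ : ℤ}
    (f : Vsmooth m (-μ) (-δ)) (Y : Sph m) :
    IsNormalizedKSValue μ δ (f : CN m → ℂ) (Y : CN m) (normalizedFun f Y) := by
  have hY : (Y : CN m) ≠ 0 := ne_zero_of_mem_unit_sphere Y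
  set I : ℂ → ℂ := knappSteinIntegral δ (f : CN m → ℂ) (Y : CN m) with hI
  set W : ℂ → ℂ := fun z => radialMellin (sympFT (cutoff f)) (z + dimN m) Y with hW
  set M : ℂ → ℂ := fun z => bumpMellin (μ - z) with hM
  have hN : 2 ≤ (dimN m).re := by
    rw [dimN_re]
    have : (0 : ℝ) ≤ m := Nat.cast_nonneg m
    linarith
  have hMd : Differentiable ℂ M := differentiable_bumpMellin.comp (by fun_prop)
  have hWd : DifferentiableOn ℂ W {z | -(dimN m).re < z.re} := by
    intro z hz
    have hz' : 0 < (z + dimN m).re := by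
      simp only [Set.mem_ofPred_eq] at hz
      rw [Complex.add_re]; linarith
    have h1 := differentiableAt_radialMellin (sympFT (cutoff f)) hY hz'
    exact (h1.comp z (by fun_prop : DifferentiableAt ℂ (fun z : ℂ => z + dimN m) z)
      ).differentiableWithinAt
  have hWo : IsOpen {z : ℂ | -(dimN m).re < z.re} := isOpen_lt continuous_const Complex.continuous_re
  have hIo : IsOpen {z : ℂ | z.re < 1 - (dimN m).re} :=
    isOpen_lt Complex.continuous_re continuous_const
  have hstrip : ∀ z : ℂ, -(dimN m).re < z.re → z.re < 1 - (dimN m).re →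
      I z * M z = normFactor m z δ * W z := by
    intro z h0 h1
    rw [hI, hM, hW]
    simp only
    rw [← integral_cutoff_mul_homChar, integral_cutoff_eq_normFactor f hY] <;>
    · rw [Complex.add_re]; linarith
  have hMμ : M μ ≠ 0 := by
    rw [hM]; simpa using bumpMellin_zero_ne_zero
  have hMne : ∀ z, ∀ᶠ w in 𝓝[≠] z, M w ≠ 0 := by
    intro z
    refine (hMd.analyticAt z).eventually_eq_zero_or_eventually_ne_zero.resolve_left fun h => hMμ ?_
    have han : AnalyticOnNhd ℂ M Set.univ := fun w _ => hMd.analyticAt w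
    exact han.eqOn_zero_of_preconnected_of_eventuallyEq_zero isPreconnected_univ (Set.mem_univ z) h
      (Set.mem_univ μ)
  -- The continuation is the integral glued to `C_N W / M` along `Re z = 1 - N`. By `hstrip` the two
  -- agree on the strip to the left of that line, off the isolated zeros of `M`. As `Re μ = 0 > 1 -
  -- N`, the second formula holds near `μ`, and `C_N` cancels at nearby points where it is nonzero.
  refine ⟨fun z => if z.re < 1 - (dimN m).re then I z else normFactor m z δ * W z / M z,
    fun z _ => ?_, fun z hz => if_pos hz, ?_⟩
  · by_cases hz : z.re < 1 - (dimN m).re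
    · have h1 : MeromorphicAt I z :=
        ((differentiableOn_knappSteinIntegral f δ Y).analyticAt (hIo.mem_nhds hz)).meromorphicAt
      refine h1.congr (Filter.Eventually.filter_mono nhdsWithin_le_nhds ?_)
      filter_upwards [hIo.mem_nhds hz] with w hw
      exact (if_pos hw).symm
    · have hz' : z ∈ {z : ℂ | -(dimN m).re < z.re} := by
        simp only [Set.mem_ofPred_eq]; linarith
      have h1 : MeromorphicAt (fun z => normFactor m z δ * W z / M z) z :=
        ((meromorphicAt_normFactor m δ z).mul (hWd.analyticAt (hWo.mem_nhds hz')).meromorphicAt).div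
          (hMd.analyticAt z).meromorphicAt
      refine h1.congr ?_
      filter_upwards [hMne z, nhdsWithin_le_nhds (hWo.mem_nhds hz')] with w hw hw'
      split_ifs with h
      · rw [← hstrip w hw' h, mul_div_cancel_right₀ _ hw]
      · rfl
  · have hμ' : μ ∈ {z : ℂ | 1 - (dimN m).re < z.re} := by
      simp only [Set.mem_ofPred_eq]; linarith
    have hμo : IsOpen {z : ℂ | 1 - (dimN m).re < z.re} :=
      isOpen_lt continuous_const Complex.continuous_re
    have hμW : μ ∈ {z : ℂ | -(dimN m).re < z.re} := by
      simp only [Set.mem_ofPred_eq]; linarith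
    have hc : ContinuousAt (fun z => W z / M z) μ :=
      ((hWd.analyticAt (hWo.mem_nhds hμW)).continuousAt).div (hMd.analyticAt μ).continuousAt hMμ
    have hv : W μ / M μ = normalizedFun f Y := by
      simp only [hW, hM, normalizedFun, sub_self]
      rw [div_eq_inv_mul]
    rw [← hv]
    refine (hc.tendsto.mono_left nhdsWithin_le_nhds).congr' ?_
    filter_upwards [eventually_normFactor_ne_zero m δ μ, nhdsWithin_le_nhds (hμo.mem_nhds hμ')]
      with z hz hz'
    rw [if_neg (not_lt.2 (le_of_lt hz'))]
    field_simp

lemma IsNormalizedKSValue.unique {m : ℕ} {μ : ℂ} {δ : ℤ} {f : CN m → ℂ} {Y : CN m} {w w' : ℂ}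
    (h : IsNormalizedKSValue μ δ f Y w) (h' : IsNormalizedKSValue μ δ f Y w') : w = w' := by
  obtain ⟨Φ, hΦ, hΦ', hl⟩ := h
  obtain ⟨Ψ, hΨ, hΨ', hl'⟩ := h'
  have hD : MeromorphicOn (Φ - Ψ) Set.univ := hΦ.sub hΨ
  -- The point `-N` lies in the half-plane where both continuations equal the integral. Infinite
  -- vanishing order there propagates through the connected plane to `μ`.
  have h0 : meromorphicOrderAt (Φ - Ψ) (-(dimN m).re : ℂ) = ⊤ := by
    rw [meromorphicOrderAt_eq_top_iff]
    have ho : IsOpen {z : ℂ | z.re < 1 - (dimN m).re} :=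
      isOpen_lt Complex.continuous_re continuous_const
    have hm : (-(dimN m).re : ℂ) ∈ {z : ℂ | z.re < 1 - (dimN m).re} := by
      simp only [Set.mem_ofPred_eq, Complex.neg_re, Complex.ofReal_re]; linarith
    filter_upwards [nhdsWithin_le_nhds (ho.mem_nhds hm)] with z hz
    rw [Pi.sub_apply, hΦ' z hz, hΨ' z hz, sub_self]
  have h1 : meromorphicOrderAt (Φ - Ψ) μ = ⊤ := by
    by_contra hne
    exact hD.meromorphicOrderAt_ne_top_of_isPreconnected isPreconnected_univ (Set.mem_univ _)
      (Set.mem_univ _) hne h0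
  rw [meromorphicOrderAt_eq_top_iff] at h1
  refine tendsto_nhds_unique hl (hl'.congr' ?_)
  filter_upwards [h1] with z hz
  rw [Pi.sub_apply, sub_eq_zero] at hz
  rw [hz]

lemma measurable_normalizedFun {m : ℕ} {μ : ℂ} {δ : ℤ} (f : Vsmooth m (-μ) (-δ)) :
    Measurable (normalizedFun f) := 
  (measurable_radialMellin (sympFT (cutoff f)).continuous.measurable _).const_mul _

lemma isHomog_normalizedFun {m : ℕ} {μ : ℂ} {δ : ℤ} (f : Vsmooth m (-μ) (-δ)) :
    IsHomog μ δ (normalizedFun f) := by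
  intro a ha X _
  rw [normalizedFun, radialMellin_smul (d := -δ) (fun u hu X => sympFT_unit_smul
      (fun u hu X => by rw [cutoff_unit_smul f hu, neg_neg]) hu X) _ ha,
    normalizedFun, show -(μ + dimN m) = -μ - dimN m by ring]
  ring

lemma memLp_normalizedFun {m : ℕ} {μ : ℂ} (hμ : μ.re = 0) {δ : ℤ} (f : Vsmooth m (-μ) (-δ)) :
    MemLp (nonCompact (normalizedFun f)) 2 volume := by
  rw [(isHomog_normalizedFun f).memLp_iff hμ (measurable_normalizedFun f)]
  obtain ⟨C, hC⟩ := exists_integral_ray_le (sympFT (cutoff f)) (w := μ + dimN m) (by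
    rw [Complex.add_re, hμ, zero_add])
  refine MemLp.of_bound ?_ (‖(bumpMellin 0)⁻¹‖ * C) (Filter.Eventually.of_forall fun Y => ?_)
  · have := measurable_normalizedFun f
    exact Measurable.aestronglyMeasurable (by fun_prop)
  · rw [normalizedFun, norm_mul]
    exact mul_le_mul_of_nonneg_left ((norm_integral_le_integral_norm _).trans (hC Y))
      (norm_nonneg _)

/-! ### Pairing a function on `ℂ^N` with a homogeneous function -/

lemma chartMeasure_radial (m : ℕ) {p : ℝ → ℂ} {P : ℂ → ℂ} (hP : ∀ a, a ≠ 0 → P a = p ‖a‖)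
    (hp : IntegrableOn (fun r : ℝ => (r : ℂ) ^ (4 * m + 3) * p r) (Set.Ioi 0)) :
    Integrable P (chartMeasure m) ∧ ∫ a, P a ∂(chartMeasure m) =
      8 * Real.pi * ∫ r in Set.Ioi (0 : ℝ), (r : ℂ) ^ (4 * m + 3) * p r := by
  have h0 : ∀ᵐ a : ℂ, a ≠ 0 := by simp [ae_iff, measure_singleton]
  set φ : ℝ → ℂ := fun r => ((4 * r ^ (4 * m + 2) : ℝ) : ℂ) * p r with hφ
  have h1 : (fun a : ℂ => (ENNReal.ofReal (4 * ‖a‖ ^ (4 * m + 2))).toReal • P a) =ᵐ[volume]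
      fun a : ℂ => φ ‖a‖ := by
    filter_upwards [h0] with a ha
    rw [ENNReal.toReal_ofReal (by positivity), hP a ha, Complex.real_smul]
  have h2 : (fun r : ℝ => r ^ (Module.finrank ℝ ℂ - 1) • φ r) =
      fun r : ℝ => 4 * ((r : ℂ) ^ (4 * m + 3) * p r) := by
    funext r
    rw [Complex.finrank_real_complex, Complex.real_smul, hφ]
    push_cast
    ring
  have hi : Integrable (fun a : ℂ => φ ‖a‖) := by
    rw [integrable_fun_norm_addHaar, h2]
    exact hp.const_mul _
  constructor
  · rw [chartMeasure, integrable_withDensity_iff_integrable_smul' (by fun_prop)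
      (Filter.Eventually.of_forall fun _ => ENNReal.ofReal_lt_top)]
    exact hi.congr h1.symm
  · rw [chartMeasure, integral_withDensity_eq_integral_toReal_smul (by fun_prop)
      (Filter.Eventually.of_forall fun _ => ENNReal.ofReal_lt_top), integral_congr_ae h1,
      integral_fun_norm_addHaar, h2, integral_const_mul, Complex.finrank_real_complex]
    have : (volume : Measure ℂ).real (Metric.ball 0 1) = Real.pi := by
      simp [Measure.real, Complex.volume_ball]
    rw [this, Complex.real_smul, nsmul_eq_mul]
    push_cast
    ring

lemma measurable_chartPoint (m : ℕ) : Measurable (chartPoint (m := m)) := by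
  have : ∀ i, Measurable fun X : CN m => X i := fun i => by fun_prop
  unfold chartPoint
  fun_prop

lemma measurable_extHom {m : ℕ} (w : ℂ) (d : ℤ) {u : HC m → ℂ} (hu : Measurable u) :
    Measurable (extHom w d u) := by
  have h1 : Measurable fun X : CN m => X (Sum.inl 0) := by fun_prop
  exact ((measurable_homChar w d).comp h1).mul (hu.comp (measurable_chartPoint m))

/-- In the coordinates `X = a (1,X₁,2t,X₂)` the phases `[a]^{-d}` of `G` and `[a]^d` of the
extension cancel, so the integral over `a` is radial. The density gives `8π r^{2N-1} dr`, whence a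
Mellin transform at `w + 2N`. -/
lemma integral_mul_extHom {m : ℕ} (G : 𝓢(CN m, ℂ)) {d : ℤ}
    (hG : ∀ u : ℂ, ‖u‖ = 1 → ∀ X, G (u • X) = u ^ (-d) * G X) {w : ℂ}
    (hw : w.re = -(dimN m).re) {u : HC m → ℂ} (hu : Measurable u) (hu2 : MemLp u 2 volume) :
    Integrable (fun X : CN m => G X * extHom w d u X) ∧
    ∫ X : CN m, G X * extHom w d u X =
      8 * Real.pi * ∫ q : HC m, radialMellin G (w + 2 * dimN m) (embedPoint q) * u q := by
  have hGm : Measurable G := G.continuous.measurable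
  have hem := measurable_extHom w d hu
  have hpm := measurable_embedPoint m
  set w' := w + 2 * dimN m with hw'
  have hw're : w'.re = (dimN m).re := by rw [hw']; simp [hw]; ring
  have hw'pos : 0 < w'.re := by
    rw [hw're, dimN_re]
    have : (0 : ℝ) ≤ m := Nat.cast_nonneg m
    linarith
  have hpow : ∀ r : ℝ, 0 < r → (r : ℂ) ^ (w' - 1) = (r : ℂ) ^ (4 * m + 3) * (r : ℂ) ^ w := by
    intro r hr
    rw [← Complex.cpow_natCast, ← Complex.cpow_add _ _ (by exact_mod_cast hr.ne'), hw', dimN]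
    congr 1
    push_cast
    ring
  set Ψ : ℂ × HC m → ℂ := fun p => G (p.1 • embedPoint p.2) * extHom w d u (p.1 • embedPoint p.2)
    with hΨ
  have hΨm : Measurable Ψ := by fun_prop
  have hΨa : ∀ q : HC m, ∀ a : ℂ, a ≠ 0 →
      Ψ (a, q) = ((‖a‖ : ℂ) ^ w * G (‖a‖ • embedPoint q)) * u q := by
    intro q a ha
    have h1 : a • embedPoint q = bracket a • ‖a‖ • embedPoint q := by
      rw [← Complex.coe_smul, smul_smul, bracket, div_mul_cancel₀ _ (by simpa using ha)]
    have h2 : extHom w d u (embedPoint q) = u q := congrFun (nonCompact_extHom w d u) q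
    simp only [hΨ]
    rw [extHom_smul _ _ _ ha, h2, h1, hG _ (norm_bracket ha), homChar, zpow_neg]
    have := zpow_ne_zero d (bracket_ne_zero ha)
    field_simp
  have hray : ∀ q : HC m, IntegrableOn (fun r : ℝ => (r : ℂ) ^ (w' - 1) • G (r • embedPoint q))
      (Set.Ioi 0) := fun q => mellinConvergent_ray G (embedPoint_ne_zero q) hw'pos
  have hrad : ∀ q : HC m, Integrable (fun a => Ψ (a, q)) (chartMeasure m) ∧
      ∫ a, Ψ (a, q) ∂(chartMeasure m) =
        8 * Real.pi * (radialMellin G w' (embedPoint q) * u q) := by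
    intro q
    have he : Set.EqOn (fun r : ℝ => (r : ℂ) ^ (w' - 1) • G (r • embedPoint q) * u q)
        (fun r : ℝ => (r : ℂ) ^ (4 * m + 3) * (((r : ℂ) ^ w * G (r • embedPoint q)) * u q))
        (Set.Ioi 0) := by
      intro r (hr : 0 < r)
      simp only [smul_eq_mul, hpow r hr]
      ring
    have := chartMeasure_radial m (P := fun a => Ψ (a, q))
      (p := fun r : ℝ => ((r : ℂ) ^ w * G (r • embedPoint q)) * u q) (hΨa q)
      (IntegrableOn.congr_fun (Integrable.mul_const (hray q) (u q)) he measurableSet_Ioi)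
    rw [← setIntegral_congr_fun measurableSet_Ioi he, integral_mul_const] at this
    exact this
  -- Integrability: `A` is the radial Mellin transform of `|G|`. It is homogeneous of type `(0,0)`
  -- and bounded on the sphere, hence in `L²` of the chart, and Cauchy–Schwarz against `u`
  -- concludes.
  set A : CN m → ℂ := radialMellin (fun X => (‖G X‖ : ℂ)) (dimN m) with hA
  have hAeq : ∀ X : CN m, A X =
      ((∫ r in Set.Ioi (0 : ℝ), ‖(r : ℂ) ^ (w' - 1) • G (r • X)‖ : ℝ) : ℂ) := by
    intro X
    rw [hA, radialMellin, mellin, ← integral_complex_ofReal]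
    refine setIntegral_congr_fun measurableSet_Ioi fun r (hr : 0 < r) => ?_
    rw [norm_smul, Complex.norm_cpow_eq_rpow_re_of_pos hr, Complex.sub_re, hw're, Complex.ofReal_mul,
      Complex.ofReal_cpow hr.le, smul_eq_mul, dimN_eq_ofReal]
    simp
  have hAm : Measurable A := measurable_radialMellin (by fun_prop) _
  have hAh : IsHomog 0 0 A := by
    intro a ha X _
    rw [hA, radialMellin_smul (d := 0) (fun u hu X => ?_) _ ha, neg_zero, zero_sub, neg_zero]
    rw [hG u hu, norm_mul, norm_zpow, hu]
    simp
  have hA2 : MemLp (nonCompact A) 2 volume := by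
    rw [hAh.memLp_iff (by simp) hAm]
    obtain ⟨C, hC⟩ := exists_integral_ray_le G hw're
    refine MemLp.of_bound (Measurable.aestronglyMeasurable (by fun_prop)) C
      (Filter.Eventually.of_forall fun Y => ?_)
    rw [hAeq, Complex.norm_real, Real.norm_of_nonneg (by positivity)]
    exact hC Y
  have hnorm : ∀ q : HC m, ∫ a, ‖Ψ (a, q)‖ ∂(chartMeasure m) =
      8 * Real.pi * ‖nonCompact A q * u q‖ := by
    intro q
    have he : Set.EqOn
        (fun r : ℝ => ((‖(r : ℂ) ^ (w' - 1) • G (r • embedPoint q)‖ : ℝ) : ℂ) * (‖u q‖ : ℂ))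
        (fun r : ℝ => (r : ℂ) ^ (4 * m + 3) *
          ((‖((r : ℂ) ^ w * G (r • embedPoint q)) * u q‖ : ℝ) : ℂ)) (Set.Ioi 0) := by
      intro r (hr : 0 < r)
      simp only
      rw [norm_smul, hpow r hr, norm_mul, norm_mul, norm_mul, norm_pow, Complex.norm_real,
        Real.norm_of_nonneg hr.le]
      push_cast
      ring
    have := chartMeasure_radial m (P := fun a => ((‖Ψ (a, q)‖ : ℝ) : ℂ))
      (p := fun r : ℝ => ((‖((r : ℂ) ^ w * G (r • embedPoint q)) * u q‖ : ℝ) : ℂ))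
      (fun a ha => by rw [hΨa q a ha])
      (IntegrableOn.congr_fun (Integrable.mul_const (hray q).norm.ofReal _) he measurableSet_Ioi)
    have h2 := this.2
    rw [← setIntegral_congr_fun measurableSet_Ioi he, integral_mul_const, integral_complex_ofReal,
      integral_complex_ofReal] at h2
    rw [nonCompact, norm_mul, hAeq, Complex.norm_real, Real.norm_of_nonneg (by positivity)]
    exact_mod_cast h2
  have hint : Integrable Ψ ((chartMeasure m).prod volume) := by
    rw [integrable_prod_iff' hΨm.aestronglyMeasurable]
    refine ⟨Filter.Eventually.of_forall fun q => (hrad q).1, ?_⟩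
    simp only [hnorm]
    exact ((hA2.integrable_mul hu2).norm).const_mul _
  have hmap := map_chart m
  have hmeas : AEStronglyMeasurable (fun X : CN m => G X * extHom w d u X)
      (Measure.map (fun p : ℂ × HC m => p.1 • embedPoint p.2) ((chartMeasure m).prod volume)) :=
    Measurable.aestronglyMeasurable (by fun_prop)
  constructor
  · rw [← hmap, integrable_map_measure hmeas (by fun_prop)]
    exact hint
  · rw [← hmap, integral_map (by fun_prop) hmeas]
    change ∫ p, Ψ p ∂((chartMeasure m).prod volume) = _
    rw [integral_prod_symm _ hint]
    simp only [(hrad _).2]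
    rw [integral_const_mul]

/-- The exponent cancels the degree of `f`, leaving the bump against `dr/r`. Scale invariance makes
the result independent of `‖X‖`, so this Mellin transform undoes the cutoff. -/
lemma radialMellin_cutoff {m : ℕ} {μ : ℂ} {δ : ℤ} (f : Vsmooth m μ δ) {X : CN m} (hX : X ≠ 0) :
    radialMellin (cutoff f) (μ + dimN m) X = bumpMellin 0 * (f : CN m → ℂ) X := by
  have hX' : 0 < ‖X‖ := norm_pos_iff.2 hX
  have h1 : radialMellin (cutoff f) (μ + dimN m) X =
      mellin (fun r : ℝ => (radialBump (r * ‖X‖) : ℂ)) 0 * (f : CN m → ℂ) X := by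
    rw [radialMellin, mellin, mellin, ← integral_mul_const]
    refine setIntegral_congr_fun measurableSet_Ioi fun r (hr : 0 < r) => ?_
    have hr' : (r : ℂ) ≠ 0 := by exact_mod_cast hr.ne'
    have h2 : (f : CN m → ℂ) (r • X) = (r : ℂ) ^ (-μ - dimN m) * (f : CN m → ℂ) X := by
      rw [← Complex.coe_smul, vsmooth_isHomog f _ hr' _ hX, homChar_ofReal _ _ hr]
    simp only [smul_eq_mul]
    rw [cutoff_apply, h2, norm_smul, Real.norm_of_nonneg hr.le,
      show (0 : ℂ) - 1 = (μ + dimN m - 1) + (-μ - dimN m) by ring, Complex.cpow_add _ _ hr']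
    ring
  rw [h1, mellin_comp_mul_right (fun r : ℝ => (radialBump r : ℂ)) 0 hX', bumpMellin]
  simp

/-! ### Kernels in the splitting `ℂ^N = ℂ^n × ℂ^n` -/

/-- Scaling `(t, X₂) ↦ (2 a t, a X₂)`. -/
def scaleP {m : ℕ} (a : ℂ) (p : ℂ × (Fin m → ℂ)) : ℂ × (Fin m → ℂ) := (2 * a * p.1, a • p.2)

@[fun_prop]
lemma measurable_scaleP {m : ℕ} (a : ℂ) : Measurable (scaleP (m := m) a) := by
  unfold scaleP; fun_prop

lemma map_scaleP (m : ℕ) {a : ℂ} (ha : a ≠ 0) :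
    Measure.map (scaleP (m := m) a) volume =
      ENNReal.ofReal ((4 * ‖a‖ ^ (2 * m + 2))⁻¹) • volume := by
  have h1 := map_complex_smul ℂ volume (c := 2 * a) (by simp [ha])
  have h2 := map_complex_smul (Fin m → ℂ) volume ha
  have : scaleP (m := m) a =
    Prod.map (fun x : ℂ => (2 * a) • x) (fun x : Fin m → ℂ => a • x) := rfl
  rw [this]
  change Measure.map _ (volume.prod volume) = _ • (volume.prod volume)
  rw [← Measure.map_prod_map _ _ (by fun_prop) (by fun_prop), h1, h2]
  simp only [Measure.prod_smul_left, Measure.prod_smul_right, smul_smul]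
  rw [← ENNReal.ofReal_mul (by positivity)]
  congr 2
  simp only [Module.finrank_self, Module.finrank_fin_fun, norm_mul, Complex.norm_ofNat, mul_one]
  rw [← mul_inv]
  congr 1
  ring

lemma measurableEmbedding_scaleP (m : ℕ) {a : ℂ} (ha : a ≠ 0) :
    MeasurableEmbedding (scaleP (m := m) a) :=
  ((Homeomorph.mulLeft₀ (2 * a) (by simp [ha])).prodCongr
    (Homeomorph.smulOfNeZero a ha)).measurableEmbedding

lemma integral_comp_scaleP {m : ℕ} {a : ℂ} (ha : a ≠ 0) (K : ℂ × (Fin m → ℂ) → ℂ) :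
    ∫ p, K p = ((4 * ‖a‖ ^ (2 * m + 2) : ℝ) : ℂ) * ∫ p, K (scaleP a p) := by
  have h := (measurableEmbedding_scaleP m ha).integral_map (μ := volume) K
  rw [map_scaleP m ha, integral_smul_measure, ENNReal.toReal_ofReal (by positivity)] at h
  rw [← h, Complex.real_smul, ← mul_assoc, ← Complex.ofReal_mul,
    mul_inv_cancel₀ (by positivity), Complex.ofReal_one, one_mul]

lemma integrable_comp_scaleP {m : ℕ} {a : ℂ} (ha : a ≠ 0) {K : ℂ × (Fin m → ℂ) → ℂ}
    (hK : Integrable K) : Integrable fun p => K (scaleP a p) := by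
  have h := (measurableEmbedding_scaleP m ha).integrable_map_iff (μ := volume) (g := K)
  rw [map_scaleP m ha] at h
  exact h.1 (hK.smul_measure ENNReal.ofReal_ne_top)

/-- The kernel of the homogeneous extension of a partial Fourier transform. -/
def kern {m : ℕ} (μ : ℂ) (δ : ℤ) (ψ : HC m → ℂ) (y η : WC m) : ℂ :=
  4 * homChar μ δ (y 0) *
    ψ (2 * y 0 * η 0, fun i => y i.succ / y 0, fun i => y 0 * η i.succ)

lemma kern_consW {m : ℕ} (μ : ℂ) (δ : ℤ) (ψ : HC m → ℂ) (y : WC m) (p : ℂ × (Fin m → ℂ)) :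
    kern μ δ ψ y (consW m p) = 4 * homChar μ δ (y 0) *
      ψ ((scaleP (y 0) p).1, fun i => y i.succ / y 0, (scaleP (y 0) p).2) := by
  rw [kern, consW_apply]
  rfl

lemma integrable_kern {m : ℕ} (μ : ℂ) (δ : ℤ) (ψ : 𝓢(HC m, ℂ)) {y : WC m} (hy : y 0 ≠ 0) :
    Integrable (kern μ δ ψ y) := by
  have hc := volume_preserving_consW m
  rw [← hc.integrable_comp_emb (consW m).measurableEmbedding]
  have h1 : Integrable fun p : ℂ × (Fin m → ℂ) => ψ (p.1, (fun i => y i.succ / y 0), p.2) := by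
    have := (schwartzSlice ψ (fun i => y i.succ / y 0)).integrable (μ := volume)
    rw [← hc.integrable_comp_emb (consW m).measurableEmbedding] at this
    refine this.congr (Filter.Eventually.of_forall fun p => ?_)
    simp only [Function.comp, schwartzSlice_apply, sliceHC_consW]
  refine ((integrable_comp_scaleP hy h1).const_mul (4 * homChar μ δ (y 0))).congr
    (Filter.Eventually.of_forall fun p => ?_)
  exact (kern_consW μ δ ψ y p).symm

lemma chartPoint_joinW {m : ℕ} (y y' : WC m) :
    chartPoint (joinW m (y, y')) =
      (y' 0 / (2 * y 0), fun i => y i.succ / y 0, fun i => y' i.succ / y 0) := by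
  rw [joinW_apply]
  rfl

/-- The substitution `t = 2y₀η₀`, `X₂ = y₀η'` turns the exponent into `Re⟨η,y'⟩`, the 2 matching the
coordinate `2t` of the chart. Its Jacobian `4|y₀|^{2m+2} = 4|y₀|^N` cancels the `-N` in the degree
and leaves a kernel with the unitary character of `y₀`. -/
lemma extHom_partialFourierIntegral {m : ℕ} (μ : ℂ) (δ : ℤ) (ψ : HC m → ℂ) {y : WC m}
    (hy : y 0 ≠ 0) (y' : WC m) :
    extHom (μ - dimN m) δ (partialFourierIntegral ψ) (joinW m (y, y')) =
      WF (kern μ δ ψ y) y' := by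
  have hy' : (‖y 0‖ : ℂ) ≠ 0 := by simpa using hy
  have h0 : (joinW m (y, y')) (Sum.inl 0) = y 0 := by rw [joinW_apply]; rfl
  have hch : homChar (μ - dimN m) δ (y 0) * ((4 * ‖y 0‖ ^ (2 * m + 2) : ℝ) : ℂ) =
      4 * homChar μ δ (y 0) := by
    have h2 : (‖y 0‖ : ℂ) ^ μ = (‖y 0‖ : ℂ) ^ (μ - dimN m) * (‖y 0‖ : ℂ) ^ (2 * m + 2) := by
      rw [← Complex.cpow_natCast, ← Complex.cpow_add _ _ hy', dimN]
      congr 1; push_cast; ring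
    rw [homChar, homChar, h2]
    push_cast
    ring
  rw [extHom, h0, chartPoint_joinW, partialFourierIntegral, integral_comp_scaleP hy, ← mul_assoc,
    hch, WF, ← (volume_preserving_consW m).integral_comp (consW m).measurableEmbedding,
    ← integral_const_mul]
  refine integral_congr_ae (Filter.Eventually.of_forall fun p => ?_)
  simp only [kern_consW, ← mul_assoc, expC]
  congr 4
  rw [pairW, consW_apply, Fin.sum_univ_succ]
  simp only [scaleP, Fin.cons_zero, Fin.cons_succ, Pi.smul_apply, smul_eq_mul]
  congr 2
  · field_simp
  · refine Finset.sum_congr rfl fun i _ => ?_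
    field_simp

lemma ae_apply_zero_ne_zero (m : ℕ) : ∀ᵐ y : WC m, y 0 ≠ 0 := by
  have h0 : ∀ᵐ a : ℂ, a ≠ 0 := by simp [ae_iff, measure_singleton]
  have h1 : ∀ᵐ p : ℂ × (Fin m → ℂ), p.1 ≠ 0 := Measure.quasiMeasurePreserving_fst.ae h0
  have h2 := ((volume_preserving_consW m).symm (consW m)).quasiMeasurePreserving.ae h1
  filter_upwards [h2] with y hy
  rwa [consW_symm_apply] at hy

lemma integrable_joinW {m : ℕ} {H : CN m → ℂ} (hH : Integrable H) :
    Integrable (fun p : WC m × WC m => H (joinW m p)) (volume.prod volume) :=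
  ((volume_preserving_joinW m).integrable_comp_emb (joinW m).measurableEmbedding).2 hH

lemma integral_mul_extHom_eq_kern {m : ℕ} (μ : ℂ) (δ : ℤ) (ψ : 𝓢(HC m, ℂ)) (H : 𝓢(CN m, ℂ))
    (hi : Integrable fun X : CN m =>
      H X * extHom (μ - dimN m) δ (partialFourierIntegral ψ) X) :
    ∫ X : CN m, H X * extHom (μ - dimN m) δ (partialFourierIntegral ψ) X =
      ∫ y : WC m, ∫ η : WC m, WF (fun y' => H (joinW m (y, y'))) η * kern μ δ ψ y η := by
  rw [← (volume_preserving_joinW m).integral_comp (joinW m).measurableEmbedding]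
  change ∫ p : WC m × WC m, _ ∂(volume.prod volume) = _
  rw [integral_prod _ (integrable_joinW hi)]
  refine integral_congr_ae ?_
  filter_upwards [ae_apply_zero_ne_zero m, (integrable_joinW H.integrable).prod_right_ae]
    with y hy hH
  rw [integral_WF_mul hH (integrable_kern μ δ ψ hy)]
  simp only [extHom_partialFourierIntegral μ δ ψ hy]

/-- The algebraic core. Put `s = 2x₀y₀`, which is symmetric in `x` and `y`. Then `(2/s) x₀y' =
y'/y₀` and `(s/2) x'/x₀ = y₀x'`, and the character of `s/2 = x₀y₀` divided by that of `x₀` is that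
of `y₀`. -/
lemma kern_algebraicFun {m : ℕ} (μ : ℂ) (δ : ℤ) (ψ : HC m → ℂ) {x y : WC m} (hx : x 0 ≠ 0)
    (hy : y 0 ≠ 0) : kern (-μ) (-δ) (algebraicFun μ δ ψ) x y = kern μ δ ψ y x := by
  have h1 : swapHC ((2 * x 0 * y 0, fun i => x i.succ / x 0, fun i => x 0 * y i.succ) : HC m) =
      (2 * y 0 * x 0, fun i => y i.succ / y 0, fun i => y 0 * x i.succ) := by
    refine Prod.ext ?_ (Prod.ext ?_ ?_)
    · simp only [swapHC]; ring
    · funext i; simp only [swapHC, Pi.smul_apply, smul_eq_mul]; field_simp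
    · funext i; simp only [swapHC, Pi.smul_apply, smul_eq_mul]; field_simp
  have h2 : 2 * x 0 * y 0 / 2 = x 0 * y 0 := by ring
  rw [kern, kern, algebraicFun_eq, h1, homChar_neg]
  simp only [h2]
  rw [homChar_mul]
  have := homChar_ne_zero μ δ hx
  field_simp

/-! ### The symplectic Fourier transform on slices -/

lemma norm_le_norm_joinW_left {m : ℕ} (x x' : WC m) : ‖x‖ ≤ ‖joinW m (x, x')‖ := by
  rw [EuclideanSpace.norm_eq, EuclideanSpace.norm_eq, joinW_apply]
  refine Real.sqrt_le_sqrt ?_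
  rw [Fintype.sum_sum_type]
  simp only [Sum.elim_inl, Sum.elim_inr]
  exact le_add_of_nonneg_right (by positivity)

lemma norm_le_norm_joinW_right {m : ℕ} (x x' : WC m) : ‖x'‖ ≤ ‖joinW m (x, x')‖ := by
  rw [EuclideanSpace.norm_eq, EuclideanSpace.norm_eq, joinW_apply]
  refine Real.sqrt_le_sqrt ?_
  rw [Fintype.sum_sum_type]
  simp only [Sum.elim_inl, Sum.elim_inr]
  exact le_add_of_nonneg_left (by positivity)

lemma continuous_joinW (m : ℕ) : Continuous (joinW m) := by
  have : (joinW m : WC m × WC m → CN m) = fun p => WithLp.toLp 2 (Sum.elim p.1 p.2) := by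
    ext1 p; exact joinW_apply p
  rw [this]
  refine (PiLp.continuous_toLp 2 _).comp (continuous_pi fun i => ?_)
  rcases i with i | i <;> simp only [Sum.elim_inl, Sum.elim_inr] <;> fun_prop

lemma omega_joinW {m : ℕ} (x x' y y' : WC m) :
    (omega (joinW m (x, x')) (joinW m (y, y'))).re = pairW x' y + pairW x (-y') := by
  rw [omega, joinW_apply, joinW_apply, pairW, pairW]
  simp [sub_eq_add_neg]

lemma sympFT_joinW {m : ℕ} (F : 𝓢(CN m, ℂ)) (y y' : WC m) :
    sympFT F (joinW m (y, y')) = WF (fun x => WF (fun x' => F (joinW m (x, x'))) y) (-y') := by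
  rw [sympFT_apply, ← (volume_preserving_joinW m).integral_comp (joinW m).measurableEmbedding]
  change ∫ p : WC m × WC m, _ ∂(volume.prod volume) = _
  have hi : Integrable (fun X : CN m => F X * expC (omega X (joinW m (y, y'))).re) := by
    refine F.integrable.mul_bdd (c := 1) ?_ (Filter.Eventually.of_forall fun X => (norm_expC _).le)
    simp only [← omegaForm_apply]
    have h1 := (omegaForm (joinW m (y, y'))).continuous
    exact (continuous_expC.comp h1).aestronglyMeasurable
  rw [integral_prod _ (integrable_joinW hi), WF]
  refine integral_congr_ae (Filter.Eventually.of_forall fun x => ?_)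
  simp only [WF, omega_joinW, expC_add]
  rw [← integral_mul_const]
  refine integral_congr_ae (Filter.Eventually.of_forall fun x' => ?_)
  simp only
  ring

lemma continuous_WF_slice {m : ℕ} (F : 𝓢(CN m, ℂ)) {R : ℝ} (hR : ∀ X, R ≤ ‖X‖ → F X = 0) :
    Continuous fun p : WC m × WC m => WF (fun x' => F (joinW m (p.1, x'))) p.2 := by
  have hF := F.continuous
  have hj := continuous_joinW m
  obtain ⟨C, -, hC⟩ := F.decay 0 0
  simp only [pow_zero, one_mul, norm_iteratedFDeriv_zero] at hC
  unfold WF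
  refine continuous_of_dominated
    (bound := (Metric.closedBall (0 : WC m) R).indicator fun _ => C) ?_ ?_ ?_ ?_
  · exact fun p => Continuous.aestronglyMeasurable (by fun_prop)
  · refine fun p => Filter.Eventually.of_forall fun x' => ?_
    rw [norm_mul, norm_expC, mul_one]
    by_cases hx : x' ∈ Metric.closedBall (0 : WC m) R
    · rw [Set.indicator_of_mem hx]; exact hC _
    · rw [Set.indicator_of_notMem hx, norm_le_zero_iff]
      refine hR _ ?_
      rw [mem_closedBall_zero_iff, not_le] at hx
      exact hx.le.trans (norm_le_norm_joinW_right _ _)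
  · rw [integrable_indicator_iff Metric.isClosed_closedBall.measurableSet]
    exact integrableOn_const (isCompact_closedBall _ _).measure_lt_top.ne
  · exact Filter.Eventually.of_forall fun x' => by fun_prop

/-- `sympFT F (y, ·)` is itself the Fourier transform, at `-y'`, of the partial transform of `F`
evaluated at `y`, so Fourier inversion in the first half gives the exchange of variables. Compact
support makes that partial transform continuous and integrable; integrability of the slice of
`sympFT F` comes from Fubini, hence only for almost every `y`. -/
lemma ae_WF_sympFT {m : ℕ} (F : 𝓢(CN m, ℂ)) {R : ℝ} (hR : ∀ X, R ≤ ‖X‖ → F X = 0) :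
    ∀ᵐ y : WC m, Integrable (fun y' => sympFT F (joinW m (y, y'))) ∧
      ∀ x, WF (fun y' => sympFT F (joinW m (y, y'))) x = WF (fun x' => F (joinW m (x, x'))) y := by
  filter_upwards [(integrable_joinW (sympFT F).integrable).prod_right_ae] with y hy
  refine ⟨hy, fun x => ?_⟩
  set g : WC m → ℂ := fun x => WF (fun x' => F (joinW m (x, x'))) y with hg
  have hgc : Continuous g := (continuous_WF_slice F hR).comp (Continuous.prodMk_left y)
  have hgs : HasCompactSupport g := by
    refine HasCompactSupport.intro (isCompact_closedBall (0 : WC m) R) fun x hx => ?_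
    rw [mem_closedBall_zero_iff, not_le] at hx
    simp only [hg, WF]
    refine integral_eq_zero_of_ae (Filter.Eventually.of_forall fun x' => ?_)
    simp [hR _ (hx.le.trans (norm_le_norm_joinW_left x x'))]
  have h1 : ∀ y', sympFT F (joinW m (y, y')) = WF g (-y') := sympFT_joinW F y
  have h2 : Integrable (WF g) := by
    have := hy.comp_neg
    refine this.congr (Filter.Eventually.of_forall fun y' => ?_)
    simp only
    rw [h1, neg_neg]
  simp only [h1]
  exact WF_WF_neg hgc (hgc.integrable_of_hasCompactSupport hgs) h2 x

lemma measurable_kern {m : ℕ} (μ : ℂ) (δ : ℤ) {ψ : HC m → ℂ} (hψ : Measurable ψ) :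
    Measurable fun p : WC m × WC m => kern μ δ ψ p.1 p.2 := by
  unfold kern
  have h1 : ∀ i, Measurable fun p : WC m × WC m => p.1 i := fun i => by fun_prop
  have h2 : ∀ i, Measurable fun p : WC m × WC m => p.2 i := fun i => by fun_prop
  fun_prop

lemma norm_kern_le {m : ℕ} {μ : ℂ} (hμ : μ.re = 0) (δ : ℤ) {ψ : HC m → ℂ} {C : ℝ}
    (hC : ∀ q, ‖ψ q‖ ≤ C) {y : WC m} (hy : y 0 ≠ 0) (η : WC m) : ‖kern μ δ ψ y η‖ ≤ 4 * C := by
  rw [kern, norm_mul, norm_mul, norm_homChar _ _ hy, hμ, Real.rpow_zero, mul_one]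
  simp only [Complex.norm_ofNat]
  gcongr
  exact hC _

lemma integral_sympFT_mul_extHom {m : ℕ} {μ : ℂ} (hμ : μ.re = 0) (δ : ℤ) (F : 𝓢(CN m, ℂ)) {R : ℝ}
    (hR : ∀ X, R ≤ ‖X‖ → F X = 0) (ψ ψ' : 𝓢(HC m, ℂ))
    (hψ : (ψ' : HC m → ℂ) = algebraicFun μ δ ψ)
    (h1 : Integrable fun X : CN m =>
      sympFT F X * extHom (μ - dimN m) δ (partialFourierIntegral ψ) X)
    (h2 : Integrable fun X : CN m =>
      F X * extHom (-μ - dimN m) (-δ) (partialFourierIntegral ψ') X) :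
    ∫ X : CN m, sympFT F X * extHom (μ - dimN m) δ (partialFourierIntegral ψ) X =
      ∫ X : CN m, F X * extHom (-μ - dimN m) (-δ) (partialFourierIntegral ψ') X := by
  rw [integral_mul_extHom_eq_kern μ δ ψ _ h1, integral_mul_extHom_eq_kern (-μ) (-δ) ψ' _ h2, hψ]
  have hae := ae_WF_sympFT F hR
  have h0 := ae_apply_zero_ne_zero m
  set G : WC m → WC m → ℂ := fun x y => WF (fun x' => F (joinW m (x, x'))) y with hG
  have hGc : Continuous fun p : WC m × WC m => G p.1 p.2 := continuous_WF_slice F hR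
  obtain ⟨C, -, hC⟩ := ψ.decay 0 0
  simp only [pow_zero, one_mul, norm_iteratedFDeriv_zero] at hC
  have hG0 : ∀ x y, R < ‖x‖ → G x y = 0 := by
    intro x y hx
    simp only [hG, WF]
    refine integral_eq_zero_of_ae (Filter.Eventually.of_forall fun x' => ?_)
    simp [hR _ (hx.le.trans (norm_le_norm_joinW_left x x'))]
  -- The kernel is bounded by `4C` but need not decay. Integrability in `x` comes from the compact
  -- support of `F`, and in `y` from `|G x y| ≤ ∫ |sympFT F (y,y')| dy'`, a consequence of the
  -- exchange identity.
  have hint : Integrable (fun p : WC m × WC m => G p.2 p.1 * kern μ δ ψ p.1 p.2)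
      (volume.prod volume) := by
    have hb1 := ((integrable_joinW (sympFT F).integrable).norm.integral_prod_left)
    have hb2 : Integrable ((Metric.closedBall (0 : WC m) R).indicator fun _ => 4 * C) := by
      rw [integrable_indicator_iff Metric.isClosed_closedBall.measurableSet]
      exact integrableOn_const (isCompact_closedBall _ _).measure_lt_top.ne
    refine (hb1.mul_prod hb2).mono' ?_ ?_
    · have hk := measurable_kern μ δ (ψ := ψ) ψ.continuous.measurable
      exact ((hGc.comp continuous_swap).measurable.mul hk).aestronglyMeasurable
    · filter_upwards [Measure.quasiMeasurePreserving_fst.ae hae,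
        Measure.quasiMeasurePreserving_fst.ae h0] with p hp hp0
      by_cases hx : p.2 ∈ Metric.closedBall (0 : WC m) R
      · rw [Set.indicator_of_mem hx, norm_mul]
        refine mul_le_mul ?_ (norm_kern_le hμ δ hC hp0 _) (norm_nonneg _) (by positivity)
        rw [hG]
        simp only
        rw [← hp.2 p.2, WF]
        refine (norm_integral_le_integral_norm _).trans (le_of_eq ?_)
        refine integral_congr_ae (Filter.Eventually.of_forall fun y' => ?_)
        simp only [norm_mul, norm_expC, mul_one]
      · rw [Set.indicator_of_notMem hx, hG0, zero_mul, norm_zero, mul_zero]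
        rwa [mem_closedBall_zero_iff, not_le] at hx
  calc ∫ y : WC m, ∫ η : WC m, WF (fun y' => sympFT F (joinW m (y, y'))) η * kern μ δ ψ y η
      = ∫ y : WC m, ∫ x : WC m, G x y * kern μ δ ψ y x := by
        refine integral_congr_ae ?_
        filter_upwards [hae] with y hy
        simp only [hy.2, hG]
    _ = ∫ x : WC m, ∫ y : WC m, G x y * kern μ δ ψ y x := integral_integral_swap hint
    _ = _ := by
        refine integral_congr_ae ?_
        filter_upwards [h0] with x hx
        refine integral_congr_ae ?_
        filter_upwards [h0] with y hy
        rw [kern_algebraicFun μ δ ψ hx hy]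

/-! ### The normalised Knapp-Stein operator in the non-standard model -/

/-- Both integrals of `integral_sympFT_mul_extHom` are read in the chart. Each carries the same
factor `8π · bumpMellin 0`: on the left it is the normalisation of `normalizedFun`, on the right it
is what the cutoff of `f` contributes. -/
lemma integral_nonCompact_normalizedFun {m : ℕ} {μ : ℂ} (hμ : μ.re = 0) {δ : ℤ}
    (f : Vsmooth m (-μ) (-δ)) (ψ ψ' : 𝓢(HC m, ℂ)) (hψ : (ψ' : HC m → ℂ) = algebraicFun μ δ ψ) :
    ∫ q : HC m, nonCompact (normalizedFun f) q * partialFourierIntegral ψ q =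
      ∫ q : HC m, nonCompact (f : CN m → ℂ) q * partialFourierIntegral ψ' q := by
  have hF : ∀ u : ℂ, ‖u‖ = 1 → ∀ X, cutoff f (u • X) = u ^ δ * cutoff f X := fun u hu X => by
    rw [cutoff_unit_smul f hu, neg_neg]
  have hm : ∀ ψ : 𝓢(HC m, ℂ), Measurable (partialFourierIntegral ψ) := fun ψ =>
    (stronglyMeasurable_partialFourierIntegral ψ.continuous.measurable).measurable
  obtain ⟨h1, h2⟩ := integral_mul_extHom (sympFT (cutoff f)) (d := δ) (w := μ - dimN m)
    (fun u hu X => sympFT_unit_smul hF hu X) (by rw [Complex.sub_re, hμ, zero_sub]) (hm ψ)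
    (memLp_partialFourierIntegral ψ)
  obtain ⟨h3, h4⟩ := integral_mul_extHom (cutoff f) (d := -δ) (w := -μ - dimN m)
    (fun u hu X => by rw [hF u hu, neg_neg]) (by rw [Complex.sub_re, Complex.neg_re, hμ]; simp)
    (hm ψ') (memLp_partialFourierIntegral ψ')
  have h5 := integral_sympFT_mul_extHom hμ δ (cutoff f) (R := 3) (fun X hX => by
    rw [cutoff_apply, radialBump_eq_zero (Or.inr hX)]; simp) ψ ψ' hψ h1 h3
  have hb := bumpMellin_zero_ne_zero
  have h6 : ∀ q : HC m, radialMellin (sympFT (cutoff f)) (μ - dimN m + 2 * dimN m) (embedPoint q) *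
      partialFourierIntegral ψ q =
      bumpMellin 0 * (nonCompact (normalizedFun f) q * partialFourierIntegral ψ q) := by
    intro q
    rw [nonCompact, normalizedFun, show μ - dimN m + 2 * dimN m = μ + dimN m by ring]
    field_simp
  have h7 : ∀ q : HC m, radialMellin (cutoff f) (-μ - dimN m + 2 * dimN m) (embedPoint q) *
      partialFourierIntegral ψ' q =
      bumpMellin 0 * (nonCompact (f : CN m → ℂ) q * partialFourierIntegral ψ' q) := by
    intro q
    rw [nonCompact, show -μ - dimN m + 2 * dimN m = -μ + dimN m by ring,
      radialMellin_cutoff f (embedPoint_ne_zero q), mul_assoc]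
  simp only [h6] at h2
  simp only [h7] at h4
  rw [h2, h4, integral_const_mul, integral_const_mul] at h5
  have hpi : (8 * Real.pi : ℂ) ≠ 0 := by simp [Real.pi_ne_zero]
  exact mul_left_cancel₀ hb (mul_left_cancel₀ hpi h5)

lemma PF_normalizedFun {m : ℕ} {μ : ℂ} (hμ : μ.re = 0) {δ : ℤ} (f : Vsmooth m (-μ) (-δ))
    (hf : MemLp (nonCompact (f : CN m → ℂ)) 2 volume) :
    PF m ((memLp_normalizedFun hμ f).toLp _) = AO m hμ δ (PF m (hf.toLp _)) := by
  rw [← sub_eq_zero]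
  set D : L2 m := PF m ((memLp_normalizedFun hμ f).toLp _) - AO m hμ δ (PF m (hf.toLp _)) with hD
  have hU : IsOpen {q : HC m | q.1 ≠ 0} := isOpen_ne_fun continuous_fst continuous_const
  have hloc : LocallyIntegrableOn (D : HC m → ℂ) {q : HC m | q.1 ≠ 0} volume :=
    ((Lp.memLp D).locallyIntegrable one_le_two).locallyIntegrableOn _
  -- Test functions are supported away from `s = 0` so that `Tψ` is again smooth with compact
  -- support, hence Schwartz. The excluded set is null.
  have hae := hU.ae_eq_zero_of_integral_contDiff_smul_eq_zero hloc fun ψ₀ hs hc hsub => ?_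
  · rw [Lp.eq_zero_iff_ae_eq_zero]
    filter_upwards [hae, ae_fst_ne_zero m] with q hq hq0 using hq hq0
  set φ : HC m → ℂ := fun q => (ψ₀ q : ℂ) with hφ
  have hφs : ContDiff ℝ ∞ φ := Complex.ofRealCLM.contDiff.comp hs
  have hφc : HasCompactSupport φ := hc.comp_left (g := fun x : ℝ => (x : ℂ)) Complex.ofReal_zero
  have hφU : tsupport φ ⊆ {q | q.1 ≠ 0} := by
    refine (closure_mono fun q hq => ?_).trans hsub
    simpa [hφ] using hq
  let ψ : 𝓢(HC m, ℂ) := hφc.toSchwartzMap hφs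
  let ψ' : 𝓢(HC m, ℂ) := (hasCompactSupport_algebraicFun μ δ hφc hφU).toSchwartzMap
    (contDiff_algebraicFun μ δ hφs hφc hφU)
  have hψ : (ψ' : HC m → ℂ) = algebraicFun μ δ ψ := rfl
  have h1 : ∫ q, ψ₀ q • D q = pair2 m D ((ψ.memLp 2 volume).toLp ψ) := by
    rw [pair2_apply]
    refine integral_congr_ae ?_
    filter_upwards [(ψ.memLp 2 volume).coeFn_toLp] with q hq
    rw [hq, Complex.real_smul, mul_comm]
    rfl
  have h2 : AO m hμ δ ((ψ.memLp 2 volume).toLp ψ) = (ψ'.memLp 2 volume).toLp ψ' := AO_toLp hμ δ _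
  rw [h1, hD, map_sub, sub_apply, pair2_PF, pair2_AO, h2, pair2_PF, PF_toLp,
    PF_toLp, pair2_toLp, pair2_toLp, integral_nonCompact_normalizedFun hμ f ψ ψ' hψ, sub_self]

/-- The normalised Knapp-Stein operator. -/
def KS (m : ℕ) {μ : ℂ} (hμ : μ.re = 0) (δ : ℤ) : V m (-μ) (-δ) →L[ℂ] V m μ δ :=
  ((ALEquiv m hμ δ).symm : L2 m →L[ℂ] V m μ δ).comp
    ((AO m hμ δ).comp (AL m (μ := -μ) (by simp [hμ]) (-δ)))

lemma AL_comp_KS (m : ℕ) {μ : ℂ} (hμ : μ.re = 0) (δ : ℤ) :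
    (AL m hμ δ).comp (KS m hμ δ) = (AO m hμ δ).comp (AL m (μ := -μ) (by simp [hμ]) (-δ)) := by
  ext1 w
  exact (ALEquiv m hμ δ).apply_symm_apply _

/-- `α⁻¹Tα` and `normalizedFun f` have the same image under `𝓕` in the chart. Injectivity of `𝓕` and
the comparison of chart and sphere then make them agree almost everywhere on the sphere. -/
lemma isNormalizedKS_KS (m : ℕ) {μ : ℂ} (hμ : μ.re = 0) (δ : ℤ) :
    IsNormalizedKS m μ δ (KS m hμ δ) := by
  intro f
  have hμ' : (-μ).re = 0 := by simp [hμ]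
  refine ⟨fun Y => normalizedFun f Y, isNormalizedKSValue_normalizedFun hμ f, ?_⟩
  refine ae_eq_of_chartL_eq hμ (isHomog_normalizedFun f) (measurable_normalizedFun f)
    (memLp_normalizedFun hμ f) _ (PF_injective m ?_)
  rw [PF_normalizedFun hμ f (vsmooth_memLp_nonCompact hμ' f), ← chartL_toV hμ' f]
  exact DFunLike.congr_fun (AL_comp_KS m hμ δ) (toV f)

lemma IsNormalizedKS.eq_KS {m : ℕ} {μ : ℂ} (hμ : μ.re = 0) {δ : ℤ}
    {S : V m (-μ) (-δ) →L[ℂ] V m μ δ} (hS : IsNormalizedKS m μ δ S) : S = KS m hμ δ := by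
  refine ContinuousLinearMap.coeFn_injective
    ((denseRange_toVL m (-μ) (-δ)).equalizer S.continuous (KS m hμ δ).continuous ?_)
  ext1 f
  obtain ⟨g, hg, hg'⟩ := hS f
  obtain ⟨k, hk, hk'⟩ := isNormalizedKS_KS m hμ δ f
  have hgk : g = k := funext fun Y => (hg Y).unique (hk Y)
  refine Subtype.ext (Lp.ext (hg'.trans ?_))
  rw [hgk]
  exact hk'.symm

lemma normalizedKS_eq (m : ℕ) {μ : ℂ} (hμ : μ.re = 0) (δ : ℤ) : normalizedKS m μ δ = KS m hμ δ :=
  IsNormalizedKS.eq_KS hμ (Classical.epsilon_spec ⟨_, isNormalizedKS_KS m hμ δ⟩)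

end

end KnappStein

/-- The first five clauses say that the operators of the diagram are well defined; the last one is
the commutativity of the diagram. -/
theorem theorem4p2 (m : ℕ) (μ : ℂ) (hμ : μ.re = 0) (δ : ℤ) :
    (∃! P : KnappStein.L2 m →L[ℂ] KnappStein.L2 m, KnappStein.IsPartialFourier m P) ∧
    (∃! A : KnappStein.V m (-μ) (-δ) →L[ℂ] KnappStein.L2 m, KnappStein.IsAlpha m (-μ) (-δ) A) ∧
    (∃! A : KnappStein.V m μ δ →L[ℂ] KnappStein.L2 m, KnappStein.IsAlpha m μ δ A) ∧
    (∃! S : KnappStein.V m (-μ) (-δ) →L[ℂ] KnappStein.V m μ δ,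
      KnappStein.IsNormalizedKS m μ δ S) ∧
    (∃! T : KnappStein.L2 m →L[ℂ] KnappStein.L2 m, KnappStein.IsAlgebraicOp m μ δ T) ∧
    (KnappStein.alpha m μ δ).comp (KnappStein.normalizedKS m μ δ) =
      (KnappStein.algebraicOp m μ δ).comp (KnappStein.alpha m (-μ) (-δ)) := by
  have hμ' : (-μ).re = 0 := by simp [hμ]
  refine ⟨⟨KnappStein.PF m, KnappStein.isPartialFourier_PF m, fun P hP => hP.eq_PF⟩,
    ⟨KnappStein.AL m hμ' (-δ), KnappStein.isAlpha_AL m hμ' (-δ), fun A hA => hA.eq_AL hμ'⟩,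
    ⟨KnappStein.AL m hμ δ, KnappStein.isAlpha_AL m hμ δ, fun A hA => hA.eq_AL hμ⟩,
    ⟨KnappStein.KS m hμ δ, KnappStein.isNormalizedKS_KS m hμ δ, fun S hS => hS.eq_KS hμ⟩,
    ⟨KnappStein.AO m hμ δ, KnappStein.isAlgebraicOp_AO m hμ δ, fun T hT => hT.eq_AO hμ⟩, ?_⟩
  rw [KnappStein.alpha_eq m hμ δ, KnappStein.alpha_eq m hμ' (-δ), KnappStein.normalizedKS_eq m hμ δ,
    KnappStein.algebraicOp_eq m hμ δ]
  exact KnappStein.AL_comp_KS m hμ δ
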